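/- Let $\mathcal M=(M,\mathcal O_{\mathcal M})$ be a compact complex supermanifold of dimension $(m|n)$: $M$ is a compact complex manifold of dimension $m$ and $\mathcal O_{\mathcal M}$ is a sheaf of $\mathbb Z/2$-graded $\mathbb C$-algebras on $M$ such that every point of $M$ has an open neighbourhood $W$ with an isomorphism $\mathcal O_{W}\otimes\bigwedge\mathbb C^n\cong\mathcal O_{\mathcal M}|_W$ of sheaves of $\mathbb Z/2$-graded $\mathbb C$-algebras, where $\mathcal O_W$ is the sheaf of holomorphic functions on $W$. Such an isomorphism over an open set $W\subseteq M$ is called a system of local odd coordinates $\theta=(\theta_1,\dots,\theta_n)$ on $W$, where $\theta_j$ is the image of the $j$-th standard basis vector of $\mathbb C^n$; with respect to it, every section $s\in\mathcal O_{\mathcal M}(V)$ over an open set $V\subseteq W$ has a unique expansion $s=\sum_{\nu\in(\mathbb Z/2)^n}s_\nu\theta^\nu$ with holomorphic functions $s_\nu$ on $V$. Let $\mathrm{Aut}_{\bar 0}(\mathcal M)$ be the set of automorphisms $\varphi=(\tilde\varphi,\varphi^*)$ of $\mathcal M$, that is, of invertible morphisms consisting of a continuous map $\tilde\varphi:M\to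 M$ and a parity-preserving morphism $\varphi^*:\mathcal O_{\mathcal M}\to\tilde\varphi_*\mathcal O_{\mathcal M}$ of sheaves of $\mathbb C$-algebras. Let $K\subseteq M$ be compact, let $\theta_1,\dots,\theta_n$ be local odd coordinates on an open neighbourhood $W$ of $K$, let $U\subseteq M$ be open, let $f\in\mathcal O_{\mathcal M}(U)$, and let $U_\nu\subseteq\mathbb C$ be open for $\nu\in(\mathbb Z/2)^n$. Put $$\Delta(K,U,f,\theta_j,U_\nu)=\{\varphi\in\mathrm{Aut}_{\bar 0}(\mathcal M)\mid \tilde\varphi(K)\subseteq U,\ \varphi_{f,\nu}(K)\subseteq U_\nu\text{ for all }\nu\},$$ where $\varphi^*(f)=\sum_\nu\varphi_{f,\nu}\theta^\nu$ is the expansion on $W\cap\tilde\varphi^{-1}(U)$. Endow $\mathrm{Aut}_{\bar 0}(\mathcal M)$ with the topology for which the sets $\Delta(K,U,f,\theta_j,U_\nu)$ form a subbase. Then the topological space $\mathrm{Aut}_{\bar 0}(\mathcal M)$ is locally compact. -/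

import Mathlib

open CategoryTheory TopologicalSpace Opposite AlgebraicGeometry
open scoped Manifold ContDiff TensorProduct

universe u

noncomputable section

namespace Supergeometry

/-- The algebra `𝒪_M(V)` of holomorphic (that is, complex-analytic) functions on an open subset `V`
of a complex manifold `M` of dimension `m`. -/
abbrev Hol (m : ℕ) {M : Type u} [TopologicalSpace M] [ChartedSpace (EuclideanSpace ℂ (Fin m)) M]
    (V : Opens M) : Type u :=
  C^ω⟮𝓘(ℂ, EuclideanSpace ℂ (Fin m)), V; 𝓘(ℂ, ℂ), ℂ⟯

/-- Restriction of holomorphic functions to a smaller open subset. -/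
abbrev Hol.res {m : ℕ} {M : Type u} [TopologicalSpace M]
    [ChartedSpace (EuclideanSpace ℂ (Fin m)) M] {V' V : Opens M} (h : V' ≤ V) :
    Hol m V →+* Hol m V' :=
  ContMDiffMap.restrictRingHom 𝓘(ℂ, EuclideanSpace ℂ (Fin m)) 𝓘(ℂ, ℂ) ℂ h

/-- The Grassmann algebra `⋀ ℂⁿ`. -/
abbrev Grassmann (n : ℕ) : Type := ExteriorAlgebra ℂ (Fin n → ℂ)

/-- The basis `θ^ν` of `⋀ ℂⁿ`. A multi-index `ν ∈ (ℤ/2)ⁿ` is encoded as the subset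
`{j | ν_j = 1}` of `Fin n`, and `θ^ν = θ_{j₁} ∧ … ∧ θ_{j_k}` for `ν = {j₁ < … < j_k}`, where
`θ_1, …, θ_n` is the standard basis of `ℂⁿ`. -/
def grassmannBasis (n : ℕ) : Module.Basis (Finset (Fin n)) ℂ (Grassmann n) :=
  (Pi.basisFun ℂ (Fin n)).ExteriorAlgebra

/-- A topological space with a sheaf of `ℤ/2`-graded `ℂ`-algebras (superalgebras): a space with a
sheaf of `ℂ`-algebras, each algebra of sections being graded compatibly with restriction. -/
structure SuperSpace where
  /-- The space together with the underlying sheaf of `ℂ`-algebras. -/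
  space : SheafedSpace (AlgCat.{u} ℂ)
  /-- `parity U 0` and `parity U 1` are the even and the odd sections over `U`. -/
  parity : ∀ U : Opens space, ZMod 2 → Submodule ℂ (space.presheaf.obj (op U))
  graded : ∀ U : Opens space, GradedAlgebra (parity U)
  res_mem_parity : ∀ {U V : Opens space} (h : V ≤ U) (k : ZMod 2)
    (s : space.presheaf.obj (op U)),
    s ∈ parity U k → space.presheaf.map (homOfLE h).op s ∈ parity V k

namespace SuperSpace

instance : CoeSort SuperSpace.{u} (Type u) := ⟨fun X => X.space⟩

/-- The superalgebra `𝒪(U)` of sections over `U`. -/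
abbrev Sec (X : SuperSpace.{u}) (U : Opens X) : Type u := X.space.presheaf.obj (op U)

/-- Restriction of sections. -/
abbrev res (X : SuperSpace.{u}) {V U : Opens X} (h : V ≤ U) : X.Sec U →ₐ[ℂ] X.Sec V :=
  (X.space.presheaf.map (homOfLE h).op).hom

/-- The underlying continuous map `φ̃ : M → M` of a morphism `φ`. -/
def base {X : SuperSpace.{u}} (φ : X.space ⟶ X.space) : C(X, X) := φ.hom.base.hom

/-- The pullback `φ^* : 𝒪(U) → 𝒪(φ̃⁻¹(U))` of a morphism `φ`. -/
def pullback {X : SuperSpace.{u}} (φ : X.space ⟶ X.space) (U : Opens X) :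
    X.Sec U →ₐ[ℂ] X.Sec (U.comap (base φ)) :=
  (φ.hom.c.app (op U)).hom

/-- A morphism preserves parity if its pullback maps even sections to even sections and odd
sections to odd sections. -/
def PreservesParity {X : SuperSpace.{u}} (φ : X.space ⟶ X.space) : Prop :=
  ∀ (U : Opens X) (k : ZMod 2) (f : X.Sec U),
    f ∈ X.parity U k → pullback φ U f ∈ X.parity (U.comap (base φ)) k

/-- The set of automorphisms of `X`: the parity-preserving morphisms `X → X` with a
parity-preserving two-sided inverse. -/
def Automorphisms (X : SuperSpace.{u}) : Type u :=
  {φ : CategoryTheory.Aut X.space // PreservesParity φ.hom ∧ PreservesParity φ.inv}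

/-- Local odd coordinates `θ_1, …, θ_n` on the open subset `W` of a super space whose underlying
space is a complex manifold of dimension `m`. This is an isomorphism of sheaves of superalgebras
`𝒪_W ⊗ ⋀ ℂⁿ ≅ 𝒪|_W`, the coordinate `θ_j` being the image of the `j`-th basis vector of `ℂⁿ`. -/
structure OddCoordinates (X : SuperSpace.{u}) (m n : ℕ)
    [ChartedSpace (EuclideanSpace ℂ (Fin m)) X] (W : Opens X) where
  equiv : ∀ V : Opens X, V ≤ W → (Hol m V ⊗[ℂ] Grassmann n) ≃ₐ[ℂ] X.Sec V
  res_equiv : ∀ {V' V : Opens X} (h : V' ≤ V) (hV : V ≤ W) (f : Hol m V) (a : Grassmann n),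
    X.res h (equiv V hV (f ⊗ₜ a)) = equiv V' (h.trans hV) (Hol.res h f ⊗ₜ a)
  equiv_mem_parity : ∀ (V : Opens X) (hV : V ≤ W) (f : Hol m V) (k : ℕ) (a : Grassmann n),
    a ∈ ⋀[ℂ]^k (Fin n → ℂ) → equiv V hV (f ⊗ₜ a) ∈ X.parity V (k : ZMod 2)

/-- The coefficient `s_ν ∈ 𝒪_M(V)` in the expansion `s = ∑_ν s_ν θ^ν` of a section `s ∈ 𝒪(V)`
with respect to local odd coordinates `θ` on `W ⊇ V`. -/
def OddCoordinates.coeff {X : SuperSpace.{u}} {m n : ℕ}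
    [ChartedSpace (EuclideanSpace ℂ (Fin m)) X] {W : Opens X} (θ : X.OddCoordinates m n W)
    {V : Opens X} (hV : V ≤ W) (s : X.Sec V) (ν : Finset (Fin n)) : Hol m V :=
  (Algebra.TensorProduct.basis (Hol m V) (grassmannBasis n)).repr ((θ.equiv V hV).symm s) ν

/-- The expansion `s = ∑_ν s_ν θ^ν`. -/
theorem OddCoordinates.sum_coeff {X : SuperSpace.{u}} {m n : ℕ}
    [ChartedSpace (EuclideanSpace ℂ (Fin m)) X] {W : Opens X} (θ : X.OddCoordinates m n W)
    {V : Opens X} (hV : V ≤ W) (s : X.Sec V) :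
    s = ∑ ν, θ.equiv V hV (θ.coeff hV s ν ⊗ₜ grassmannBasis n ν) := by
  rw [← map_sum]
  have h := (Algebra.TensorProduct.basis (Hol m V) (grassmannBasis n)).sum_repr
    ((θ.equiv V hV).symm s)
  apply (θ.equiv V hV).symm.injective
  rw [AlgEquiv.symm_apply_apply]
  conv_lhs => rw [← h]
  refine Finset.sum_congr rfl fun ν _ => ?_
  rw [Algebra.TensorProduct.basis_apply, TensorProduct.smul_tmul']
  simp [OddCoordinates.coeff]

end SuperSpace

/-- A complex supermanifold of dimension `(m|n)`: a complex manifold `M` of dimension `m`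
(Hausdorff and second countable) with a sheaf of superalgebras that is locally isomorphic to
`𝒪_U ⊗ ⋀ ℂⁿ`. -/
structure ComplexSupermanifold (m n : ℕ) extends SuperSpace.{u} where
  [t2Space : T2Space space]
  [secondCountable : SecondCountableTopology space]
  [chartedSpace : ChartedSpace (EuclideanSpace ℂ (Fin m)) space]
  [isManifold : IsManifold 𝓘(ℂ, EuclideanSpace ℂ (Fin m)) ω space]
  exists_oddCoordinates : ∀ x : space,
    ∃ W : Opens space, x ∈ W ∧ Nonempty (toSuperSpace.OddCoordinates m n W)

namespace ComplexSupermanifold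

variable {m n : ℕ}

instance : CoeSort (ComplexSupermanifold.{u} m n) (Type u) := ⟨fun M => M.space⟩

attribute [instance] t2Space secondCountable chartedSpace isManifold

/-- The set `Aut_0(M)` of automorphisms of the complex supermanifold `M`. -/
def Aut₀ (M : ComplexSupermanifold.{u} m n) : Type u := M.toSuperSpace.Automorphisms

namespace Aut₀

variable {M : ComplexSupermanifold.{u} m n}

/-- The underlying map `φ̃ : M → M`. -/
def base (φ : M.Aut₀) : C(M, M) := SuperSpace.base φ.1.hom

/-- The pullback `φ^* : 𝒪(U) → 𝒪(φ̃⁻¹(U))`. -/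
def pullback (φ : M.Aut₀) (U : Opens M) : M.Sec U →ₐ[ℂ] M.Sec (U.comap φ.base) :=
  SuperSpace.pullback φ.1.hom U

/-- The holomorphic function `φ_{f,ν}` on `W ∩ φ̃⁻¹(U)` for which `φ^*(f) = ∑_ν φ_{f,ν} θ^ν`, where
`f ∈ 𝒪(U)` and `θ` are local odd coordinates on `W`. -/
def coeff (φ : M.Aut₀) {W : Opens M} (θ : M.OddCoordinates m n W) {U : Opens M} (f : M.Sec U)
    (ν : Finset (Fin n)) : Hol m (W ⊓ U.comap φ.base) :=
  θ.coeff inf_le_left (M.res inf_le_right (φ.pullback U f)) ν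

end Aut₀

/-- The set `Δ(K, U, f, θ_j, U_ν)` of all automorphisms `φ` with `φ̃(K) ⊆ U` and
`φ_{f,ν}(K) ⊆ U_ν` for all `ν`. Here `W` is an open neighbourhood of `K` on which the local odd
coordinates `θ_j` are defined. -/
def basicSet (M : ComplexSupermanifold.{u} m n) (K : Set M) {W : Opens M} (hKW : K ⊆ W)
    (U : Opens M) (f : M.Sec U) (θ : M.OddCoordinates m n W) (O : Finset (Fin n) → Set ℂ) :
    Set M.Aut₀ :=
  {φ | ∃ hU : Set.MapsTo φ.base K U,
    ∀ (ν : Finset (Fin n)) (x : M) (hx : x ∈ K), φ.coeff θ f ν ⟨x, hKW hx, hU hx⟩ ∈ O ν}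

/-- The topology on `Aut_0(M)` with the sets `Δ(K, U, f, θ_j, U_ν)` as a subbase, for `K` compact
with local odd coordinates `θ_j` on an open neighbourhood of `K`, `U ⊆ M` open, `f ∈ 𝒪(U)` and
`U_ν ⊆ ℂ` open. -/
instance (M : ComplexSupermanifold.{u} m n) : TopologicalSpace M.Aut₀ :=
  TopologicalSpace.generateFrom
    {S | ∃ (K : Set M) (_ : IsCompact K) (W : Opens M) (hKW : K ⊆ W) (U : Opens M) (f : M.Sec U)
      (θ : M.OddCoordinates m n W) (O : Finset (Fin n) → Set ℂ) (_ : ∀ ν, IsOpen (O ν)),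
      S = M.basicSet K hKW U f θ O}

end ComplexSupermanifold

end Supergeometry

end

/-!
The topology of `Aut₀` is compatible with left translations, and it is Hausdorff. Hence it suffices
to find one compact neighbourhood of the identity.

Cover `M` by finitely many balls in charts such that odd coordinates exist on a neighbourhood of a
concentric closed ball of twice the radius. Let `N` be the set of automorphisms `φ` for which `φ`
and its inverse map every ball into its double, the pullbacks of the coordinates are bounded by
fixed constants, and the pullbacks of the monomials `θ^ν` differ from `θ^ν` by at most a small
constant. It is a neighbourhood of the identity (`CoordBall.nearOne_mem_nhds`), and it is compact
(`isCompact_iInter_nearOne`) because every ultrafilter `F` on `N` converges in `N`: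

* The underlying maps and those of the inverses are bounded holomorphic maps in charts. They are
  equicontinuous, so they converge locally uniformly along `F` to holomorphic maps `g` and `h`
  (`contMDiffOn_of_tendsto`), and these are inverse to each other.
* The value at a point `x` of the pullback of a section, read in odd coordinates, is a homomorphism
  from the stalk at the image of `x` to `⋀ ℂⁿ` (`PointHom`). The body of such a homomorphism is
  evaluation at a point, and the values at the coordinates are bounded. By Hadamard's lemma with
  bounds (`exists_eq_add_clm_apply`), applied once for every degree of nilpotency, its values at
  arbitrary sections are bounded by a constant times a bound of the section near the point
  (`PointHom.exists_gnorm_hom_le`). This Taylor estimate replaces an expansion of the pullback in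
  derivatives.
* So the coefficients of the pullbacks of any section are locally bounded holomorphic functions
  which converge locally uniformly along `F`. The limits do not depend on the coordinates, they
  glue, and they are the pullbacks by a morphism over `g` (`LimitData.limit`), which preserves
  parity because the coefficients of the wrong parity vanish in the limit.
* The closeness of the pullbacks of `θ^ν` to `θ^ν` passes to the limit and makes the matrix of
  leading coefficients of the limit morphism diagonally dominant, hence invertible. A morphism over
  a biholomorphic map with invertible leading matrices is an isomorphism, as kernel and cokernel
  vanish successively in every degree (`isIso_of_leadMatrix`).
-/

noncomputable section

namespace Supergeometry

open Filter Topology Metric Set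

/-! ### Bounded holomorphic functions of several variables -/

section ComplexAnalysis

variable {E F : Type*} [NormedAddCommGroup E] [NormedSpace ℂ E]
  [NormedAddCommGroup F] [NormedSpace ℂ F]

theorem norm_fderiv_le_of_norm_le {f : E → F} {c : E} {r S : ℝ} (hr : 0 < r)
    (hf : DifferentiableOn ℂ f (ball c r)) (hS : ∀ z ∈ ball c r, ‖f z‖ ≤ S) :
    ‖fderiv ℂ f c‖ ≤ 2 * S / r := by
  refine Complex.norm_fderiv_le_div_of_mapsTo_ball hf (fun z hz => ?_) hr
  rw [mem_closedBall, dist_eq_norm]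
  linarith [norm_sub_le (f z) (f c), hS z hz, hS c (mem_ball_self hr)]

theorem norm_sub_le_of_norm_le {f : E → F} {c : E} {r S : ℝ}
    (hf : DifferentiableOn ℂ f (ball c r)) (hS : ∀ z ∈ ball c r, ‖f z‖ ≤ S) {z : E}
    (hz : z ∈ ball c r) : ‖f z - f c‖ ≤ 2 * S / r * ‖z - c‖ := by
  have hr : 0 < r := nonempty_ball.1 ⟨z, hz⟩
  rw [← dist_eq_norm, ← dist_eq_norm]
  refine Complex.dist_le_div_mul_dist_of_mapsTo_ball hf (fun z hz => ?_) hz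
  rw [mem_closedBall, dist_eq_norm]
  linarith [norm_sub_le (f z) (f c), hS z hz, hS c (mem_ball_self hr)]

theorem norm_iteratedFDeriv_le_of_norm_le {f : E → F} [CompleteSpace F] {δ S : ℝ} (hδ : 0 < δ)
    (j : ℕ) : ∀ {c : E} {r : ℝ}, j * δ < r → AnalyticOnNhd ℂ f (ball c r) →
      (∀ z ∈ ball c r, ‖f z‖ ≤ S) → ‖iteratedFDeriv ℂ j f c‖ ≤ S * (2 / δ) ^ j := by
  induction j with
  | zero =>
    intro c r hr _ hS
    simpa using hS c (mem_ball_self (by simpa using hr))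
  | succ j ih =>
    intro c r hr hf hS
    have hr' : j * δ < r - δ := by push_cast at hr; linarith
    have hr0 : δ ≤ r := by
      have : 0 ≤ j * δ := by positivity
      linarith
    rw [← norm_fderiv_iteratedFDeriv]
    have h1 : ∀ z ∈ ball c δ, ‖iteratedFDeriv ℂ j f z‖ ≤ S * (2 / δ) ^ j := by
      intro z hz
      have hsub : ball z (r - δ) ⊆ ball c r := ball_subset_ball' (by
        rw [mem_ball] at hz; linarith)
      exact ih hr' (hf.mono hsub) (fun w hw => hS w (hsub hw))
    have h2 : DifferentiableOn ℂ (iteratedFDeriv ℂ j f) (ball c δ) :=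
      ((hf.mono (ball_subset_ball hr0)).iteratedFDeriv j).differentiableOn
    refine (norm_fderiv_le_of_norm_le hδ h2 h1).trans (le_of_eq ?_)
    rw [pow_succ]; ring

/-- The Taylor series of `f` at `c`, as a formal multilinear series. -/
def taylorSeriesAt (f : E → F) (c : E) : FormalMultilinearSeries ℂ E F := fun j =>
  ((j.factorial : ℂ)⁻¹) • iteratedFDeriv ℂ j f c

theorem norm_taylorSeriesAt_le [CompleteSpace F] {f : E → F} {c : E} {r S : ℝ} (hr : 0 < r)
    (hf : AnalyticOnNhd ℂ f (ball c r)) (hS : ∀ z ∈ ball c r, ‖f z‖ ≤ S) (j : ℕ) :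
    ‖taylorSeriesAt f c j‖ ≤ 3 * S * (6 / r) ^ j := by
  have hS0 : 0 ≤ S := (norm_nonneg _).trans (hS c (mem_ball_self hr))
  have hj : (0 : ℝ) < j + 1 := by positivity
  have h := norm_iteratedFDeriv_le_of_norm_le (f := f) (δ := r / (j + 1)) (S := S) (by positivity) j
    (c := c) (r := r) (by rw [mul_div_assoc', div_lt_iff₀ hj]; nlinarith) hf hS
  rw [taylorSeriesAt, norm_smul, norm_inv, Complex.norm_natCast]
  have hfac : (0 : ℝ) < j.factorial := by positivity
  -- `(j + 1) ^ j / j ! = (j + 1) ^ (j + 1) / (j + 1)! ≤ exp (j + 1) ≤ 3 ^ (j + 1)`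
  have h3 : ((j : ℝ) + 1) ^ j / j.factorial ≤ 3 ^ (j + 1) := by
    have e1 := Real.pow_div_factorial_le_exp ((j : ℝ) + 1) hj.le (j + 1)
    have e2 : Real.exp ((j : ℝ) + 1) ≤ 3 ^ (j + 1) := by
      have : Real.exp ((j : ℝ) + 1) = Real.exp 1 ^ (j + 1) := by
        rw [← Real.exp_nat_mul]; push_cast; ring_nf
      rw [this]
      exact pow_le_pow_left₀ (Real.exp_pos 1).le (by linarith [Real.exp_one_lt_d9]) _
    have e3 : ((j : ℝ) + 1) ^ (j + 1) / (j + 1).factorial = ((j : ℝ) + 1) ^ j / j.factorial := by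
      rw [Nat.factorial_succ, pow_succ]; push_cast; field_simp
    linarith
  calc (j.factorial : ℝ)⁻¹ * ‖iteratedFDeriv ℂ j f c‖
      ≤ (j.factorial : ℝ)⁻¹ * (S * (2 / (r / (j + 1))) ^ j) := by gcongr
    _ = S * (2 / r) ^ j * (((j : ℝ) + 1) ^ j / j.factorial) := by
        rw [show (2 / (r / ((j : ℝ) + 1))) = 2 / r * (j + 1) by field_simp, mul_pow]; ring
    _ ≤ S * (2 / r) ^ j * 3 ^ (j + 1) := by gcongr
    _ = 3 * S * (6 / r) ^ j := by
        rw [show (6 / r : ℝ) = 2 / r * 3 by ring, mul_pow, pow_succ]; ring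

theorem le_radius_of_norm_le {p : FormalMultilinearSeries ℂ E F} {r S : ℝ} (hr : 0 < r)
    (hp : ∀ j, ‖p j‖ ≤ 3 * S * (6 / r) ^ j) : ENNReal.ofReal (r / 6) ≤ p.radius := by
  refine p.le_radius_of_bound (3 * S) fun j => ?_
  rw [Real.coe_toNNReal _ (by positivity)]
  calc ‖p j‖ * (r / 6) ^ j ≤ 3 * S * (6 / r) ^ j * (r / 6) ^ j := by gcongr; exact hp j
    _ = 3 * S := by
      rw [mul_assoc, ← mul_pow, show 6 / r * (r / 6) = 1 by field_simp, one_pow, mul_one]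

/-- A holomorphic function which is bounded on a ball is the sum of its Taylor series at the centre
on a ball whose radius is a fixed fraction of the given one. -/
theorem hasFPowerSeriesOnBall_taylorSeriesAt [CompleteSpace F] {f : E → F} {c : E} {r S : ℝ}
    (hr : 0 < r) (hf : AnalyticOnNhd ℂ f (ball c r)) (hS : ∀ z ∈ ball c r, ‖f z‖ ≤ S) :
    HasFPowerSeriesOnBall f (taylorSeriesAt f c) c (ENNReal.ofReal (r / 6)) := by
  set p := taylorSeriesAt f c with hp
  have hr6 : (0 : ℝ) < r / 6 := by positivity
  have hrad := le_radius_of_norm_le hr (norm_taylorSeriesAt_le hr hf hS)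
  have hpos : 0 < ENNReal.ofReal (r / 6) := ENNReal.ofReal_pos.2 hr6
  have h1 : HasFPowerSeriesOnBall (fun z => p.sum (z - c)) p c p.radius := by
    have := (p.hasFPowerSeriesOnBall (hpos.trans_le hrad)).comp_sub c
    simpa using this
  have h1' := h1.mono hpos hrad
  obtain ⟨q, R, hq⟩ := hf c (mem_ball_self hr)
  have hev : f =ᶠ[𝓝 c] fun z => p.sum (z - c) := by
    filter_upwards [Metric.eball_mem_nhds c hq.r_pos] with z hz
    have hy : z - c ∈ Metric.eball (0 : E) R := by
      simpa [edist_eq_enorm_sub] using hz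
    have := hq.hasSum_iteratedFDeriv hy
    rw [add_sub_cancel] at this
    exact this.tsum_eq.symm
  have hball : Metric.eball c (ENNReal.ofReal (r / 6)) = ball c (r / 6) := Metric.eball_ofReal
  have heq := AnalyticOnNhd.eqOn_of_preconnected_of_eventuallyEq (U := ball c (r / 6))
    (hf.mono (ball_subset_ball (by linarith))) (by rw [← hball]; exact h1'.analyticOnNhd)
    (convex_ball c (r / 6)).isPreconnected (mem_ball_self hr6) hev
  exact h1'.congr (by rw [hball]; exact heq.symm)

/-- Hadamard's lemma with bounds: `f z - f c` is a linear form in `z - c` with holomorphic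
coefficients, which are bounded in terms of a bound for `f`. -/
theorem exists_eq_add_clm_apply [CompleteSpace F] {f : E → F} {c : E} {r S : ℝ} (hr : 0 < r)
    (hf : AnalyticOnNhd ℂ f (ball c r)) (hS : ∀ z ∈ ball c r, ‖f z‖ ≤ S) :
    ∃ H : E → E →L[ℂ] F, AnalyticOnNhd ℂ H (ball c (r / 12)) ∧
      (∀ z ∈ ball c (r / 12), ‖H z‖ ≤ 36 / r * S) ∧
      ∀ z ∈ ball c (r / 12), f z = f c + H z (z - c) := by
  have hS0 : 0 ≤ S := (norm_nonneg _).trans (hS c (mem_ball_self hr))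
  set p := taylorSeriesAt f c
  have hbd := norm_taylorSeriesAt_le hr hf hS
  have hp := hasFPowerSeriesOnBall_taylorSeriesAt hr hf hS
  have hr6 : (0 : ℝ) < r / 6 := by positivity
  have hpos : 0 < ENNReal.ofReal (r / 6) := ENNReal.ofReal_pos.2 hr6
  have hrad : ENNReal.ofReal (r / 6) ≤ p.shift.radius := by
    rw [FormalMultilinearSeries.radius_shift]; exact hp.r_le
  have h1 : HasFPowerSeriesOnBall (fun z => p.shift.sum (z - c)) p.shift c
      (ENNReal.ofReal (r / 6)) := by
    have := (p.shift.hasFPowerSeriesOnBall (hpos.trans_le hrad)).comp_sub c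
    exact (by simpa using this : HasFPowerSeriesOnBall _ p.shift c p.shift.radius).mono hpos hrad
  have hball : ball c (r / 12) ⊆ Metric.eball c (ENNReal.ofReal (r / 6)) := by
    rw [Metric.eball_ofReal]; exact ball_subset_ball (by linarith)
  refine ⟨fun z => p.shift.sum (z - c), h1.analyticOnNhd.mono hball, fun z hz => ?_,
    fun z hz => ?_⟩
  · have hz' : ‖z - c‖ ≤ r / 12 := by rw [mem_ball, dist_eq_norm] at hz; exact hz.le
    have hgeo : HasSum (fun j : ℕ => 18 / r * S * (1 / 2 : ℝ) ^ j) (18 / r * S * 2) :=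
      hasSum_geometric_two.mul_left _
    have hle : ∀ j, ‖p.shift j fun _ => z - c‖ ≤ 18 / r * S * (1 / 2 : ℝ) ^ j := by
      intro j
      calc ‖p.shift j fun _ => z - c‖ ≤ ‖p.shift j‖ * ‖z - c‖ ^ j := by
            simpa using (p.shift j).le_opNorm fun _ => z - c
        _ ≤ 3 * S * (6 / r) ^ (j + 1) * (r / 12) ^ j := by
            gcongr
            rw [FormalMultilinearSeries.shift, ContinuousMultilinearMap.curryRight_norm]
            exact hbd (j + 1)
        _ = 18 / r * S * (1 / 2 : ℝ) ^ j := by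
            rw [pow_succ, show (1 / 2 : ℝ) = 6 / r * (r / 12) by field_simp; norm_num, mul_pow]
            ring
    refine (tsum_of_norm_bounded hgeo hle).trans (le_of_eq (by ring))
  · have hz' : z - c ∈ Metric.eball (0 : E) (ENNReal.ofReal (r / 6)) := by
      have := hball hz
      rw [Metric.eball_ofReal, mem_ball, dist_eq_norm] at this
      rwa [Metric.eball_ofReal, mem_ball_zero_iff]
    have hs1 := hp.hasSum hz'
    rw [add_sub_cancel] at hs1
    have hs2 := (h1.hasSum hz').mapL (ContinuousLinearMap.apply ℂ F (z - c))
    rw [add_sub_cancel] at hs2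
    have hs3 := (hasSum_nat_add_iff' 1).2 hs1
    have h4 : ∀ j : ℕ, p (j + 1) (fun _ => z - c) = (p.shift j fun _ => z - c) (z - c) := by
      intro j
      refine congrArg (p (j + 1)) (funext fun i => ?_)
      refine Fin.lastCases ?_ (fun i => ?_) i <;> simp
    have h5 := (hs3.congr_fun fun j => (h4 j).symm).unique hs2
    have h6 : p 0 (fun _ => z - c) = f c := by
      simp [p, taylorSeriesAt]
    rw [Finset.sum_range_one, h6] at h5
    simpa [sub_eq_iff_eq_add'] using h5

instance finiteDimensional_continuousMultilinearMap [FiniteDimensional ℂ E] [FiniteDimensional ℂ F]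
    (j : ℕ) : FiniteDimensional ℂ (E [×j]→L[ℂ] F) :=
  Module.Finite.of_injective (R := ℂ)
    (f := (ContinuousMultilinearMap.toMultilinearMapLinear :
      (E [×j]→L[ℂ] F) →ₗ[ℂ] MultilinearMap ℂ (fun _ : Fin j => E) F))
    ContinuousMultilinearMap.toMultilinearMap_injective

/-- A pointwise limit of uniformly bounded holomorphic functions is holomorphic. -/
theorem analyticAt_of_tendsto [FiniteDimensional ℂ E] [FiniteDimensional ℂ F] {ι : Type*}
    {l : Filter ι} [l.NeBot] {f : ι → E → F} {g : E → F} {c : E} {r S : ℝ} (hr : 0 < r)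
    (hf : ∀ᶠ i in l, AnalyticOnNhd ℂ (f i) (ball c r))
    (hS : ∀ᶠ i in l, ∀ z ∈ ball c r, ‖f i z‖ ≤ S)
    (hlim : ∀ z ∈ ball c r, Tendsto (f · z) l (𝓝 (g z))) : AnalyticAt ℂ g c := by
  have : CompleteSpace F := FiniteDimensional.complete ℂ F
  have hU : (Ultrafilter.of l : Filter ι) ≤ l := Ultrafilter.of_le l
  set U := Ultrafilter.of l
  -- the Taylor coefficients stay in a compact set, so that they converge along the ultrafilter
  have hlimp : ∀ j : ℕ, ∃ q : E [×j]→L[ℂ] F, ‖q‖ ≤ 3 * S * (6 / r) ^ j ∧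
      Tendsto (fun i => taylorSeriesAt (f i) c j) U (𝓝 q) := by
    intro j
    have : ProperSpace (E [×j]→L[ℂ] F) := FiniteDimensional.proper ℂ _
    have hK := isCompact_closedBall (0 : E [×j]→L[ℂ] F) (3 * S * (6 / r) ^ j)
    obtain ⟨q, hq, hqU⟩ := hK.ultrafilter_le_nhds (U.map fun i => taylorSeriesAt (f i) c j) (by
      rw [le_principal_iff]
      change ∀ᶠ i in U, taylorSeriesAt (f i) c j ∈ _
      filter_upwards [hU hf, hU hS] with i h1 h2
      simpa using norm_taylorSeriesAt_le hr h1 h2 j)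
    exact ⟨q, by simpa using hq, hqU⟩
  choose q hq hqU using hlimp
  have hr6 : (0 : ℝ) < r / 6 := by positivity
  have hpos : 0 < ENNReal.ofReal (r / 6) := ENNReal.ofReal_pos.2 hr6
  have hrad : ENNReal.ofReal (r / 6) ≤ FormalMultilinearSeries.radius q :=
    le_radius_of_norm_le (p := q) hr hq
  have h1 : HasFPowerSeriesOnBall (fun z => FormalMultilinearSeries.sum q (z - c)) q c
      (ENNReal.ofReal (r / 6)) := by
    have := (FormalMultilinearSeries.hasFPowerSeriesOnBall q (hpos.trans_le hrad)).comp_sub c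
    exact (by simpa using this : HasFPowerSeriesOnBall _ q c _).mono hpos hrad
  refine (h1.mono (ENNReal.ofReal_pos.2 (by positivity : 0 < r / 12))
    (ENNReal.ofReal_le_ofReal (by linarith))).congr (fun z hz => ?_) |>.analyticAt
  rw [Metric.eball_ofReal] at hz
  have hzn : ‖z - c‖ ≤ r / 12 := by rw [mem_ball, dist_eq_norm] at hz; exact hz.le
  have hz' : z - c ∈ Metric.eball (0 : E) (ENNReal.ofReal (r / 6)) := by
    rw [Metric.eball_ofReal, mem_ball_zero_iff]; linarith
  have hgeo : Summable (fun j : ℕ => 3 * S * (1 / 2 : ℝ) ^ j) :=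
    summable_geometric_two.mul_left _
  have key : Tendsto (fun i => ∑' j, taylorSeriesAt (f i) c j fun _ => z - c) U
      (𝓝 (∑' j, q j fun _ => z - c)) := by
    refine tendsto_tsum_of_dominated_convergence hgeo (fun j => ?_) ?_
    · exact (ContinuousMultilinearMap.apply ℂ (fun _ : Fin j => E) F
        (fun _ => z - c)).continuous.continuousAt.tendsto.comp (hqU j)
    · filter_upwards [hU hf, hU hS] with i h1 h2 j
      have hS0 : 0 ≤ S := (norm_nonneg _).trans (h2 c (mem_ball_self hr))
      calc ‖taylorSeriesAt (f i) c j fun _ => z - c‖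
          ≤ ‖taylorSeriesAt (f i) c j‖ * ‖z - c‖ ^ j := by
            simpa using (taylorSeriesAt (f i) c j).le_opNorm fun _ => z - c
        _ ≤ 3 * S * (6 / r) ^ j * (r / 12) ^ j := by
            gcongr
            exact norm_taylorSeriesAt_le hr h1 h2 j
        _ = 3 * S * (1 / 2 : ℝ) ^ j := by
            rw [show (1 / 2 : ℝ) = 6 / r * (r / 12) by field_simp; norm_num, mul_pow]
            ring
  have key2 : Tendsto (f · z) U (𝓝 (∑' j, q j fun _ => z - c)) := by
    refine key.congr' ?_
    filter_upwards [hU hf, hU hS] with i h1 h2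
    have := (hasFPowerSeriesOnBall_taylorSeriesAt hr h1 h2).hasSum hz'
    rw [add_sub_cancel] at this
    exact this.tsum_eq
  exact tendsto_nhds_unique key2
    ((hlim z (ball_subset_ball (by linarith) hz)).mono_left hU)

/-- Uniformly bounded holomorphic functions are equicontinuous, so that pointwise convergence is
locally uniform. -/
theorem eventually_norm_sub_lt_of_tendsto {ι : Type*}
    {l : Filter ι} [l.NeBot] {f : ι → E → F} {g : E → F} {c : E} {r S : ℝ} (hr : 0 < r)
    (hf : ∀ᶠ i in l, AnalyticOnNhd ℂ (f i) (ball c r))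
    (hS : ∀ᶠ i in l, ∀ z ∈ ball c r, ‖f i z‖ ≤ S)
    (hlim : ∀ z ∈ ball c r, Tendsto (f · z) l (𝓝 (g z))) {ε : ℝ} (hε : 0 < ε) :
    ∃ δ > 0, δ < r ∧ ∀ᶠ i in l, ∀ z ∈ ball c δ, ‖f i z - g c‖ < ε := by
  have hS0 : 0 ≤ S := by
    obtain ⟨i, hi⟩ := hS.exists
    exact (norm_nonneg _).trans (hi c (mem_ball_self hr))
  obtain ⟨δ, hδ, hδ1, hδ2⟩ : ∃ δ > 0, δ < r ∧ 2 * S / r * δ < ε / 2 := by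
    refine ⟨min (r / 2) (ε / 4 / (2 * S / r + 1)), by positivity,
      (min_le_left _ _).trans_lt (by linarith), ?_⟩
    have h0 : 0 ≤ 2 * S / r := by positivity
    calc 2 * S / r * min (r / 2) (ε / 4 / (2 * S / r + 1))
        ≤ (2 * S / r + 1) * (ε / 4 / (2 * S / r + 1)) := by
          gcongr
          · linarith
          · exact min_le_right _ _
      _ = ε / 4 := by field_simp
      _ < ε / 2 := by linarith
  have hlip : ∀ᶠ i in l, ∀ z ∈ ball c δ, ‖f i z - f i c‖ ≤ ε / 2 := by
    filter_upwards [hf, hS] with i h1 h2 z hz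
    refine (norm_sub_le_of_norm_le h1.differentiableOn h2
      (ball_subset_ball hδ1.le hz)).trans (le_trans ?_ hδ2.le)
    rw [mem_ball, dist_eq_norm] at hz
    gcongr
  refine ⟨δ, hδ, hδ1, ?_⟩
  have hc := (hlim c (mem_ball_self hr)).eventually (ball_mem_nhds (g c) (half_pos hε))
  filter_upwards [hlip, hc] with i h1 h2 z hz
  rw [dist_eq_norm] at h2
  calc ‖f i z - g c‖ ≤ ‖f i z - f i c‖ + ‖f i c - g c‖ := norm_sub_le_norm_sub_add_norm_sub _ _ _
    _ < ε := by linarith [h1 z hz]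

end ComplexAnalysis

/-! ### The Grassmann algebra: coordinates, norm and filtration -/

section Grassmann

variable {n : ℕ}

/-- The coordinate of `a ∈ ⋀ ℂⁿ` at the basis vector `θ^ν`. -/
def gcoeff (ν : Finset (Fin n)) : Grassmann n →ₗ[ℂ] ℂ := (grassmannBasis n).coord ν

theorem sum_gcoeff (a : Grassmann n) : ∑ ν, gcoeff ν a • grassmannBasis n ν = a :=
  (grassmannBasis n).sum_repr a

theorem gcoeff_ext {a b : Grassmann n} (h : ∀ ν, gcoeff ν a = gcoeff ν b) : a = b :=
  (grassmannBasis n).ext_elem h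

theorem gcoeff_basis (ν μ : Finset (Fin n)) :
    gcoeff μ (grassmannBasis n ν) = if ν = μ then 1 else 0 := by
  rw [gcoeff, Module.Basis.coord_apply, Module.Basis.repr_self, Finsupp.single_apply]

theorem gcoeff_mul (κ : Finset (Fin n)) (a b : Grassmann n) :
    gcoeff κ (a * b) = ∑ ν, ∑ μ, gcoeff ν a * gcoeff μ b *
      gcoeff κ (grassmannBasis n ν * grassmannBasis n μ) := by
  conv_lhs => rw [← sum_gcoeff a, ← sum_gcoeff b, Finset.sum_mul_sum]
  simp [mul_assoc, mul_left_comm]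

/-- The `ℓ¹`-norm on `⋀ ℂⁿ` with respect to the basis `θ^ν`. -/
def gnorm (a : Grassmann n) : ℝ := ∑ ν, ‖gcoeff ν a‖

theorem gnorm_nonneg (a : Grassmann n) : 0 ≤ gnorm a := Finset.sum_nonneg fun _ _ => norm_nonneg _

@[simp] theorem gnorm_zero : gnorm (0 : Grassmann n) = 0 := by simp [gnorm]

theorem norm_gcoeff_le_gnorm (a : Grassmann n) (ν : Finset (Fin n)) : ‖gcoeff ν a‖ ≤ gnorm a :=
  Finset.single_le_sum (f := fun ν => ‖gcoeff ν a‖) (fun _ _ => norm_nonneg _) (Finset.mem_univ ν)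

theorem gnorm_le_of_norm_gcoeff_le {a : Grassmann n} {C : ℝ} (h : ∀ ν, ‖gcoeff ν a‖ ≤ C) :
    gnorm a ≤ 2 ^ n * C := by
  refine (Finset.sum_le_sum fun ν _ => h ν).trans (le_of_eq ?_)
  simp

theorem gnorm_add_le (a b : Grassmann n) : gnorm (a + b) ≤ gnorm a + gnorm b := by
  rw [gnorm, gnorm, gnorm, ← Finset.sum_add_distrib]
  exact Finset.sum_le_sum fun ν _ => by rw [map_add]; exact norm_add_le _ _

theorem gnorm_smul (c : ℂ) (a : Grassmann n) : gnorm (c • a) = ‖c‖ * gnorm a := by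
  simp [gnorm, Finset.mul_sum]

theorem gnorm_sum_le {ι : Type*} (s : Finset ι) (f : ι → Grassmann n) :
    gnorm (∑ i ∈ s, f i) ≤ ∑ i ∈ s, gnorm (f i) :=
  Finset.le_sum_of_subadditive gnorm gnorm_zero.le gnorm_add_le s f

theorem gnorm_sub_le (a b : Grassmann n) : gnorm (a - b) ≤ gnorm a + gnorm b := by
  have := gnorm_add_le a ((-1 : ℂ) • b)
  rw [gnorm_smul] at this
  simpa [sub_eq_add_neg] using this

variable (n) in
/-- A constant for which multiplication in `⋀ ℂⁿ` is bounded, see `gnorm_mul_le`. -/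
def gmulConst : ℝ := ∑ ν, ∑ μ, gnorm (grassmannBasis n ν * grassmannBasis n μ)

theorem gmulConst_nonneg : 0 ≤ gmulConst n :=
  Finset.sum_nonneg fun _ _ => Finset.sum_nonneg fun _ _ => gnorm_nonneg _

theorem gnorm_mul_le (a b : Grassmann n) : gnorm (a * b) ≤ gmulConst n * gnorm a * gnorm b := by
  conv_lhs => rw [← sum_gcoeff a, ← sum_gcoeff b, Finset.sum_mul_sum]
  have hle : ∀ ν μ, gnorm (grassmannBasis n ν * grassmannBasis n μ) ≤ gmulConst n := fun ν μ =>
    (Finset.single_le_sum (f := fun μ => gnorm (grassmannBasis n ν * grassmannBasis n μ))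
      (fun _ _ => gnorm_nonneg _) (Finset.mem_univ μ)).trans
    (Finset.single_le_sum (f := fun ν => ∑ μ, gnorm (grassmannBasis n ν * grassmannBasis n μ))
      (fun _ _ => Finset.sum_nonneg fun _ _ => gnorm_nonneg _) (Finset.mem_univ ν))
  calc _ ≤ ∑ ν, ∑ μ, gnorm (gcoeff ν a • grassmannBasis n ν * gcoeff μ b • grassmannBasis n μ) :=
        (gnorm_sum_le _ _).trans (Finset.sum_le_sum fun ν _ => gnorm_sum_le _ _)
    _ ≤ ∑ ν, ∑ μ, ‖gcoeff ν a‖ * ‖gcoeff μ b‖ * gmulConst n := by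
        refine Finset.sum_le_sum fun ν _ => Finset.sum_le_sum fun μ _ => ?_
        rw [smul_mul_smul_comm, gnorm_smul, norm_mul]
        gcongr
        exact hle ν μ
    _ = gmulConst n * gnorm a * gnorm b := by
        rw [gnorm, gnorm, mul_assoc, Finset.sum_mul_sum, Finset.mul_sum]
        refine Finset.sum_congr rfl fun ν _ => ?_
        rw [Finset.mul_sum]
        exact Finset.sum_congr rfl fun μ _ => by ring

variable (n) in
/-- The decreasing filtration of `⋀ ℂⁿ` by degree: the elements without components of degree less
than `l`. -/
def degFiltration (l : ℕ) : Submodule ℂ (Grassmann n) :=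
  ⨅ (ν : Finset (Fin n)) (_ : ν.card < l), LinearMap.ker (gcoeff ν)

theorem mem_degFiltration {l : ℕ} {a : Grassmann n} :
    a ∈ degFiltration n l ↔ ∀ ν : Finset (Fin n), ν.card < l → gcoeff ν a = 0 := by
  simp [degFiltration, Submodule.mem_iInf]

theorem degFiltration_anti {l k : ℕ} (h : l ≤ k) : degFiltration n k ≤ degFiltration n l :=
  fun _ ha => mem_degFiltration.2 fun ν hν => mem_degFiltration.1 ha ν (hν.trans_le h)

theorem mem_degFiltration_zero (a : Grassmann n) : a ∈ degFiltration n 0 :=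
  mem_degFiltration.2 fun _ h => absurd h (Nat.not_lt_zero _)

theorem eq_zero_of_mem_degFiltration {a : Grassmann n} (h : a ∈ degFiltration n (n + 1)) :
    a = 0 :=
  gcoeff_ext fun ν => by
    rw [map_zero]
    exact mem_degFiltration.1 h ν (Nat.lt_succ_of_le (by simpa using Finset.card_le_univ ν))

theorem grassmannBasis_mem_degFiltration (ν : Finset (Fin n)) :
    grassmannBasis n ν ∈ degFiltration n ν.card :=
  mem_degFiltration.2 fun μ hμ => by
    rw [gcoeff_basis, if_neg]
    rintro rfl
    exact lt_irrefl _ hμ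

theorem grassmannBasis_mul_mem_degFiltration (ν μ : Finset (Fin n)) :
    grassmannBasis n ν * grassmannBasis n μ ∈ degFiltration n (ν.card + μ.card) := by
  let s : Set.powersetCard (Fin n) ν.card := ⟨ν, rfl⟩
  let t : Set.powersetCard (Fin n) μ.card := ⟨μ, rfl⟩
  by_cases h : Disjoint s.val t.val
  · have h1 := ExteriorAlgebra.basis_mul_of_disjoint (Pi.basisFun ℂ (Fin n)) s t h
    have h2 := grassmannBasis_mem_degFiltration (Set.powersetCard.disjUnion h : Finset (Fin n))
    rw [show (Set.powersetCard.disjUnion h : Finset (Fin n)).card = ν.card + μ.card from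
      (Set.powersetCard.disjUnion h).2] at h2
    change (Pi.basisFun ℂ (Fin n)).ExteriorAlgebra s * (Pi.basisFun ℂ (Fin n)).ExteriorAlgebra t ∈ _
    rw [h1, Units.smul_def]
    exact zsmul_mem h2 _
  · have h1 := ExteriorAlgebra.basis_mul_of_not_disjoint (Pi.basisFun ℂ (Fin n)) s t h
    change (Pi.basisFun ℂ (Fin n)).ExteriorAlgebra s * (Pi.basisFun ℂ (Fin n)).ExteriorAlgebra t ∈ _
    rw [h1]
    exact zero_mem _

theorem mul_mem_degFiltration {i j : ℕ} {a b : Grassmann n} (ha : a ∈ degFiltration n i)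
    (hb : b ∈ degFiltration n j) : a * b ∈ degFiltration n (i + j) := by
  rw [← sum_gcoeff a, ← sum_gcoeff b, Finset.sum_mul_sum]
  refine Submodule.sum_mem _ fun ν _ => Submodule.sum_mem _ fun μ _ => ?_
  rw [smul_mul_smul_comm]
  by_cases hν : ν.card < i
  · rw [mem_degFiltration.1 ha ν hν]; simp
  by_cases hμ : μ.card < j
  · rw [mem_degFiltration.1 hb μ hμ]; simp
  exact Submodule.smul_mem _ _
    (degFiltration_anti (by omega) (grassmannBasis_mul_mem_degFiltration ν μ))

theorem grassmannBasis_empty : grassmannBasis n ∅ = 1 := by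
  rw [grassmannBasis, ExteriorAlgebra.basis_apply_ofCard (Pi.basisFun ℂ (Fin n)) Finset.card_empty]
  simp [ExteriorAlgebra.ιMulti_family]

theorem grassmannBasis_mem_exteriorPower (ν : Finset (Fin n)) :
    grassmannBasis n ν ∈ ⋀[ℂ]^ν.card (Fin n → ℂ) := by
  have := ExteriorAlgebra.basis_eq_coe_basis (Pi.basisFun ℂ (Fin n))
    (⟨ν, rfl⟩ : Set.powersetCard (Fin n) ν.card)
  rw [grassmannBasis]
  change (Pi.basisFun ℂ (Fin n)).ExteriorAlgebra
    ((⟨ν, rfl⟩ : Set.powersetCard (Fin n) ν.card) : Finset (Fin n)) ∈ _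
  rw [this]
  exact Subtype.mem _

theorem gcoeff_algebraMap (ν : Finset (Fin n)) (c : ℂ) :
    gcoeff ν (algebraMap ℂ (Grassmann n) c) = if ν = ∅ then c else 0 := by
  rw [Algebra.algebraMap_eq_smul_one, ← grassmannBasis_empty, map_smul, gcoeff_basis]
  simp [eq_comm]

theorem sub_algebraMap_mem_degFiltration (a : Grassmann n) :
    a - algebraMap ℂ (Grassmann n) (gcoeff ∅ a) ∈ degFiltration n 1 :=
  mem_degFiltration.2 fun ν hν => by
    obtain rfl : ν = ∅ := by simpa using hν
    rw [map_sub, gcoeff_algebraMap]; simp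

variable (n) in
/-- The augmentation of `⋀ ℂⁿ`, sending every `θ_j` to zero. -/
def augmentation : Grassmann n →ₐ[ℂ] ℂ := ExteriorAlgebra.algebraMapInv

theorem augmentation_eq_zero {a : Grassmann n} (ha : a ∈ degFiltration n 1) :
    augmentation n a = 0 := by
  rw [← sum_gcoeff a, map_sum]
  refine Finset.sum_eq_zero fun ν _ => ?_
  rw [map_smul]
  by_cases hν : ν.card < 1
  · rw [mem_degFiltration.1 ha ν hν, zero_smul]
  have hp : IsNilpotent (grassmannBasis n ν) := by
    refine ⟨n + 1, eq_zero_of_mem_degFiltration ?_⟩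
    have key : ∀ k : ℕ, grassmannBasis n ν ^ k ∈ degFiltration n k := by
      intro k
      induction k with
      | zero => exact mem_degFiltration_zero _
      | succ k ih =>
        rw [pow_succ]
        exact mul_mem_degFiltration ih
          (degFiltration_anti (by omega) (grassmannBasis_mem_degFiltration ν))
    exact key _
  rw [(hp.map (augmentation n)).eq_zero, smul_zero]

theorem augmentation_eq_gcoeff (a : Grassmann n) : augmentation n a = gcoeff ∅ a := by
  have := augmentation_eq_zero (sub_algebraMap_mem_degFiltration a)
  rw [map_sub, sub_eq_zero] at this
  rw [this, AlgHom.commutes]; rfl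

theorem mem_degFiltration_one_iff {a : Grassmann n} :
    a ∈ degFiltration n 1 ↔ gcoeff ∅ a = 0 := by
  constructor
  · intro h; exact mem_degFiltration.1 h ∅ (by simp)
  · intro h
    have := sub_algebraMap_mem_degFiltration a
    rwa [h, map_zero, sub_zero] at this

/-- Algebra endomorphisms of `⋀ ℂⁿ` respect the degree filtration: the image of a generator has
square zero, so its augmentation vanishes. -/
theorem algHom_mem_degFiltration (c : Grassmann n →ₐ[ℂ] Grassmann n) {l : ℕ} {a : Grassmann n}
    (ha : a ∈ ⋀[ℂ]^l (Fin n → ℂ)) : c a ∈ degFiltration n l := by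
  have h1 : ∀ b ∈ LinearMap.range (ExteriorAlgebra.ι ℂ : (Fin n → ℂ) →ₗ[ℂ] _),
      c b ∈ degFiltration n 1 := by
    rintro _ ⟨v, rfl⟩
    rw [mem_degFiltration_one_iff, ← augmentation_eq_gcoeff]
    have : augmentation n (c (ExteriorAlgebra.ι ℂ v)) * augmentation n (c (ExteriorAlgebra.ι ℂ v))
        = 0 := by
      rw [← map_mul, ← map_mul, ExteriorAlgebra.ι_sq_zero, map_zero, map_zero]
    exact mul_self_eq_zero.1 this
  induction l generalizing a with
  | zero => exact mem_degFiltration_zero _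
  | succ l ih =>
    change a ∈ LinearMap.range (ExteriorAlgebra.ι ℂ : (Fin n → ℂ) →ₗ[ℂ] _) ^ (l + 1) at ha
    rw [pow_succ] at ha
    refine Submodule.mul_induction_on ha (fun x hx y hy => ?_) fun x y hx hy => ?_
    · rw [map_mul]; exact mul_mem_degFiltration (ih hx) (h1 y hy)
    · rw [map_add]; exact add_mem hx hy

end Grassmann

/-! ### Sections and their values in the Grassmann algebra -/

theorem mem_inf_of_mem {M : Type*} [TopologicalSpace M] {U V : Opens M} {x : M} (hU : x ∈ U)
    (hV : x ∈ V) : x ∈ U ⊓ V := ⟨hU, hV⟩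

namespace Hol

variable {m : ℕ} {M : Type u} [TopologicalSpace M] [ChartedSpace (EuclideanSpace ℂ (Fin m)) M]

/-- Evaluation of holomorphic functions at a point. -/
def eval {V : Opens M} (x : V) : Hol m V →ₐ[ℂ] ℂ where
  toFun h := h x
  map_one' := rfl
  map_mul' _ _ := rfl
  map_zero' := rfl
  map_add' _ _ := rfl
  commutes' _ := rfl

theorem eval_apply {V : Opens M} (x : V) (h : Hol m V) : eval x h = h x := rfl

/-- The holomorphic function on `V` given by a function on `M` which is holomorphic on `V`. -/
def ofContMDiffOn {V : Opens M} (g : M → ℂ)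
    (hg : ContMDiffOn 𝓘(ℂ, EuclideanSpace ℂ (Fin m)) 𝓘(ℂ, ℂ) ω g V) : Hol m V :=
  ⟨fun x => g x, fun x => contMDiffAt_subtype_iff.2 (hg.contMDiffAt (V.2.mem_nhds x.2))⟩

theorem contMDiffOn_of_eq {V : Opens M} (h : Hol m V) {g : M → ℂ}
    (hg : ∀ x : V, g x = h x) :
    ContMDiffOn 𝓘(ℂ, EuclideanSpace ℂ (Fin m)) 𝓘(ℂ, ℂ) ω g V := fun x hx => by
  refine ContMDiffAt.contMDiffWithinAt ?_
  have h1 := h.contMDiff ⟨x, hx⟩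
  have : (h : V → ℂ) = fun y : V => g y := funext fun y => (hg y).symm
  rw [this] at h1
  exact contMDiffAt_subtype_iff.1 h1

theorem isUnit_of_ne_zero {V : Opens M} (h : Hol m V) (h0 : ∀ x, h x ≠ 0) : IsUnit h := by
  refine IsUnit.of_mul_eq_one (⟨fun x => (h x)⁻¹, h.contMDiff.inv₀ h0⟩ : Hol m V) ?_
  ext x
  exact mul_inv_cancel₀ (h0 x)

theorem isOpen_ne_zero {V : Opens M} (h : Hol m V) :
    IsOpen {x : M | ∃ hx : x ∈ V, h ⟨x, hx⟩ ≠ 0} := by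
  have h1 : IsOpen {x : V | h x ≠ 0} := isOpen_ne.preimage h.contMDiff.continuous
  have h2 := V.2.isOpenEmbedding_subtypeVal.isOpenMap _ h1
  convert h2
  ext x
  simp only [mem_image, mem_ofPred_eq, Subtype.exists, exists_and_right, exists_eq_right]
  rfl

end Hol

namespace ComplexSupermanifold

variable {m n : ℕ} {M : ComplexSupermanifold.{u} m n}

theorem res_res {V₁ V₂ V₃ : Opens M} (h : V₁ ≤ V₂) (h' : V₂ ≤ V₃) (s : M.Sec V₃) :
    M.res h (M.res h' s) = M.res (h.trans h') s := by
  have := M.space.presheaf.map_comp (homOfLE h').op (homOfLE h).op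
  exact (congrArg (fun f => f.hom s) this).symm

theorem sec_eq_of_locally_eq {V : Opens M} {s t : M.Sec V}
    (h : ∀ x ∈ V, ∃ (V' : Opens M) (hV : V' ≤ V), x ∈ V' ∧ M.res hV s = M.res hV t) : s = t := by
  choose! U hUV hxU hU using h
  refine TopCat.Sheaf.eq_of_locally_eq' M.space.sheaf (fun x : V => U x) V
    (fun x => homOfLE (hUV x x.2)) ?_ s t fun x => hU x x.2
  intro x hx
  exact Opens.mem_iSup.2 ⟨⟨x, hx⟩, hxU x hx⟩

theorem exists_glue {V : Opens M} {ι : Type u} (U : ι → Opens M) (hU : ∀ i, U i ≤ V)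
    (hcov : ∀ x ∈ V, ∃ i, x ∈ U i) (s : ∀ i, M.Sec (U i))
    (hs : ∀ i j, M.res (inf_le_left : U i ⊓ U j ≤ U i) (s i) = M.res inf_le_right (s j)) :
    ∃ t : M.Sec V, ∀ i, M.res (hU i) t = s i := by
  obtain ⟨t, ht, -⟩ := TopCat.Sheaf.existsUnique_gluing' M.space.sheaf U V
    (fun i => homOfLE (hU i)) (fun x hx => Opens.mem_iSup.2 (hcov x hx)) s hs
  exact ⟨t, ht⟩

end ComplexSupermanifold

namespace SuperSpace.OddCoordinates

variable {m n : ℕ} {M : ComplexSupermanifold.{u} m n} {W : Opens M}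

/-- The value at `x` of an element of `𝒪(V) ⊗ ⋀ ℂⁿ`. -/
def tensorEval {V : Opens M} (x : V) : Hol m V ⊗[ℂ] Grassmann n →ₐ[ℂ] Grassmann n :=
  Algebra.TensorProduct.lift ((Algebra.ofId ℂ (Grassmann n)).comp (Hol.eval x)) (AlgHom.id ℂ _)
    fun h a => Algebra.commutes (Hol.eval x h) a

theorem tensorEval_tmul {V : Opens M} (x : V) (h : Hol m V) (a : Grassmann n) :
    tensorEval x (h ⊗ₜ a) = h x • a := by
  rw [Algebra.smul_def]
  exact Algebra.TensorProduct.lift_tmul _ _ _ _ _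

theorem gcoeff_tensorEval {V : Opens M} (x : V) (t : Hol m V ⊗[ℂ] Grassmann n)
    (ν : Finset (Fin n)) : gcoeff ν (tensorEval x t) =
      (Algebra.TensorProduct.basis (Hol m V) (grassmannBasis n)).repr t ν x := by
  induction t with
  | zero => simp
  | add t s ht hs =>
    rw [map_add, map_add, ht, hs, map_add]; rfl
  | tmul h a =>
    rw [tensorEval_tmul, Algebra.TensorProduct.basis_repr_tmul, map_smul]; rfl

/-- The value in `⋀ ℂⁿ` at the point `x` of a section over `V`, read in odd coordinates near `x`. -/
def ev (θ : M.OddCoordinates m n W) {V : Opens M} {x : M} (hW : x ∈ W) (hV : x ∈ V) :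
    M.Sec V →ₐ[ℂ] Grassmann n :=
  ((tensorEval ⟨x, mem_inf_of_mem hW hV⟩).comp (θ.equiv (W ⊓ V) inf_le_left).symm.toAlgHom).comp
    (M.res inf_le_right)

theorem tensorEval_symm_res (θ : M.OddCoordinates m n W) {V' V : Opens M} (h : V' ≤ V) (hV : V ≤ W)
    {x : M} (hx : x ∈ V') (s : M.Sec V) :
    tensorEval ⟨x, hx⟩ ((θ.equiv V' (h.trans hV)).symm (M.res h s)) =
      tensorEval ⟨x, h hx⟩ ((θ.equiv V hV).symm s) := by
  obtain ⟨t, rfl⟩ := (θ.equiv V hV).surjective s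
  rw [AlgEquiv.symm_apply_apply]
  induction t with
  | zero => simp
  | add t s ht hs => simp only [map_add, ht, hs]
  | tmul f a =>
    rw [θ.res_equiv, AlgEquiv.symm_apply_apply, tensorEval_tmul, tensorEval_tmul]; rfl

theorem ev_eq (θ : M.OddCoordinates m n W) {V : Opens M} (hVW : V ≤ W) {x : M} (hW : x ∈ W)
    (hV : x ∈ V) (s : M.Sec V) :
    θ.ev hW hV s = tensorEval ⟨x, hV⟩ ((θ.equiv V hVW).symm s) :=
  θ.tensorEval_symm_res inf_le_right hVW (mem_inf_of_mem hW hV) s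

theorem ev_res (θ : M.OddCoordinates m n W) {V' V : Opens M} (h : V' ≤ V) {x : M} (hW : x ∈ W)
    (hV' : x ∈ V') (s : M.Sec V) : θ.ev hW hV' (M.res h s) = θ.ev hW (h hV') s := by
  have := θ.tensorEval_symm_res (V' := W ⊓ V') (V := W ⊓ V) (inf_le_inf_left _ h) inf_le_left
    ⟨hW, hV'⟩ (M.res inf_le_right s)
  rw [ComplexSupermanifold.res_res] at this
  change tensorEval _ ((θ.equiv (W ⊓ V') _).symm (M.res _ (M.res h s))) = _
  rw [ComplexSupermanifold.res_res]
  exact this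

theorem gcoeff_ev (θ : M.OddCoordinates m n W) {V : Opens M} (hVW : V ≤ W) {x : M} (hW : x ∈ W)
    (hV : x ∈ V) (s : M.Sec V) (ν : Finset (Fin n)) :
    gcoeff ν (θ.ev hW hV s) = θ.coeff hVW s ν ⟨x, hV⟩ := by
  rw [θ.ev_eq hVW, gcoeff_tensorEval]; rfl

theorem ev_equiv_tmul (θ : M.OddCoordinates m n W) {V : Opens M} (hVW : V ≤ W) {x : M} (hW : x ∈ W)
    (hV : x ∈ V) (f : Hol m V) (a : Grassmann n) :
    θ.ev hW hV (θ.equiv V hVW (f ⊗ₜ a)) = f ⟨x, hV⟩ • a := by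
  rw [θ.ev_eq hVW, AlgEquiv.symm_apply_apply, tensorEval_tmul]

theorem sec_ext (θ : M.OddCoordinates m n W) {V : Opens M} (hVW : V ≤ W) {s t : M.Sec V}
    (h : ∀ x (hV : x ∈ V), θ.ev (hVW hV) hV s = θ.ev (hVW hV) hV t) : s = t := by
  apply (θ.equiv V hVW).symm.injective
  apply (Algebra.TensorProduct.basis (Hol m V) (grassmannBasis n)).ext_elem
  intro ν
  ext ⟨x, hx⟩
  have := congrArg (gcoeff ν) (h x hx)
  rwa [θ.gcoeff_ev hVW, θ.gcoeff_ev hVW] at this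

/-- The section `∑_ν c_ν θ^ν` with given coefficients. -/
def ofCoeff (θ : M.OddCoordinates m n W) {V : Opens M} (hVW : V ≤ W)
    (c : Finset (Fin n) → Hol m V) : M.Sec V :=
  ∑ ν, θ.equiv V hVW (c ν ⊗ₜ grassmannBasis n ν)

theorem gcoeff_ev_ofCoeff (θ : M.OddCoordinates m n W) {V : Opens M} (hVW : V ≤ W)
    (c : Finset (Fin n) → Hol m V) {x : M} (hW : x ∈ W) (hV : x ∈ V) (ν : Finset (Fin n)) :
    gcoeff ν (θ.ev hW hV (θ.ofCoeff hVW c)) = c ν ⟨x, hV⟩ := by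
  simp only [ofCoeff, map_sum, θ.ev_equiv_tmul, map_smul, gcoeff_basis]
  simp

/-- Odd coordinates restrict to smaller open sets. -/
def restrict (θ : M.OddCoordinates m n W) {W' : Opens M} (h : W' ≤ W) :
    M.OddCoordinates m n W' where
  equiv V hV := θ.equiv V (hV.trans h)
  res_equiv hV' hV f a := θ.res_equiv hV' (hV.trans h) f a
  equiv_mem_parity V hV f k a ha := θ.equiv_mem_parity V (hV.trans h) f k a ha

theorem ev_restrict (θ : M.OddCoordinates m n W) {W' : Opens M} (h : W' ≤ W) {V : Opens M} {x : M}
    (hW : x ∈ W') (hV : x ∈ V) (s : M.Sec V) :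
    (θ.restrict h).ev hW hV s = θ.ev (h hW) hV s := by
  rw [← θ.ev_res (inf_le_right : W' ⊓ V ≤ V) (h hW) (mem_inf_of_mem hW hV),
    ← (θ.restrict h).ev_res (inf_le_right : W' ⊓ V ≤ V) hW (mem_inf_of_mem hW hV),
    θ.ev_eq (inf_le_left.trans h), (θ.restrict h).ev_eq inf_le_left]
  rfl

/-- The coefficient functions of a section are holomorphic. -/
theorem contMDiffOn_gcoeff (θ : M.OddCoordinates m n W) {V : Opens M} (s : M.Sec V)
    (ν : Finset (Fin n)) {g : M → ℂ}
    (hg : ∀ x (hW : x ∈ W) (hV : x ∈ V), g x = gcoeff ν (θ.ev hW hV s)) :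
    ContMDiffOn 𝓘(ℂ, EuclideanSpace ℂ (Fin m)) 𝓘(ℂ, ℂ) ω g (W ⊓ V : Opens M) :=
  Hol.contMDiffOn_of_eq (θ.coeff inf_le_left (M.res inf_le_right s) ν) fun ⟨x, hx⟩ => by
    have hW : x ∈ W := hx.1
    have hV : x ∈ V := hx.2
    rw [hg x hW hV, ← θ.gcoeff_ev inf_le_left hW, θ.ev_res]

end SuperSpace.OddCoordinates

/-! ### Holomorphic functions in charts -/

section Charts

variable {m : ℕ} {M : Type u} [TopologicalSpace M] [ChartedSpace (EuclideanSpace ℂ (Fin m)) M]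

theorem analyticOnNhd_comp_chart_symm [IsManifold 𝓘(ℂ, EuclideanSpace ℂ (Fin m)) ω M]
    {F : Type*} [NormedAddCommGroup F] [NormedSpace ℂ F] [CompleteSpace F] {g : M → F} {V : Set M}
    (hg : ContMDiffOn 𝓘(ℂ, EuclideanSpace ℂ (Fin m)) 𝓘(ℂ, F) ω g V) {p : M}
    {B : Set (EuclideanSpace ℂ (Fin m))} (hB : IsOpen B)
    (hBt : B ⊆ (chartAt (EuclideanSpace ℂ (Fin m)) p).target)
    (hBV : ∀ z ∈ B, (chartAt (EuclideanSpace ℂ (Fin m)) p).symm z ∈ V) :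
    AnalyticOnNhd ℂ (fun z => g ((chartAt (EuclideanSpace ℂ (Fin m)) p).symm z)) B := by
  have h1 := (contMDiffOn_chart_symm (I := 𝓘(ℂ, EuclideanSpace ℂ (Fin m))) (n := ω) (x := p)).mono
    hBt
  have h2 := contMDiffOn_iff_contDiffOn.1 (hg.comp h1 hBV)
  intro z hz
  exact (h2.contDiffAt (hB.mem_nhds hz)).analyticAt

theorem contMDiffOn_comp_chart [IsManifold 𝓘(ℂ, EuclideanSpace ℂ (Fin m)) ω M]
    {F : Type*} [NormedAddCommGroup F] [NormedSpace ℂ F] [CompleteSpace F]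
    {B : Set (EuclideanSpace ℂ (Fin m))} {G : EuclideanSpace ℂ (Fin m) → F}
    (hG : AnalyticOnNhd ℂ G B) (p : M) :
    ContMDiffOn 𝓘(ℂ, EuclideanSpace ℂ (Fin m)) 𝓘(ℂ, F) ω
      (fun x => G (chartAt (EuclideanSpace ℂ (Fin m)) p x))
      ((chartAt (EuclideanSpace ℂ (Fin m)) p).source ∩
        chartAt (EuclideanSpace ℂ (Fin m)) p ⁻¹' B) := by
  have h1 := (contMDiffOn_chart (I := 𝓘(ℂ, EuclideanSpace ℂ (Fin m))) (n := ω) (x := p)).mono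
    (inter_subset_left (t := chartAt (EuclideanSpace ℂ (Fin m)) p ⁻¹' B))
  exact (contMDiffOn_iff_contDiffOn.2 hG.contDiffOn_of_completeSpace).comp h1 fun x hx => hx.2

/-- The open set which is the ball of centre `c` and radius `r` in the chart at `p`. -/
def chartBall (p : M) (c : EuclideanSpace ℂ (Fin m)) (r : ℝ) : Opens M :=
  ⟨(chartAt (EuclideanSpace ℂ (Fin m)) p).source ∩
    chartAt (EuclideanSpace ℂ (Fin m)) p ⁻¹' ball c r,
    (chartAt (EuclideanSpace ℂ (Fin m)) p).isOpen_inter_preimage isOpen_ball⟩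

theorem chartBall_mono {p : M} {c c' : EuclideanSpace ℂ (Fin m)} {r r' : ℝ}
    (h : ball c r ⊆ ball c' r') : chartBall p c r ≤ chartBall p c' r' :=
  fun _ hx => ⟨hx.1, h hx.2⟩

theorem chart_symm_mem_chartBall {p : M} {c z : EuclideanSpace ℂ (Fin m)} {r : ℝ}
    (ht : ball c r ⊆ (chartAt (EuclideanSpace ℂ (Fin m)) p).target) (hz : z ∈ ball c r) :
    (chartAt (EuclideanSpace ℂ (Fin m)) p).symm z ∈ chartBall p c r :=
  ⟨(chartAt (EuclideanSpace ℂ (Fin m)) p).map_target (ht hz), by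
    rw [mem_preimage, (chartAt (EuclideanSpace ℂ (Fin m)) p).right_inv (ht hz)]; exact hz⟩

/-- The `k`-th coordinate function of the chart at `p`. -/
def chartCoord (p : M) (k : Fin m) (x : M) : ℂ := (chartAt (EuclideanSpace ℂ (Fin m)) p x) k

theorem contMDiffOn_chartCoord [IsManifold 𝓘(ℂ, EuclideanSpace ℂ (Fin m)) ω M] (p : M)
    (k : Fin m) : ContMDiffOn 𝓘(ℂ, EuclideanSpace ℂ (Fin m)) 𝓘(ℂ, ℂ) ω (chartCoord p k)
      (chartAt (EuclideanSpace ℂ (Fin m)) p).source := by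
  have h : AnalyticOnNhd ℂ (EuclideanSpace.proj k : EuclideanSpace ℂ (Fin m) →L[ℂ] ℂ) univ :=
    fun z _ => ContinuousLinearMap.analyticAt _ z
  have := contMDiffOn_comp_chart h p
  rwa [preimage_univ, inter_univ] at this

end Charts

/-! ### Point homomorphisms and the Taylor estimate -/

namespace ComplexSupermanifold

variable {m n : ℕ}

/-- A compatible family of algebra homomorphisms `𝒪(V) → ⋀ ℂⁿ` for the open neighbourhoods `V` of
`y`, that is, a homomorphism from the stalk of `𝒪` at `y` to `⋀ ℂⁿ`. -/
structure PointHom (M : ComplexSupermanifold.{u} m n) (y : M) where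
  hom : ∀ V : Opens M, y ∈ V → M.Sec V →ₐ[ℂ] Grassmann n
  hom_res : ∀ {V' V : Opens M} (h : V' ≤ V) (hy : y ∈ V') (s : M.Sec V),
    hom V' hy (M.res h s) = hom V (h hy) s

namespace PointHom

variable {M : ComplexSupermanifold.{u} m n} {y : M} (χ : M.PointHom y) {W : Opens M}
  (θ : M.OddCoordinates m n W)

/-- The restriction of a point homomorphism to the holomorphic functions, which are embedded into
the sections by means of odd coordinates. -/
def hol {V : Opens M} (hVW : V ≤ W) (hy : y ∈ V) : Hol m V →ₐ[ℂ] Grassmann n :=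
  ((χ.hom V hy).comp (θ.equiv V hVW).toAlgHom).comp Algebra.TensorProduct.includeLeft

/-- The restriction of a point homomorphism to the Grassmann algebra generated by odd coordinates.
-/
def odd (hy : y ∈ W) : Grassmann n →ₐ[ℂ] Grassmann n :=
  ((χ.hom W hy).comp (θ.equiv W le_rfl).toAlgHom).comp Algebra.TensorProduct.includeRight

theorem hol_apply {V : Opens M} (hVW : V ≤ W) (hy : y ∈ V) (f : Hol m V) :
    χ.hol θ hVW hy f = χ.hom V hy (θ.equiv V hVW (f ⊗ₜ 1)) := rfl

theorem odd_apply (hy : y ∈ W) (a : Grassmann n) :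
    χ.odd θ hy a = χ.hom W hy (θ.equiv W le_rfl (1 ⊗ₜ a)) := rfl

theorem hol_res {V' V : Opens M} (h : V' ≤ V) (hVW : V ≤ W) (hy : y ∈ V') (f : Hol m V) :
    χ.hol θ (h.trans hVW) hy (Hol.res h f) = χ.hol θ hVW (h hy) f := by
  rw [hol_apply, hol_apply, ← θ.res_equiv h hVW, χ.hom_res]

theorem hom_tmul {V : Opens M} (hVW : V ≤ W) (hy : y ∈ V) (f : Hol m V) (a : Grassmann n) :
    χ.hom V hy (θ.equiv V hVW (f ⊗ₜ a)) = χ.hol θ hVW hy f * χ.odd θ (hVW hy) a := by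
  have h1 : θ.equiv V hVW (1 ⊗ₜ a) = M.res hVW (θ.equiv W le_rfl (1 ⊗ₜ a)) := by
    rw [θ.res_equiv, map_one]
  rw [hol_apply, odd_apply, ← χ.hom_res hVW hy, ← h1, ← map_mul, ← map_mul,
    Algebra.TensorProduct.tmul_mul_tmul, one_mul, mul_one]

theorem hom_eq_sum {V : Opens M} (hVW : V ≤ W) (hy : y ∈ V) (s : M.Sec V) :
    χ.hom V hy s = ∑ ν, χ.hol θ hVW hy (θ.coeff hVW s ν) *
      χ.odd θ (hVW hy) (grassmannBasis n ν) := by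
  conv_lhs => rw [θ.sum_coeff hVW s]
  rw [map_sum]
  exact Finset.sum_congr rfl fun ν _ => χ.hom_tmul θ hVW hy _ _

theorem odd_mem_degFiltration (hy : y ∈ W) (ν : Finset (Fin n)) :
    χ.odd θ hy (grassmannBasis n ν) ∈ degFiltration n ν.card :=
  algHom_mem_degFiltration _ (grassmannBasis_mem_exteriorPower ν)

/-- The body of a point homomorphism at `y` is evaluation at `y`, because a holomorphic function
which does not vanish at `y` is invertible near `y`. -/
theorem gcoeff_empty_hol {V : Opens M} (hVW : V ≤ W) (hy : y ∈ V) (f : Hol m V) :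
    gcoeff ∅ (χ.hol θ hVW hy f) = f ⟨y, hy⟩ := by
  set c := gcoeff ∅ (χ.hol θ hVW hy f) with hc
  set f' : Hol m V := f - algebraMap ℂ _ c with hf'
  have h0 : gcoeff ∅ (χ.hol θ hVW hy f') = 0 := by
    rw [hf', map_sub, map_sub, AlgHom.commutes, gcoeff_algebraMap, ← hc]; simp
  by_contra hne
  have hne' : f' ⟨y, hy⟩ ≠ 0 := fun h => hne (sub_eq_zero.1 h).symm
  let V' : Opens M := ⟨_, Hol.isOpen_ne_zero f'⟩
  have hV' : V' ≤ V := fun x hx => hx.1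
  have hyV' : y ∈ V' := ⟨hy, hne'⟩
  have hu : IsUnit (Hol.res hV' f') := Hol.isUnit_of_ne_zero _ fun x => x.2.2
  have hu2 := (hu.map (χ.hol θ (hV'.trans hVW) hyV')).map (augmentation n)
  rw [χ.hol_res θ hV' hVW, augmentation_eq_gcoeff, h0] at hu2
  exact not_isUnit_zero hu2

theorem hol_sub_mem_degFiltration {V : Opens M} (hVW : V ≤ W) (hy : y ∈ V) (f : Hol m V) :
    χ.hol θ hVW hy f - algebraMap ℂ _ (f ⟨y, hy⟩) ∈ degFiltration n 1 := by
  rw [← χ.gcoeff_empty_hol θ hVW hy f]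
  exact sub_algebraMap_mem_degFiltration _

/-- The coordinates of the chart at `p`, as holomorphic functions on a subset of its domain. -/
def _root_.Supergeometry.chartCoordHol {p : M} {V : Opens M}
    (hV : (V : Set M) ⊆ (chartAt (EuclideanSpace ℂ (Fin m)) p).source) (k : Fin m) : Hol m V :=
  Hol.ofContMDiffOn (chartCoord p k) ((contMDiffOn_chartCoord p k).mono hV)

theorem gnorm_algebraMap (c : ℂ) : gnorm (algebraMap ℂ (Grassmann n) c) = ‖c‖ := by
  rw [gnorm, Finset.sum_eq_single ∅]
  · simp [gcoeff_algebraMap]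
  · intro ν _ hν; simp [gcoeff_algebraMap, hν]
  · simp

/-- The recursion behind the Taylor estimate: modulo elements of higher degree, Hadamard's lemma
reduces the estimate of `w * χ f` for `w` of degree at least `l` to that of `w' * χ g` for `w'` of
degree at least `l + 1`. -/
theorem exists_gnorm_mul_hol_le (M : ComplexSupermanifold.{u} m n) {C : ℝ} (hC : 0 ≤ C) (j : ℕ) :
    ∀ l : ℕ, j + l = n + 1 → ∀ r : ℝ, 0 < r → ∃ K : ℝ, 0 ≤ K ∧
      ∀ (p y : M) (W : Opens M) (θ : M.OddCoordinates m n W) (χ : M.PointHom y) (hy : y ∈ W)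
        (hW : (W : Set M) ⊆ (chartAt (EuclideanSpace ℂ (Fin m)) p).source)
        (_ : ∀ k, gnorm (χ.hol θ le_rfl hy (chartCoordHol hW k)) ≤ C)
        (_ : ball (chartAt (EuclideanSpace ℂ (Fin m)) p y) r ⊆
          (chartAt (EuclideanSpace ℂ (Fin m)) p).target)
        (V : Opens M) (hVW : V ≤ W) (hyV : y ∈ V)
        (hB : chartBall p (chartAt (EuclideanSpace ℂ (Fin m)) p y) r ≤ V)
        (f : Hol m V) (S : ℝ) (_ : ∀ x (hx : x ∈ chartBall p _ r), ‖f ⟨x, hB hx⟩‖ ≤ S)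
        (w : Grassmann n) (_ : w ∈ degFiltration n l),
        gnorm (w * χ.hol θ hVW hyV f) ≤ K * gnorm w * S := by
  induction j with
  | zero =>
    intro l hl r hr
    refine ⟨0, le_rfl, ?_⟩
    intro p y W θ χ hy hW hz ht V hVW hyV hB f S hS w hw
    obtain rfl : l = n + 1 := by omega
    rw [eq_zero_of_mem_degFiltration hw]; simp
  | succ j ih =>
    intro l hl r hr
    obtain ⟨K', hK', hK⟩ := ih (l + 1) (by omega) (r / 12) (by positivity)
    have hgm := gmulConst_nonneg (n := n)
    refine ⟨1 + m * (K' * (gmulConst n * (2 * C)) * (36 / r)), by positivity, ?_⟩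
    intro p y W θ χ hy hW hz ht V hVW hyV hB f S hS w hw
    classical
    set e := chartAt (EuclideanSpace ℂ (Fin m)) p with he
    set c := e y with hc
    have hyB : y ∈ chartBall p c r := ⟨hW hy, mem_ball_self hr⟩
    have hS0 : 0 ≤ S := (norm_nonneg _).trans (hS y hyB)
    set F : M → ℂ := fun x => if hx : x ∈ V then f ⟨x, hx⟩ else 0 with hF
    have hFV : ∀ x (hx : x ∈ V), F x = f ⟨x, hx⟩ := fun x hx => dif_pos hx
    have hFc := Hol.contMDiffOn_of_eq f (g := F) fun x => hFV x x.2
    have hmem : ∀ z ∈ ball c r, e.symm z ∈ chartBall p c r := fun z hz =>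
      chart_symm_mem_chartBall ht hz
    have hFa := analyticOnNhd_comp_chart_symm hFc isOpen_ball ht fun z hz => hB (hmem z hz)
    obtain ⟨H, hHa, hHn, hH⟩ := exists_eq_add_clm_apply hr hFa (S := S) fun z hz => by
      rw [hFV _ (hB (hmem z hz))]; exact hS _ (hmem z hz)
    -- the holomorphic functions `h k` with `f = f y + ∑ k, (z_k - z_k(y)) * h k` near `y`
    set B := chartBall p c (r / 12) with hBdef
    have hBr : B ≤ chartBall p c r := chartBall_mono (ball_subset_ball (by linarith))
    have hBV : B ≤ V := hBr.trans hB
    have hyB' : y ∈ B := ⟨hW hy, mem_ball_self (by positivity)⟩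
    have hHk : ∀ k, AnalyticOnNhd ℂ (fun z => H z (EuclideanSpace.single k 1)) (ball c (r / 12)) :=
      fun k => ((ContinuousLinearMap.apply ℂ ℂ
        (EuclideanSpace.single k (1 : ℂ))).analyticOnNhd univ).comp hHa fun _ _ => mem_univ _
    let h : Fin m → Hol m B := fun k =>
      Hol.ofContMDiffOn (fun x => H (e x) (EuclideanSpace.single k 1))
        (contMDiffOn_comp_chart (hHk k) p)
    have hhk : ∀ k x (hx : x ∈ B), ‖h k ⟨x, hx⟩‖ ≤ 36 / r * S := by
      intro k x hx
      refine ((H (e x)).le_opNorm _).trans ?_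
      rw [PiLp.norm_single, norm_one, mul_one]
      exact hHn _ hx.2
    have hdec : Hol.res hBV f = algebraMap ℂ _ (f ⟨y, hyV⟩) +
        ∑ k, (Hol.res (hBV.trans hVW) (chartCoordHol hW k) - algebraMap ℂ _ (c k)) * h k := by
      ext ⟨x, hx⟩
      have h1 : F (e.symm (e x)) = F (e.symm c) + H (e x) (e x - c) := hH (e x) hx.2
      have hx1 : e.symm (e x) = x := e.left_inv hx.1
      have hy1 : e.symm c = y := e.left_inv (hW hy)
      rw [hx1, hy1, hFV x (hBV hx), hFV y hyV] at h1
      have h2 : H (e x) (e x - c) = ∑ k, (e x k - c k) * H (e x) (EuclideanSpace.single k 1) := by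
        have : e x - c = ∑ k, (e x k - c k) • EuclideanSpace.single k (1 : ℂ) := by
          ext i
          simp [Finset.sum_apply, Pi.single_apply]
        conv_lhs => rw [this]
        simp only [map_sum, map_smul, smul_eq_mul]
      rw [h2] at h1
      have h3 : (Hol.eval (⟨x, hx⟩ : B)) (algebraMap ℂ _ (f ⟨y, hyV⟩) +
        ∑ k, (Hol.res (hBV.trans hVW) (chartCoordHol hW k) - algebraMap ℂ _ (c k)) * h k) =
        f ⟨y, hyV⟩ + ∑ k, (e x k - c k) * H (e x) (EuclideanSpace.single k 1) := by
        rw [map_add, map_sum, AlgHom.commutes]; simp only [map_mul, map_sub, AlgHom.commutes]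
        rfl
      exact h1.trans h3.symm
    have hdec2 : w * χ.hol θ hVW hyV f = f ⟨y, hyV⟩ • w +
        ∑ k, w * (χ.hol θ le_rfl hy (chartCoordHol hW k) - algebraMap ℂ _ (c k)) *
          χ.hol θ (hBV.trans hVW) hyB' (h k) := by
      rw [← χ.hol_res θ hBV hVW hyB' f, hdec, map_add, map_sum, AlgHom.commutes, mul_add,
        ← Algebra.commutes, ← Algebra.smul_def, Finset.mul_sum]
      congr 1
      refine Finset.sum_congr rfl fun k _ => ?_
      rw [map_mul, map_sub, AlgHom.commutes, ← mul_assoc,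
        χ.hol_res θ (hBV.trans hVW) le_rfl hyB']
    have hck : ∀ k, gcoeff ∅ (χ.hol θ le_rfl hy (chartCoordHol hW k)) = c k := fun k =>
      χ.gcoeff_empty_hol θ le_rfl hy _
    have hterm : ∀ k, gnorm (w * (χ.hol θ le_rfl hy (chartCoordHol hW k) - algebraMap ℂ _ (c k)) *
          χ.hol θ (hBV.trans hVW) hyB' (h k)) ≤
        K' * (gmulConst n * (2 * C)) * (36 / r) * gnorm w * S := by
      intro k
      have hd : w * (χ.hol θ le_rfl hy (chartCoordHol hW k) - algebraMap ℂ _ (c k)) ∈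
          degFiltration n (l + 1) := by
        refine mul_mem_degFiltration hw ?_
        rw [← hck k]
        exact sub_algebraMap_mem_degFiltration _
      have hg : gnorm (χ.hol θ le_rfl hy (chartCoordHol hW k) - algebraMap ℂ _ (c k)) ≤ 2 * C := by
        refine (gnorm_sub_le _ _).trans ?_
        rw [gnorm_algebraMap, ← hck k]
        linarith [norm_gcoeff_le_gnorm (χ.hol θ le_rfl hy (chartCoordHol hW k)) ∅, hz k]
      refine (hK p y W θ χ hy hW hz ((ball_subset_ball (by linarith)).trans ht) B
        (hBV.trans hVW) hyB' le_rfl (h k) (36 / r * S) (fun x hx => hhk k x hx) _ hd).trans ?_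
      calc K' * gnorm (w * (χ.hol θ le_rfl hy (chartCoordHol hW k) - algebraMap ℂ _ (c k))) *
            (36 / r * S) ≤ K' * (gmulConst n * gnorm w * (2 * C)) * (36 / r * S) := by
            gcongr
            exact (gnorm_mul_le _ _).trans
              (mul_le_mul_of_nonneg_left hg (mul_nonneg hgm (gnorm_nonneg _)))
        _ = _ := by ring
    rw [hdec2]
    calc _ ≤ gnorm (f ⟨y, hyV⟩ • w) + ∑ k, gnorm (w * (χ.hol θ le_rfl hy (chartCoordHol hW k) -
            algebraMap ℂ _ (c k)) * χ.hol θ (hBV.trans hVW) hyB' (h k)) :=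
          (gnorm_add_le _ _).trans (add_le_add le_rfl (gnorm_sum_le _ _))
      _ ≤ S * gnorm w + ∑ _k : Fin m, K' * (gmulConst n * (2 * C)) * (36 / r) * gnorm w * S := by
          refine add_le_add ?_ (Finset.sum_le_sum fun k _ => hterm k)
          rw [gnorm_smul]
          exact mul_le_mul_of_nonneg_right (hS y hyB) (gnorm_nonneg _)
      _ = _ := by
          rw [Finset.sum_const, Finset.card_univ, Fintype.card_fin, nsmul_eq_mul]; ring

/-- The Taylor estimate: the value of a point homomorphism at a section is bounded in terms of the
values at the coordinates and of a bound for the coefficients of the section on a ball. -/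
theorem exists_gnorm_hom_le (M : ComplexSupermanifold.{u} m n) {C r : ℝ} (hC : 0 ≤ C)
    (hr : 0 < r) : ∃ K : ℝ, 0 ≤ K ∧
      ∀ (p y : M) (W : Opens M) (θ : M.OddCoordinates m n W) (χ : M.PointHom y) (hy : y ∈ W)
        (hW : (W : Set M) ⊆ (chartAt (EuclideanSpace ℂ (Fin m)) p).source)
        (_ : ∀ k, gnorm (χ.hol θ le_rfl hy (chartCoordHol hW k)) ≤ C)
        (_ : ∀ ν, gnorm (χ.odd θ hy (grassmannBasis n ν)) ≤ C)
        (_ : ball (chartAt (EuclideanSpace ℂ (Fin m)) p y) r ⊆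
          (chartAt (EuclideanSpace ℂ (Fin m)) p).target)
        (hBW : chartBall p (chartAt (EuclideanSpace ℂ (Fin m)) p y) r ≤ W)
        (V : Opens M) (hB : chartBall p (chartAt (EuclideanSpace ℂ (Fin m)) p y) r ≤ V)
        (hyV : y ∈ V) (s : M.Sec V) (S : ℝ)
        (_ : ∀ x (hx : x ∈ chartBall p _ r) (ν : Finset (Fin n)),
          ‖gcoeff ν (θ.ev (hBW hx) (hB hx) s)‖ ≤ S),
        gnorm (χ.hom V hyV s) ≤ K * S := by
  obtain ⟨K, hK0, hK⟩ := exists_gnorm_mul_hol_le M hC (n + 1) 0 (by omega) r hr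
  have hgm := gmulConst_nonneg (n := n)
  refine ⟨2 ^ n * (gmulConst n * (K * gnorm (1 : Grassmann n)) * C), by
    have := gnorm_nonneg (1 : Grassmann n); positivity, ?_⟩
  intro p y W θ χ hy hW hz hodd ht hBW V hB hyV s S hS
  have hyI : y ∈ W ⊓ V := mem_inf_of_mem hy hyV
  have hBI : chartBall p (chartAt (EuclideanSpace ℂ (Fin m)) p y) r ≤ W ⊓ V := le_inf hBW hB
  rw [← χ.hom_res (inf_le_right : W ⊓ V ≤ V) hyI, χ.hom_eq_sum θ inf_le_left hyI]
  have hS0 : 0 ≤ S := (norm_nonneg _).trans (hS y ⟨hW hy, mem_ball_self hr⟩ ∅)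
  refine (gnorm_sum_le _ _).trans ?_
  have hterm : ∀ ν, gnorm (χ.hol θ (inf_le_left : W ⊓ V ≤ W) hyI
      (θ.coeff inf_le_left (M.res inf_le_right s) ν) * χ.odd θ hy (grassmannBasis n ν)) ≤
      gmulConst n * (K * gnorm (1 : Grassmann n)) * C * S := by
    intro ν
    have h1 := hK p y W θ χ hy hW hz ht (W ⊓ V) inf_le_left hyI hBI
      (θ.coeff inf_le_left (M.res inf_le_right s) ν) S (fun x hx => by
        rw [← θ.gcoeff_ev inf_le_left (hBW hx), θ.ev_res]; exact hS x hx ν) 1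
      (mem_degFiltration_zero _)
    rw [one_mul] at h1
    calc _ ≤ gmulConst n * gnorm _ * gnorm _ := gnorm_mul_le _ _
      _ ≤ gmulConst n * (K * gnorm (1 : Grassmann n) * S) * C := by
          have := gnorm_nonneg (1 : Grassmann n)
          gcongr
          · exact gnorm_nonneg _
          · exact hodd ν
      _ = _ := by ring
  refine (Finset.sum_le_sum fun ν _ => hterm ν).trans (le_of_eq ?_)
  simp; ring

end PointHom

end ComplexSupermanifold

/-! ### Morphisms and point homomorphisms -/

namespace ComplexSupermanifold

variable {m n : ℕ} {M : ComplexSupermanifold.{u} m n}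

theorem comap_le_comap (g : C(M, M)) {V' V : Opens M} (h : V' ≤ V) : V'.comap g ≤ V.comap g :=
  fun _ hx => h hx

theorem pullback_res (φ : M.space ⟶ M.space) {V' V : Opens M} (h : V' ≤ V) (s : M.Sec V) :
    SuperSpace.pullback φ V' (M.res h s) =
      M.res (comap_le_comap (SuperSpace.base φ) h) (SuperSpace.pullback φ V s) :=
  congrArg (fun f => f.hom s) (φ.hom.c.naturality (homOfLE h).op)

namespace PointHom

/-- Evaluation in odd coordinates is a point homomorphism. -/
def ofCoord {W : Opens M} (θ : M.OddCoordinates m n W) {x : M} (hx : x ∈ W) : M.PointHom x where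
  hom _ hV := θ.ev hx hV
  hom_res h hy s := θ.ev_res h hx hy s

/-- The composition of a point homomorphism with a morphism. -/
def comp {x : M} (χ : M.PointHom x) (φ : M.space ⟶ M.space) :
    M.PointHom (SuperSpace.base φ x) where
  hom V hy := (χ.hom (V.comap (SuperSpace.base φ)) hy).comp (SuperSpace.pullback φ V)
  hom_res {V' V} h hy s := by
    rw [AlgHom.comp_apply, pullback_res, χ.hom_res _ hy]; rfl

end PointHom

theorem continuousAt_gcoeff_ev {W : Opens M} (θ : M.OddCoordinates m n W) {V : Opens M}
    (s : M.Sec V) (ν : Finset (Fin n)) {x : M} (hW : x ∈ W) (hV : x ∈ V) {g : M → ℂ}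
    (hg : ∀ x (hW : x ∈ W) (hV : x ∈ V), g x = gcoeff ν (θ.ev hW hV s)) : ContinuousAt g x :=
  (θ.contMDiffOn_gcoeff s ν hg).continuousOn.continuousAt
    ((W ⊓ V).2.mem_nhds (mem_inf_of_mem hW hV))

theorem exists_gnorm_ev_le {W : Opens M} (θ : M.OddCoordinates m n W) {V : Opens M}
    (s : M.Sec V) {x : M} (hW : x ∈ W) (hV : x ∈ V) :
    ∃ C : ℝ, 0 ≤ C ∧ ∀ᶠ x' in 𝓝 x, ∀ (hW' : x' ∈ W) (hV' : x' ∈ V),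
      gnorm (θ.ev hW' hV' s) ≤ C := by
  classical
  have h1 : ∀ ν : Finset (Fin n), ∃ C : ℝ, ∀ᶠ x' in 𝓝 x, ∀ (hW' : x' ∈ W) (hV' : x' ∈ V),
      ‖gcoeff ν (θ.ev hW' hV' s)‖ ≤ C := by
    intro ν
    let g : M → ℂ := fun x =>
      if h : x ∈ W ∧ x ∈ V then gcoeff ν (θ.ev h.1 h.2 s) else 0
    have hg : ∀ x (hW : x ∈ W) (hV : x ∈ V), g x = gcoeff ν (θ.ev hW hV s) :=
      fun x hW hV => dif_pos ⟨hW, hV⟩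
    have hc := (continuousAt_gcoeff_ev θ s ν hW hV hg).norm
    refine ⟨‖g x‖ + 1, ?_⟩
    filter_upwards [hc.eventually_lt_const (lt_add_one ‖g x‖)] with x' hx' hW' hV'
    rw [← hg]; exact hx'.le
  choose C hC using h1
  refine ⟨∑ ν, |C ν|, Finset.sum_nonneg fun _ _ => abs_nonneg _, ?_⟩
  filter_upwards [eventually_all.2 hC] with x' hx' hW' hV'
  exact Finset.sum_le_sum fun ν _ => (hx' ν hW' hV').trans (le_abs_self _)

/-- A uniform version of the Taylor estimate: the point `y` may vary near a given point. -/
theorem exists_gnorm_hom_le_near {p : M} {W : Opens M} (θ : M.OddCoordinates m n W)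
    (hW : (W : Set M) ⊆ (chartAt (EuclideanSpace ℂ (Fin m)) p).source) {y₀ : M} (hy₀ : y₀ ∈ W)
    {N : Opens M} (hN : y₀ ∈ N) {C : ℝ} (hC : 0 ≤ C) :
    ∃ N' : Opens M, y₀ ∈ N' ∧ N' ≤ N ∧ N' ≤ W ∧ ∃ K : ℝ, 0 ≤ K ∧
      ∀ (y : M) (χ : M.PointHom y) (hy : y ∈ W) (_ : y ∈ N')
        (_ : ∀ k, gnorm (χ.hol θ le_rfl hy (chartCoordHol hW k)) ≤ C)
        (_ : ∀ ν, gnorm (χ.odd θ hy (grassmannBasis n ν)) ≤ C)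
        (V : Opens M) (hNV : N ≤ V) (hyV : y ∈ V) (s : M.Sec V) (S : ℝ)
        (_ : ∀ x (hx : x ∈ N) (hxW : x ∈ W) (ν : Finset (Fin n)),
          ‖gcoeff ν (θ.ev hxW (hNV hx) s)‖ ≤ S),
        gnorm (χ.hom V hyV s) ≤ K * S := by
  set e := chartAt (EuclideanSpace ℂ (Fin m)) p with he
  have hopen : IsOpen (e.target ∩ e.symm ⁻¹' (W ⊓ N : Opens M)) :=
    e.symm.isOpen_inter_preimage (W ⊓ N).2
  have hmem : e y₀ ∈ e.target ∩ e.symm ⁻¹' (W ⊓ N : Opens M) :=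
    ⟨e.map_source (hW hy₀), by
      rw [mem_preimage, e.left_inv (hW hy₀)]; exact ⟨hy₀, hN⟩⟩
  obtain ⟨R, hR, hRsub⟩ := Metric.isOpen_iff.1 hopen _ hmem
  have hR2 : 0 < R / 2 := by positivity
  have hball : chartBall p (e y₀) R ≤ W ⊓ N := fun x hx => by
    have := (hRsub hx.2).2
    rwa [mem_preimage, e.left_inv hx.1] at this
  have hN' : chartBall p (e y₀) (R / 2) ≤ W ⊓ N :=
    (chartBall_mono (ball_subset_ball (by linarith))).trans hball
  obtain ⟨K, hK0, hK⟩ := PointHom.exists_gnorm_hom_le M hC hR2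
  refine ⟨chartBall p (e y₀) (R / 2), ⟨hW hy₀, mem_ball_self hR2⟩, hN'.trans inf_le_right,
    hN'.trans inf_le_left, K, hK0, ?_⟩
  intro y χ hy hyN hz hodd V hNV hyV s S hS
  have hsub : ball (e y) (R / 2) ⊆ ball (e y₀) R := ball_subset_ball' (by
    have : dist (e y) (e y₀) < R / 2 := hyN.2
    linarith)
  have hB := (chartBall_mono (p := p) hsub).trans hball
  exact hK p y W θ χ hy hW hz hodd (hsub.trans fun z hz => (hRsub hz).1) (hB.trans inf_le_left) V
    ((hB.trans inf_le_right).trans hNV) hyV s S fun x hx ν =>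
      hS x (hB.trans inf_le_right hx) (hB.trans inf_le_left hx) ν

/-- Comparison of odd coordinates: the coefficients with respect to one system are bounded by those
with respect to another system on a neighbourhood. -/
theorem exists_gnorm_ev_le_of_coordChange {W W' : Opens M} (θ : M.OddCoordinates m n W)
    (θ' : M.OddCoordinates m n W') {x : M} (hx : x ∈ W) (hx' : x ∈ W') {N : Opens M}
    (hN : x ∈ N) : ∃ N' : Opens M, x ∈ N' ∧ N' ≤ N ∧ N' ≤ W' ∧ ∃ K : ℝ, 0 ≤ K ∧
      ∀ (V : Opens M) (hNV : N ≤ V) (s : M.Sec V) (S : ℝ)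
        (_ : ∀ y (hy : y ∈ N) (hyW : y ∈ W) (ν : Finset (Fin n)),
          ‖gcoeff ν (θ.ev hyW (hNV hy) s)‖ ≤ S),
        ∀ y (_ : y ∈ N') (hyV : y ∈ V) (hyW' : y ∈ W'), gnorm (θ'.ev hyW' hyV s) ≤ K * S := by
  let W₁ : Opens M := W ⊓ ⟨(chartAt (EuclideanSpace ℂ (Fin m)) x).source,
    (chartAt (EuclideanSpace ℂ (Fin m)) x).open_source⟩
  have hW₁ : (W₁ : Set M) ⊆ (chartAt (EuclideanSpace ℂ (Fin m)) x).source := fun y hy => hy.2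
  have hx₁ : x ∈ W₁ := ⟨hx, mem_chart_source _ x⟩
  let θ₁ := θ.restrict (inf_le_left : W₁ ≤ W)
  have h1 := fun k : Fin m => exists_gnorm_ev_le θ'
    (θ₁.equiv W₁ le_rfl (chartCoordHol hW₁ k ⊗ₜ 1)) hx' hx₁
  have h2 := fun ν : Finset (Fin n) => exists_gnorm_ev_le θ'
    (θ₁.equiv W₁ le_rfl (1 ⊗ₜ grassmannBasis n ν)) hx' hx₁
  choose C₁ hC₁0 hC₁ using h1
  choose C₂ hC₂0 hC₂ using h2
  set C := ∑ k, C₁ k + ∑ ν, C₂ ν with hCdef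
  have hC0 : 0 ≤ C := add_nonneg (Finset.sum_nonneg fun k _ => hC₁0 k)
    (Finset.sum_nonneg fun ν _ => hC₂0 ν)
  have hC1le : ∀ k, C₁ k ≤ C := fun k =>
    (Finset.single_le_sum (fun k _ => hC₁0 k) (Finset.mem_univ k)).trans
      (le_add_of_nonneg_right (Finset.sum_nonneg fun ν _ => hC₂0 ν))
  have hC2le : ∀ ν, C₂ ν ≤ C := fun ν =>
    (Finset.single_le_sum (fun k _ => hC₂0 k) (Finset.mem_univ ν)).trans
      (le_add_of_nonneg_left (Finset.sum_nonneg fun ν _ => hC₁0 ν))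
  obtain ⟨N₁, hxN₁, hN₁N, hN₁W, K, hK0, hK⟩ := exists_gnorm_hom_le_near θ₁ hW₁ hx₁ hN hC0
  have hev := (eventually_all.2 hC₁).and (eventually_all.2 hC₂)
  obtain ⟨O, hO, hOopen, hxO⟩ := eventually_nhds_iff.1 hev
  refine ⟨N₁ ⊓ ⟨O, hOopen⟩ ⊓ W', ⟨⟨hxN₁, hxO⟩, hx'⟩, (inf_le_left.trans inf_le_left).trans hN₁N,
    inf_le_right, K, hK0, ?_⟩
  intro V hNV s S hS y hy hyV hyW'
  have hyN₁ : y ∈ N₁ := hy.1.1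
  have hyO := hO y hy.1.2
  have hyW₁ : y ∈ W₁ := hN₁W hyN₁
  refine hK y (PointHom.ofCoord θ' hyW') hyW₁ hyN₁ (fun k => (hyO.1 k hyW' hyW₁).trans (hC1le k))
    (fun ν => (hyO.2 ν hyW' hyW₁).trans (hC2le ν)) V hNV hyV s S fun z hz hzW ν => ?_
  rw [SuperSpace.OddCoordinates.ev_restrict]
  exact hS z hz _ ν

/-! ### Limits of morphisms along an ultrafilter -/

open Classical in
/-- The value at `x`, in odd coordinates near `x`, of the pullback of the section `f ∈ 𝒪(U)` by a
morphism; it is zero unless the morphism maps `x` into `U`. -/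
def pullbackVal (φ : M.space ⟶ M.space) {W : Opens M} (θ : M.OddCoordinates m n W) {U : Opens M}
    (f : M.Sec U) (x : M) : Grassmann n :=
  if h : x ∈ W ∧ SuperSpace.base φ x ∈ U then
    θ.ev (V := U.comap (SuperSpace.base φ)) h.1 h.2 (SuperSpace.pullback φ U f) else 0

theorem pullbackVal_eq (φ : M.space ⟶ M.space) {W : Opens M} (θ : M.OddCoordinates m n W)
    {U : Opens M} (f : M.Sec U) {x : M} (hW : x ∈ W)
    (hx : x ∈ U.comap (SuperSpace.base φ)) :
    pullbackVal φ θ f x =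
      θ.ev hW hx (SuperSpace.pullback φ U f) :=
  dif_pos ⟨hW, hx⟩

theorem contMDiffOn_gcoeff_pullbackVal (φ : M.space ⟶ M.space) {W : Opens M}
    (θ : M.OddCoordinates m n W) {U : Opens M} (f : M.Sec U) (ν : Finset (Fin n)) :
    ContMDiffOn 𝓘(ℂ, EuclideanSpace ℂ (Fin m)) 𝓘(ℂ, ℂ) ω
      (fun x => gcoeff ν (pullbackVal φ θ f x))
      (W ⊓ U.comap (SuperSpace.base φ) : Opens M) :=
  θ.contMDiffOn_gcoeff _ ν fun x hW hV => by rw [pullbackVal_eq φ θ f hW hV]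

/-- Sufficient conditions for a family of morphisms to converge to a morphism with underlying map
`g` along an ultrafilter: the underlying maps converge to `g` locally uniformly, and the pullbacks
of local coordinates are locally bounded. -/
structure LimitData {ι : Type*} (F : Ultrafilter ι) (φ : ι → (M.space ⟶ M.space)) (g : C(M, M)) :
    Prop where
  /-- The underlying maps of almost all members of the family map a neighbourhood of `x` into a
  given neighbourhood of `g x`. -/
  equicontinuous : ∀ (x : M) (U : Opens M), g x ∈ U →
    ∃ V : Opens M, x ∈ V ∧ ∀ᶠ i in (F : Filter ι), ∀ x' ∈ V, SuperSpace.base (φ i) x' ∈ U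
  /-- The pullbacks of some even and odd coordinates near `g x` are bounded near `x`. -/
  bounded : ∀ x : M, ∃ (p : M) (W : Opens M) (θ : M.OddCoordinates m n W)
    (hW : (W : Set M) ⊆ (chartAt (EuclideanSpace ℂ (Fin m)) p).source)
    (W' : Opens M) (θ' : M.OddCoordinates m n W') (C : ℝ) (V : Opens M),
    g x ∈ W ∧ x ∈ W' ∧ x ∈ V ∧ 0 ≤ C ∧ ∀ᶠ i in (F : Filter ι), ∀ x' ∈ V, ∀ (hx' : x' ∈ W')
      (hy : SuperSpace.base (φ i) x' ∈ W),
      (∀ k, gnorm (((PointHom.ofCoord θ' hx').comp (φ i)).hol θ le_rfl hy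
        (chartCoordHol hW k)) ≤ C) ∧
      ∀ ν, gnorm (((PointHom.ofCoord θ' hx').comp (φ i)).odd θ hy (grassmannBasis n ν)) ≤ C

namespace LimitData

variable {ι : Type*} {F : Ultrafilter ι} {φ : ι → (M.space ⟶ M.space)} {g : C(M, M)}

theorem eventually_mem (hL : LimitData F φ g) {x : M} {U : Opens M}
    (hx : x ∈ U.comap g) : ∀ᶠ i in (F : Filter ι), x ∈ U.comap (SuperSpace.base (φ i)) := by
  obtain ⟨V, hxV, hV⟩ := hL.equicontinuous x U hx
  exact hV.mono fun i hi => hi x hxV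

/-- The pullbacks of any section are locally bounded in any odd coordinates. -/
theorem exists_bound (hL : LimitData F φ g) {U : Opens M} (f : M.Sec U) {x : M} (hx : g x ∈ U)
    {W : Opens M} (θ : M.OddCoordinates m n W) (hxW : x ∈ W) :
    ∃ (V : Opens M) (C : ℝ), x ∈ V ∧ V ≤ W ∧ V ≤ U.comap g ∧ ∀ᶠ i in (F : Filter ι),
      V ≤ U.comap (SuperSpace.base (φ i)) ∧ ∀ x' ∈ V, gnorm (pullbackVal (φ i) θ f x') ≤ C := by
  obtain ⟨p, W₀, θ₀, hW₀, W', θ', C, V₀, hgx, hxW', hxV₀, hC, hev⟩ := hL.bounded x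
  -- `f` is bounded on a neighbourhood of `g x`
  obtain ⟨S, hS0, hS⟩ := exists_gnorm_ev_le θ₀ f hgx hx
  obtain ⟨O, hO, hOopen, hxO⟩ := eventually_nhds_iff.1 hS
  let N : Opens M := ⟨O, hOopen⟩ ⊓ U
  have hxN : g x ∈ N := ⟨hxO, hx⟩
  obtain ⟨N', hxN', hN'N, hN'W, K, hK0, hK⟩ := exists_gnorm_hom_le_near θ₀ hW₀ hgx hxN hC
  obtain ⟨V₁, hxV₁, hV₁⟩ := hL.equicontinuous x N' hxN'
  let V₂ : Opens M := V₀ ⊓ V₁ ⊓ W' ⊓ U.comap g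
  have hxV₂ : x ∈ V₂ := ⟨⟨⟨hxV₀, hxV₁⟩, hxW'⟩, hx⟩
  obtain ⟨V₃, hxV₃, hV₃V₂, hV₃W, K', hK'0, hK'⟩ :=
    exists_gnorm_ev_le_of_coordChange θ' θ hxW' hxW hxV₂
  refine ⟨V₃, K' * (K * S), hxV₃, hV₃W, hV₃V₂.trans inf_le_right, ?_⟩
  filter_upwards [hev, hV₁] with i hi hi₁
  have hV₂U : V₂ ≤ U.comap (SuperSpace.base (φ i)) := fun y hy => (hN'N (hi₁ y hy.1.1.2)).2
  refine ⟨hV₃V₂.trans hV₂U, fun y hy => ?_⟩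
  have hyW : y ∈ W := hV₃W hy
  rw [pullbackVal_eq (φ i) θ f hyW (hV₂U (hV₃V₂ hy))]
  refine hK' _ hV₂U _ (K * S) (fun z hz hzW ν => ?_) y hy _ hyW
  have hzN : SuperSpace.base (φ i) z ∈ N' := hi₁ z hz.1.1.2
  obtain ⟨h1, h2⟩ := hi z hz.1.1.1 hzW (hN'W hzN)
  refine (norm_gcoeff_le_gnorm _ ν).trans ?_
  refine hK (SuperSpace.base (φ i) z) ((PointHom.ofCoord θ' hzW).comp (φ i)) (hN'W hzN) hzN h1 h2
    U inf_le_right (hN'N hzN).2 f S fun w hw hwW μ => ?_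
  exact (norm_gcoeff_le_gnorm _ μ).trans (hO w hw.1 hwW hw.2)

end LimitData

/-- `a` is the limit at `x` of the pullbacks of `f`, in the odd coordinates `θ`. -/
def IsPullbackLimit {ι : Type*} (F : Ultrafilter ι) (φ : ι → (M.space ⟶ M.space)) {W : Opens M}
    (θ : M.OddCoordinates m n W) {U : Opens M} (f : M.Sec U) (x : M) (a : Grassmann n) : Prop :=
  ∀ ν, Tendsto (fun i => gcoeff ν (pullbackVal (φ i) θ f x)) F (𝓝 (gcoeff ν a))

theorem IsPullbackLimit.unique {ι : Type*} {F : Ultrafilter ι} {φ : ι → (M.space ⟶ M.space)}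
    {W : Opens M} {θ : M.OddCoordinates m n W} {U : Opens M} {f : M.Sec U} {x : M}
    {a b : Grassmann n} (ha : IsPullbackLimit F φ θ f x a) (hb : IsPullbackLimit F φ θ f x b) :
    a = b :=
  gcoeff_ext fun ν => tendsto_nhds_unique (ha ν) (hb ν)

/-- The section `s` over `V` is the locally uniform limit of the pullbacks of `f`, in the odd
coordinates `θ`. -/
structure IsLocalLimit {ι : Type*} (F : Ultrafilter ι) (φ : ι → (M.space ⟶ M.space)) {W : Opens M}
    (θ : M.OddCoordinates m n W) {U : Opens M} (f : M.Sec U) {V : Opens M} (hVW : V ≤ W)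
    (s : M.Sec V) : Prop where
  isPullbackLimit : ∀ y (hy : y ∈ V), IsPullbackLimit F φ θ f y (θ.ev (hVW hy) hy s)
  locallyUniform : ∀ y (hy : y ∈ V) (ε : ℝ), 0 < ε → ∃ V' : Opens M, y ∈ V' ∧ V' ≤ V ∧
    ∀ᶠ i in (F : Filter ι), V' ≤ U.comap (SuperSpace.base (φ i)) ∧ ∀ z ∈ V', ∀ ν,
      ‖gcoeff ν (pullbackVal (φ i) θ f z) - gcoeff ν (θ.ev (hVW hy) hy s)‖ < ε

namespace LimitData

variable {ι : Type*} {F : Ultrafilter ι} {φ : ι → (M.space ⟶ M.space)} {g : C(M, M)}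

theorem exists_isPullbackLimit (hL : LimitData F φ g) {U : Opens M} (f : M.Sec U) {x : M}
    (hx : g x ∈ U) {W : Opens M} (θ : M.OddCoordinates m n W) (hxW : x ∈ W) :
    ∃ a, IsPullbackLimit F φ θ f x a := by
  obtain ⟨V, C, hxV, -, -, hV⟩ := hL.exists_bound f hx θ hxW
  have h1 : ∀ ν : Finset (Fin n), ∃ c : ℂ,
      Tendsto (fun i => gcoeff ν (pullbackVal (φ i) θ f x)) F (𝓝 c) := by
    intro ν
    obtain ⟨c, -, hc⟩ := (isCompact_closedBall (0 : ℂ) C).ultrafilter_le_nhds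
      (F.map fun i => gcoeff ν (pullbackVal (φ i) θ f x)) (by
        rw [le_principal_iff]
        change ∀ᶠ i in (F : Filter ι), _ ∈ _
        filter_upwards [hV] with i hi
        rw [mem_closedBall_zero_iff]
        exact (norm_gcoeff_le_gnorm _ ν).trans (hi.2 x hxV))
    exact ⟨c, hc⟩
  choose c hc using h1
  refine ⟨∑ ν, c ν • grassmannBasis n ν, fun ν => ?_⟩
  have : gcoeff ν (∑ ν, c ν • grassmannBasis n ν) = c ν := by
    simp [map_sum, gcoeff_basis]
  rw [this]
  exact hc ν

/-- Near any point the limit of the pullbacks of a section exists, and the convergence is locally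
uniform. -/
theorem exists_local_limit (hL : LimitData F φ g) {U : Opens M} (f : M.Sec U) {x : M}
    (hx : g x ∈ U) {W : Opens M} (θ : M.OddCoordinates m n W) (hxW : x ∈ W) :
    ∃ (V : Opens M) (hVW : V ≤ W) (s : M.Sec V), x ∈ V ∧ V ≤ U.comap g ∧
      IsLocalLimit F φ θ f hVW s := by
  classical
  obtain ⟨V₀, C, hxV₀, hV₀W, hV₀U, hV₀⟩ := hL.exists_bound f hx θ hxW
  set e := chartAt (EuclideanSpace ℂ (Fin m)) x with he
  have hopen : IsOpen (e.target ∩ e.symm ⁻¹' V₀) := e.symm.isOpen_inter_preimage V₀.2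
  have hmem : e x ∈ e.target ∩ e.symm ⁻¹' V₀ :=
    ⟨mem_chart_target _ x, by
      rw [mem_preimage, e.left_inv (mem_chart_source _ x)]; exact hxV₀⟩
  obtain ⟨R, hR, hRsub⟩ := Metric.isOpen_iff.1 hopen _ hmem
  set V := chartBall x (e x) R with hV
  have hVV₀ : V ≤ V₀ := fun y hy => by
    have := (hRsub hy.2).2
    rwa [mem_preimage, e.left_inv hy.1] at this
  have hVW := hVV₀.trans hV₀W
  choose! a ha using fun y (hy : y ∈ V) =>
    hL.exists_isPullbackLimit f (hV₀U (hVV₀ hy)) θ (hVW hy)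
  -- in the chart, the coefficients form a bounded family of holomorphic functions
  have hsymm : ∀ z ∈ ball (e x) R, e.symm z ∈ V := fun z hz =>
    chart_symm_mem_chartBall (fun z hz => (hRsub hz).1) hz
  have hf : ∀ ν, ∀ᶠ i in (F : Filter ι), AnalyticOnNhd ℂ
      (fun z => gcoeff ν (pullbackVal (φ i) θ f (e.symm z))) (ball (e x) R) := by
    intro ν
    filter_upwards [hV₀] with i hi
    exact analyticOnNhd_comp_chart_symm (contMDiffOn_gcoeff_pullbackVal (φ i) θ f ν) isOpen_ball
      (fun z hz => (hRsub hz).1) fun z hz => ⟨hVW (hsymm z hz), hi.1 (hVV₀ (hsymm z hz))⟩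
  have hS : ∀ ν, ∀ᶠ i in (F : Filter ι), ∀ z ∈ ball (e x) R,
      ‖gcoeff ν (pullbackVal (φ i) θ f (e.symm z))‖ ≤ C := by
    intro ν
    filter_upwards [hV₀] with i hi z hz
    exact (norm_gcoeff_le_gnorm _ ν).trans (hi.2 _ (hVV₀ (hsymm z hz)))
  have hlim : ∀ ν, ∀ z ∈ ball (e x) R, Tendsto
      (fun i => gcoeff ν (pullbackVal (φ i) θ f (e.symm z))) F (𝓝 (gcoeff ν (a (e.symm z)))) :=
    fun ν z hz => ha _ (hsymm z hz) ν
  have hball : ∀ z ∈ ball (e x) R, ∃ r > 0, ball z r ⊆ ball (e x) R := fun z hz =>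
    Metric.isOpen_iff.1 isOpen_ball z hz
  have hana : ∀ ν, AnalyticOnNhd ℂ (fun z => gcoeff ν (a (e.symm z))) (ball (e x) R) := by
    intro ν z hz
    obtain ⟨r, hr, hsub⟩ := hball z hz
    exact analyticAt_of_tendsto hr ((hf ν).mono fun i hi => hi.mono hsub)
      ((hS ν).mono fun i hi w hw => hi w (hsub hw)) fun w hw => hlim ν w (hsub hw)
  let c : Finset (Fin n) → Hol m V := fun ν =>
    Hol.ofContMDiffOn (fun y => gcoeff ν (a y)) (by
      refine (contMDiffOn_comp_chart (hana ν) x).congr fun y hy => ?_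
      change _ = gcoeff ν (a (e.symm (e y)))
      rw [e.left_inv hy.1])
  have hs : ∀ y (hy : y ∈ V), θ.ev (hVW hy) hy (θ.ofCoeff hVW c) = a y := fun y hy =>
    gcoeff_ext fun ν => by rw [θ.gcoeff_ev_ofCoeff]; rfl
  refine ⟨V, hVW, θ.ofCoeff hVW c, ⟨mem_chart_source _ x, mem_ball_self hR⟩, hVV₀.trans hV₀U,
    fun y hy => by rw [hs]; exact ha y hy, fun y hy ε hε => ?_⟩
  obtain ⟨r, hr, hsub⟩ := hball (e y) hy.2
  choose δ hδ0 hδr hδ using fun ν => eventually_norm_sub_lt_of_tendsto hr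
    ((hf ν).mono fun i hi => hi.mono hsub) ((hS ν).mono fun i hi w hw => hi w (hsub hw))
    (fun w hw => hlim ν w (hsub hw)) hε
  obtain ⟨δ', hδ', hδ'le⟩ : ∃ δ' > 0, ∀ ν, δ' ≤ δ ν :=
    ⟨Finset.univ.inf' Finset.univ_nonempty δ, by simpa [Finset.lt_inf'_iff] using hδ0,
      fun ν => Finset.inf'_le _ (Finset.mem_univ ν)⟩
  have hV'V : chartBall x (e y) δ' ≤ V := chartBall_mono
    ((ball_subset_ball ((hδ'le ∅).trans (hδr ∅).le)).trans hsub)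
  refine ⟨chartBall x (e y) δ', ⟨hy.1, mem_ball_self hδ'⟩, hV'V, ?_⟩
  filter_upwards [eventually_all.2 hδ, hV₀] with i hi hi₀
  refine ⟨(hV'V.trans hVV₀).trans hi₀.1, fun z hz ν => ?_⟩
  have h1 := hi ν (e z) (ball_subset_ball (hδ'le ν) hz.2)
  rw [e.left_inv hz.1, e.left_inv hy.1] at h1
  rw [hs]
  exact h1

end LimitData

section

variable {ι : Type*} {F : Ultrafilter ι} {φ : ι → (M.space ⟶ M.space)} {U : Opens M} {f : M.Sec U}
  {W : Opens M} {θ : M.OddCoordinates m n W} {V : Opens M} {hVW : V ≤ W} {s : M.Sec V}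

/-- Locally uniform convergence is uniform on compact sets. -/
theorem IsLocalLimit.eventually_norm_sub_le (hs : IsLocalLimit F φ θ f hVW s)
    {K : Set M} (hK : IsCompact K) (hKV : K ⊆ V) {ε : ℝ} (hε : 0 < ε) :
    ∀ᶠ i in (F : Filter ι), K ⊆ U.comap (SuperSpace.base (φ i)) ∧ ∀ z ∈ K, ∀ (hz : z ∈ V) ν,
      ‖gcoeff ν (pullbackVal (φ i) θ f z) - gcoeff ν (θ.ev (hVW hz) hz s)‖ ≤ ε := by
  refine hK.induction_on (p := fun K => ∀ᶠ i in (F : Filter ι),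
    K ⊆ U.comap (SuperSpace.base (φ i)) ∧ ∀ z ∈ K, ∀ (hz : z ∈ V) ν,
      ‖gcoeff ν (pullbackVal (φ i) θ f z) - gcoeff ν (θ.ev (hVW hz) hz s)‖ ≤ ε) ?_ ?_ ?_ ?_
  · exact Eventually.of_forall fun i => ⟨empty_subset _, fun z hz => hz.elim⟩
  · exact fun S T hST hT => hT.mono fun i hi => ⟨hST.trans hi.1, fun z hz => hi.2 z (hST hz)⟩
  · intro S T hS hT
    filter_upwards [hS, hT] with i h1 h2
    exact ⟨union_subset h1.1 h2.1, fun z hz => hz.elim (h1.2 z) (h2.2 z)⟩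
  · intro y hy
    have hyV : y ∈ V := hKV hy
    obtain ⟨V', hyV', hV'V, hev⟩ := hs.locallyUniform y hyV (ε / 2) (half_pos hε)
    refine ⟨V', mem_nhdsWithin_of_mem_nhds (V'.2.mem_nhds hyV'), ?_⟩
    filter_upwards [hev] with i hi
    refine ⟨hi.1, fun z hz hzV ν => ?_⟩
    have h1 : ‖gcoeff ν (θ.ev (hVW hzV) hzV s) - gcoeff ν (θ.ev (hVW hyV) hyV s)‖ ≤ ε / 2 := by
      refine le_of_tendsto ((hs.isPullbackLimit z hzV ν).sub_const _).norm ?_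
      filter_upwards [hev] with j hj using (hj.2 z hz ν).le
    have h2 := (hi.2 z hz ν).le
    rw [norm_sub_rev] at h1
    calc _ ≤ _ + _ := norm_sub_le_norm_sub_add_norm_sub _ _ _
      _ ≤ ε := by linarith

/-- Limits of pullbacks do not depend on the choice of odd coordinates. -/
theorem IsLocalLimit.isPullbackLimit_of_coordChange
    (hs : IsLocalLimit F φ θ f hVW s) {W' : Opens M} (θ' : M.OddCoordinates m n W') {x : M}
    (hx : x ∈ V) (hx' : x ∈ W') : IsPullbackLimit F φ θ' f x (θ'.ev hx' hx s) := by
  have : LocallyCompactSpace M := ChartedSpace.locallyCompactSpace (EuclideanSpace ℂ (Fin m)) M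
  obtain ⟨K, hK, hxK, hKV⟩ := exists_compact_subset V.2 hx
  let N : Opens M := ⟨interior K, isOpen_interior⟩
  have hNV : N ≤ V := interior_subset.trans hKV
  obtain ⟨N', hxN', hN'N, -, C, hC0, hC⟩ :=
    exists_gnorm_ev_le_of_coordChange θ θ' (hVW hx) hx' (N := N) hxK
  intro ν
  rw [Metric.tendsto_nhds]
  intro ε hε
  have hε' : 0 < ε / (C + 1) := by positivity
  filter_upwards [hs.eventually_norm_sub_le hK hKV hε'] with i hi
  have hNU : N ≤ U.comap (SuperSpace.base (φ i)) := interior_subset.trans hi.1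
  have hxN : x ∈ N := hxK
  have key := hC N le_rfl
    (M.res hNU (SuperSpace.pullback (φ i) U f) - M.res hNV s) (ε / (C + 1)) (fun y hy hyW μ => by
      rw [map_sub, θ.ev_res, θ.ev_res, map_sub, ← pullbackVal_eq (φ i) θ f hyW (hNU hy)]
      exact hi.2 y (interior_subset hy) (hNV hy) μ) x hxN' hxN hx'
  rw [map_sub, θ'.ev_res, θ'.ev_res, ← pullbackVal_eq (φ i) θ' f hx' (hNU hxN)] at key
  rw [dist_eq_norm, ← map_sub]
  calc _ ≤ C * (ε / (C + 1)) := (norm_gcoeff_le_gnorm _ ν).trans key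
    _ < ε := by
      rw [mul_div_assoc', div_lt_iff₀ (by positivity)]
      nlinarith

end

/-- The section `s` is the limit of the pullbacks of `f`, in any odd coordinates. -/
def IsSectionLimit {ι : Type*} (F : Ultrafilter ι) (φ : ι → (M.space ⟶ M.space)) {U : Opens M}
    (f : M.Sec U) {V : Opens M} (s : M.Sec V) : Prop :=
  ∀ (W : Opens M) (θ : M.OddCoordinates m n W) (x : M) (hW : x ∈ W) (hV : x ∈ V),
    IsPullbackLimit F φ θ f x (θ.ev hW hV s)

section

variable {ι : Type*} {F : Ultrafilter ι} {φ : ι → (M.space ⟶ M.space)} {U : Opens M} {f : M.Sec U}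

theorem sec_ext {V : Opens M} {s t : M.Sec V} (h : ∀ (W : Opens M) (θ : M.OddCoordinates m n W)
    (x : M) (hW : x ∈ W) (hV : x ∈ V), θ.ev hW hV s = θ.ev hW hV t) : s = t := by
  refine sec_eq_of_locally_eq fun x hx => ?_
  obtain ⟨W, hxW, ⟨θ⟩⟩ := M.exists_oddCoordinates x
  refine ⟨W ⊓ V, inf_le_right, ⟨hxW, hx⟩, θ.sec_ext inf_le_left fun y hy => ?_⟩
  have hyW : y ∈ W := hy.1
  rw [θ.ev_res, θ.ev_res]
  exact h W θ y hyW hy.2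

theorem IsSectionLimit.unique {V : Opens M} {s t : M.Sec V} (hs : IsSectionLimit F φ f s)
    (ht : IsSectionLimit F φ f t) : s = t :=
  sec_ext fun W θ x hW hV => (hs W θ x hW hV).unique (ht W θ x hW hV)

theorem IsSectionLimit.res {V V' : Opens M} {s : M.Sec V} (hs : IsSectionLimit F φ f s)
    (h : V' ≤ V) : IsSectionLimit F φ f (M.res h s) := fun W θ x hW hV => by
  rw [θ.ev_res]; exact hs W θ x hW (h hV)

variable {g : C(M, M)}

/-- The pullbacks of a section converge to a section. -/
theorem LimitData.exists_isSectionLimit (hL : LimitData F φ g) (f : M.Sec U) :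
    ∃ s : M.Sec (U.comap g), IsSectionLimit F φ f s := by
  have hloc : ∀ x : U.comap g, ∃ (V : Opens M) (s : M.Sec V), x.1 ∈ V ∧ V ≤ U.comap g ∧
      IsSectionLimit F φ f s := by
    rintro ⟨x, hx⟩
    obtain ⟨W, hxW, ⟨θ⟩⟩ := M.exists_oddCoordinates x
    obtain ⟨V, hVW, s, hxV, hVU, hs⟩ := hL.exists_local_limit f hx θ hxW
    exact ⟨V, s, hxV, hVU, fun W' θ' y hW' hV => hs.isPullbackLimit_of_coordChange θ' hV hW'⟩
  choose V s hxV hVU hs using hloc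
  obtain ⟨t, ht⟩ := exists_glue V hVU (fun x hx => ⟨⟨x, hx⟩, hxV _⟩) s fun i j =>
    ((hs i).res inf_le_left).unique ((hs j).res inf_le_right)
  refine ⟨t, fun W θ x hW hx => ?_⟩
  have := hs ⟨x, hx⟩ W θ x hW (hxV _)
  rw [← ht, θ.ev_res] at this
  exact this

/-- The convergence to the limit section is locally uniform. -/
theorem LimitData.locallyUniform (hL : LimitData F φ g) {f : M.Sec U} {s : M.Sec (U.comap g)}
    (hs : IsSectionLimit F φ f s) {W : Opens M} (θ : M.OddCoordinates m n W) {x : M} (hW : x ∈ W)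
    (hx : x ∈ U.comap g) {ε : ℝ} (hε : 0 < ε) : ∃ V : Opens M, x ∈ V ∧ V ≤ W ∧
      ∀ᶠ i in (F : Filter ι), V ≤ U.comap (SuperSpace.base (φ i)) ∧ ∀ z ∈ V, ∀ ν,
        ‖gcoeff ν (pullbackVal (φ i) θ f z) - gcoeff ν (θ.ev hW hx s)‖ < ε := by
  obtain ⟨V, hVW, t, hxV, hVU, ht⟩ := hL.exists_local_limit f hx θ hW
  obtain ⟨V', hxV', hV'V, hev⟩ := ht.locallyUniform x hxV ε hε
  have : θ.ev hW hxV t = θ.ev hW hx s := (ht.isPullbackLimit x hxV).unique (hs W θ x hW hx)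
  rw [this] at hev
  exact ⟨V', hxV', hV'V.trans hVW, hev⟩

end

/-! ### The limit morphism -/

namespace LimitData

variable {ι : Type*} {F : Ultrafilter ι} {φ : ι → (M.space ⟶ M.space)} {g : C(M, M)}

/-- The limit of the pullbacks of a section. -/
def limitSec (hL : LimitData F φ g) {U : Opens M} (f : M.Sec U) : M.Sec (U.comap g) :=
  (hL.exists_isSectionLimit f).choose

theorem isSectionLimit_limitSec (hL : LimitData F φ g) {U : Opens M} (f : M.Sec U) :
    IsSectionLimit F φ f (hL.limitSec f) := (hL.exists_isSectionLimit f).choose_spec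

theorem limitSec_eq (hL : LimitData F φ g) {U : Opens M} {f : M.Sec U} {s : M.Sec (U.comap g)}
    (h : IsSectionLimit F φ f s) : hL.limitSec f = s :=
  (hL.isSectionLimit_limitSec f).unique h

theorem tendsto_gcoeff (hL : LimitData F φ g) {U : Opens M} (f : M.Sec U) {W : Opens M}
    (θ : M.OddCoordinates m n W) {x : M} (hW : x ∈ W) (hx : x ∈ U.comap g) (ν : Finset (Fin n)) :
    Tendsto (fun i => gcoeff ν (pullbackVal (φ i) θ f x)) F
      (𝓝 (gcoeff ν (θ.ev hW hx (hL.limitSec f)))) :=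
  hL.isSectionLimit_limitSec f W θ x hW hx ν

/-- The pullback of sections by the limit morphism. -/
def limitPullback (hL : LimitData F φ g) (U : Opens M) : M.Sec U →ₐ[ℂ] M.Sec (U.comap g) :=
  AlgHom.ofLinearMap
    { toFun := hL.limitSec
      map_add' := fun f f' => hL.limitSec_eq fun W θ x hW hx ν => by
        rw [map_add, map_add]
        refine ((hL.tendsto_gcoeff f θ hW hx ν).add (hL.tendsto_gcoeff f' θ hW hx ν)).congr' ?_
        filter_upwards [hL.eventually_mem hx] with i hi
        rw [pullbackVal_eq _ _ _ hW hi, pullbackVal_eq _ _ _ hW hi, pullbackVal_eq _ _ _ hW hi,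
          map_add, map_add, map_add]
      map_smul' := fun c f => hL.limitSec_eq fun W θ x hW hx ν => by
        rw [RingHom.id_apply, map_smul, map_smul]
        refine ((hL.tendsto_gcoeff f θ hW hx ν).const_smul c).congr' ?_
        filter_upwards [hL.eventually_mem hx] with i hi
        rw [pullbackVal_eq _ _ _ hW hi, pullbackVal_eq _ _ _ hW hi, map_smul, map_smul, map_smul] }
    (hL.limitSec_eq fun W θ x hW hx ν => by
      rw [map_one]
      refine tendsto_const_nhds.congr' ?_
      filter_upwards [hL.eventually_mem hx] with i hi
      rw [pullbackVal_eq _ _ _ hW hi, map_one (SuperSpace.pullback (φ i) U), map_one (θ.ev hW hi)])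
    fun f f' => hL.limitSec_eq fun W θ x hW hx ν => by
      change Tendsto _ _ (𝓝 (gcoeff ν (θ.ev hW hx (hL.limitSec f * hL.limitSec f'))))
      rw [map_mul, gcoeff_mul]
      refine (tendsto_finsetSum _ fun μ _ => tendsto_finsetSum _ fun κ _ =>
        ((hL.tendsto_gcoeff f θ hW hx μ).mul
          (hL.tendsto_gcoeff f' θ hW hx κ)).mul_const _).congr' ?_
      filter_upwards [hL.eventually_mem hx] with i hi
      rw [pullbackVal_eq _ _ _ hW hi, pullbackVal_eq _ _ _ hW hi, pullbackVal_eq _ _ _ hW hi,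
        map_mul, map_mul, gcoeff_mul]

theorem limitPullback_apply (hL : LimitData F φ g) {U : Opens M} (f : M.Sec U) :
    hL.limitPullback U f = hL.limitSec f := rfl

theorem limitPullback_res (hL : LimitData F φ g) {U' U : Opens M} (h : U' ≤ U) (f : M.Sec U) :
    hL.limitPullback U' (M.res h f) = M.res (comap_le_comap g h) (hL.limitPullback U f) :=
  hL.limitSec_eq fun W θ x hW hx ν => by
    rw [θ.ev_res, limitPullback_apply]
    refine (hL.tendsto_gcoeff f θ hW (comap_le_comap g h hx) ν).congr' ?_
    filter_upwards [hL.eventually_mem (U := U') hx] with i hi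
    rw [pullbackVal_eq _ _ _ hW hi, pullbackVal_eq _ _ _ hW (comap_le_comap _ h hi),
      pullback_res, θ.ev_res]

/-- The limit morphism. -/
def limit (hL : LimitData F φ g) : M.space ⟶ M.space where
  hom :=
    { base := TopCat.ofHom g
      c :=
        { app := fun U => AlgCat.ofHom (hL.limitPullback U.unop)
          naturality := fun U V h => by
            ext f
            exact hL.limitPullback_res (leOfHom h.unop) f } }

end LimitData

/-! ### Parity -/

theorem zmod_two_ne_add_one (k : ZMod 2) : k ≠ k + 1 := by revert k; decide

theorem zmod_two_eq_add_one {j k : ZMod 2} (h : j ≠ k) : j = k + 1 := by revert j k; decide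

theorem eq_zero_of_mem_parity {V : Opens M} {s : M.Sec V} {k j : ZMod 2} (hkj : k ≠ j)
    (hk : s ∈ M.parity V k) (hj : s ∈ M.parity V j) : s = 0 := by
  let _ := M.graded V
  rw [← DirectSum.decompose_of_mem_same (M.parity V) hk,
    DirectSum.decompose_of_mem_ne (M.parity V) hj hkj.symm]

theorem exists_parity_decomposition {V : Opens M} (s : M.Sec V) (k : ZMod 2) :
    ∃ t ∈ M.parity V k, s - t ∈ M.parity V (k + 1) := by
  let _ := M.graded V
  refine ⟨DirectSum.decompose (M.parity V) s k, SetLike.coe_mem _, ?_⟩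
  have h1 : s = ∑ i, (DirectSum.decompose (M.parity V) s i : M.Sec V) := by
    conv_lhs => rw [← (DirectSum.decompose (M.parity V)).symm_apply_apply s]
    conv_lhs => rw [← DirectSum.sum_univ_of (DirectSum.decompose (M.parity V) s)]
    rw [DirectSum.decompose_symm_sum]
    simp only [DirectSum.decompose_symm_of]
  have h2 : (Finset.univ : Finset (ZMod 2)) = {k, k + 1} := by
    revert k; decide
  rw [h2, Finset.sum_pair (zmod_two_ne_add_one k)] at h1
  rw [sub_eq_of_eq_add' h1]
  exact SetLike.coe_mem _

theorem gcoeff_ev_eq_zero_of_mem_parity {V : Opens M} {s : M.Sec V} {k : ZMod 2}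
    (hs : s ∈ M.parity V k) {W : Opens M} (θ : M.OddCoordinates m n W) {x : M} (hW : x ∈ W)
    (hV : x ∈ V) {ν : Finset (Fin n)} (hν : (ν.card : ZMod 2) ≠ k) :
    gcoeff ν (θ.ev hW hV s) = 0 := by
  classical
  have hx : x ∈ W ⊓ V := mem_inf_of_mem hW hV
  have hs' := M.res_mem_parity (inf_le_right : W ⊓ V ≤ V) k s hs
  set s' := M.res (inf_le_right : W ⊓ V ≤ V) s with hs'def
  set c := θ.coeff inf_le_left s' with hc
  have hsum : s' = ∑ ν, θ.equiv (W ⊓ V) inf_le_left (c ν ⊗ₜ grassmannBasis n ν) :=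
    θ.sum_coeff inf_le_left s'
  have hmem : ∀ ν : Finset (Fin n), θ.equiv (W ⊓ V) inf_le_left (c ν ⊗ₜ grassmannBasis n ν) ∈
      M.parity (W ⊓ V) (ν.card : ZMod 2) := fun ν =>
    θ.equiv_mem_parity _ _ _ _ _ (grassmannBasis_mem_exteriorPower ν)
  -- the part of the other parity has both parities
  set r := ∑ ν : Finset (Fin n), if (ν.card : ZMod 2) ≠ k then
    θ.equiv (W ⊓ V) inf_le_left (c ν ⊗ₜ grassmannBasis n ν) else 0 with hr
  set q := ∑ ν : Finset (Fin n), if (ν.card : ZMod 2) = k then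
    θ.equiv (W ⊓ V) inf_le_left (c ν ⊗ₜ grassmannBasis n ν) else 0 with hq
  have hqr : s' = q + r := by
    rw [hsum, hq, hr, ← Finset.sum_add_distrib]
    refine Finset.sum_congr rfl fun ν _ => ?_
    by_cases h : (ν.card : ZMod 2) = k <;> simp [h]
  have hqk : q ∈ M.parity (W ⊓ V) k := Submodule.sum_mem _ fun ν _ => by
    split_ifs with h
    · rw [← h]; exact hmem ν
    · exact zero_mem _
  have hrk1 : r ∈ M.parity (W ⊓ V) (k + 1) := Submodule.sum_mem _ fun ν _ => by
    split_ifs with h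
    · rw [← zmod_two_eq_add_one h]; exact hmem ν
    · exact zero_mem _
  have hrk : r ∈ M.parity (W ⊓ V) k := by
    rw [show r = s' - q by rw [hqr]; abel]
    exact sub_mem hs' hqk
  have hr0 : r = 0 := eq_zero_of_mem_parity (zmod_two_ne_add_one k) hrk hrk1
  rw [hr0, add_zero] at hqr
  have h1 : θ.ev hW hV s = θ.ev hW hx s' := by rw [hs'def, θ.ev_res]
  rw [h1, hqr, hq, map_sum, map_sum]
  refine Finset.sum_eq_zero fun μ _ => ?_
  split_ifs with h
  · rw [θ.ev_equiv_tmul, map_smul, gcoeff_basis, if_neg, smul_zero]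
    rintro rfl; exact hν h
  · rw [map_zero, map_zero]

theorem mem_parity_of_gcoeff_ev_eq_zero {V : Opens M} {s : M.Sec V} {k : ZMod 2}
    (h : ∀ (W : Opens M) (θ : M.OddCoordinates m n W) (x : M) (hW : x ∈ W) (hV : x ∈ V)
      (ν : Finset (Fin n)), (ν.card : ZMod 2) ≠ k → gcoeff ν (θ.ev hW hV s) = 0) :
    s ∈ M.parity V k := by
  obtain ⟨t, ht, hst⟩ := exists_parity_decomposition s k
  have : s - t = 0 := sec_ext fun W θ x hW hV => gcoeff_ext fun ν => by
    rw [map_zero, map_zero]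
    by_cases hν : (ν.card : ZMod 2) = k
    · exact gcoeff_ev_eq_zero_of_mem_parity hst θ hW hV (hν ▸ zmod_two_ne_add_one k)
    · rw [map_sub, map_sub, h W θ x hW hV ν hν,
        gcoeff_ev_eq_zero_of_mem_parity ht θ hW hV hν, sub_zero]
  rw [sub_eq_zero.1 this]
  exact ht

theorem LimitData.preservesParity_limit {ι : Type*} {F : Ultrafilter ι}
    {φ : ι → (M.space ⟶ M.space)} {g : C(M, M)} (hL : LimitData F φ g)
    (hφ : ∀ i, SuperSpace.PreservesParity (φ i)) : SuperSpace.PreservesParity hL.limit := by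
  intro U k f hf
  refine mem_parity_of_gcoeff_ev_eq_zero (V := U.comap g) fun W θ x hW hV ν hν => ?_
  refine tendsto_nhds_unique (hL.tendsto_gcoeff f θ hW hV ν) (tendsto_const_nhds.congr' ?_)
  filter_upwards [hL.eventually_mem hV] with i hi
  rw [pullbackVal_eq _ _ _ hW hi]
  exact (gcoeff_ev_eq_zero_of_mem_parity (hφ i U k f hf) θ hW hi hν).symm

/-! ### A criterion for a morphism to be invertible -/

namespace PointHom

variable {y : M} (χ : M.PointHom y) {W : Opens M} (θ : M.OddCoordinates m n W)

/-- The leading term of the value of a point homomorphism at a section which vanishes to order `l`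
in the odd directions. -/
theorem hom_sub_mem_degFiltration {V : Opens M} (hVW : V ≤ W) (hy : y ∈ V) (s : M.Sec V) {l : ℕ}
    (hs : ∀ z (hz : z ∈ V), θ.ev (hVW hz) hz s ∈ degFiltration n l) :
    χ.hom V hy s - ∑ ν, (if ν.card = l then gcoeff ν (θ.ev (hVW hy) hy s) else 0) •
      χ.odd θ (hVW hy) (grassmannBasis n ν) ∈ degFiltration n (l + 1) := by
  rw [χ.hom_eq_sum θ hVW hy, ← Finset.sum_sub_distrib]
  refine Submodule.sum_mem _ fun ν _ => ?_
  rw [θ.gcoeff_ev hVW]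
  have hodd := χ.odd_mem_degFiltration θ (hVW hy) ν
  rcases lt_trichotomy ν.card l with h | h | h
  · have h0 : θ.coeff hVW s ν = 0 := by
      ext ⟨z, hz⟩
      rw [← θ.gcoeff_ev hVW (hVW hz)]
      exact mem_degFiltration.1 (hs z hz) ν h
    rw [h0, if_neg h.ne]; simp
  · rw [if_pos h, Algebra.smul_def, ← sub_mul, add_comm]
    exact mul_mem_degFiltration (χ.hol_sub_mem_degFiltration θ hVW hy _) (h ▸ hodd)
  · rw [if_neg h.ne', zero_smul, sub_zero]
    have := mul_mem_degFiltration (mem_degFiltration_zero (χ.hol θ hVW hy (θ.coeff hVW s ν))) hodd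
    exact degFiltration_anti (by omega) this

/-- The block diagonal matrix, with one block for every degree, of the leading coefficients of a
point homomorphism in odd coordinates. -/
def leadMatrix (hy : y ∈ W) : Matrix (Finset (Fin n)) (Finset (Fin n)) ℂ :=
  Matrix.of fun ν μ => if ν.card = μ.card then gcoeff μ (χ.odd θ hy (grassmannBasis n ν)) else 0

theorem gcoeff_hom_eq {V : Opens M} (hVW : V ≤ W) (hy : y ∈ V) (s : M.Sec V) {l : ℕ}
    (hs : ∀ z (hz : z ∈ V), θ.ev (hVW hz) hz s ∈ degFiltration n l) (μ : Finset (Fin n))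
    (hμ : μ.card = l) :
    gcoeff μ (χ.hom V hy s) = Matrix.vecMul
      (fun ν => if ν.card = l then gcoeff ν (θ.ev (hVW hy) hy s) else 0)
      (χ.leadMatrix θ (hVW hy)) μ := by
  have h := mem_degFiltration.1 (χ.hom_sub_mem_degFiltration θ hVW hy s hs) μ (by omega)
  rw [map_sub, sub_eq_zero] at h
  rw [h, map_sum, Matrix.vecMul, dotProduct]
  refine Finset.sum_congr rfl fun ν _ => ?_
  rw [map_smul, smul_eq_mul, leadMatrix, Matrix.of_apply]
  by_cases hν : ν.card = l
  · rw [if_pos hν, if_pos (hν.trans hμ.symm)]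
  · rw [if_neg hν, zero_mul, zero_mul]

theorem hom_mem_degFiltration {V : Opens M} (hVW : V ≤ W) (hy : y ∈ V) (s : M.Sec V) {l : ℕ}
    (hs : ∀ z (hz : z ∈ V), θ.ev (hVW hz) hz s ∈ degFiltration n l) :
    χ.hom V hy s ∈ degFiltration n l := by
  have h := degFiltration_anti (Nat.le_succ l) (χ.hom_sub_mem_degFiltration θ hVW hy s hs)
  refine (Submodule.sub_mem_iff_left _ (Submodule.sum_mem _ fun ν _ => ?_)).1 h
  split_ifs with hν
  · exact Submodule.smul_mem _ _ (hν ▸ χ.odd_mem_degFiltration θ (hVW hy) ν)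
  · rw [zero_smul]; exact zero_mem _

end PointHom

variable {ψ : M.space ⟶ M.space} {W : Opens M} (θ : M.OddCoordinates m n W)

/-- A morphism with invertible leading matrices is injective on sections: the components of a
section in its kernel vanish successively in every degree. -/
theorem pullback_eq_zero {V : Opens M} (hVW : V ≤ W) (hVψ : V.comap (SuperSpace.base ψ) ≤ W)
    (hsurj : Function.Surjective (SuperSpace.base ψ))
    (hdet : ∀ x (hx : x ∈ V.comap (SuperSpace.base ψ)),
      (((PointHom.ofCoord θ (hVψ hx)).comp ψ).leadMatrix θ (hVW hx)).det ≠ 0)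
    {s : M.Sec V} (hs : SuperSpace.pullback ψ V s = 0) : s = 0 := by
  have key : ∀ l : ℕ, ∀ z (hz : z ∈ V), θ.ev (hVW hz) hz s ∈ degFiltration n l := by
    intro l
    induction l with
    | zero => exact fun z hz => mem_degFiltration_zero _
    | succ l ih =>
      intro z hz
      obtain ⟨x, rfl⟩ := hsurj z
      have hx : x ∈ V.comap (SuperSpace.base ψ) := hz
      have h0 : ((PointHom.ofCoord θ (hVψ hx)).comp ψ).hom V hz s = 0 := by
        change θ.ev (hVψ hx) hx (SuperSpace.pullback ψ V s) = 0
        rw [hs, map_zero]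
      have hv : Matrix.vecMul
          (fun ν => if ν.card = l then gcoeff ν (θ.ev (hVW hz) hz s) else 0)
          (((PointHom.ofCoord θ (hVψ hx)).comp ψ).leadMatrix θ (hVW hz)) = 0 := by
        funext μ
        by_cases hμ : μ.card = l
        · rw [← PointHom.gcoeff_hom_eq _ θ hVW hz s ih μ hμ, h0]; exact map_zero _
        · rw [Pi.zero_apply, Matrix.vecMul, dotProduct]
          refine Finset.sum_eq_zero fun ν _ => ?_
          by_cases hν : ν.card = l
          · rw [PointHom.leadMatrix, Matrix.of_apply, if_neg (by omega : ¬ν.card = μ.card),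
              mul_zero]
          · simp only [if_neg hν, zero_mul]
      have hv0 := Matrix.eq_zero_of_vecMul_eq_zero (hdet x hx) hv
      refine mem_degFiltration.2 fun ν hν => ?_
      rcases Nat.lt_succ_iff_lt_or_eq.1 hν with h | h
      · exact mem_degFiltration.1 (ih _ hz) ν h
      · have := congrFun hv0 ν
        simpa only [if_pos h, Pi.zero_apply] using this
  exact θ.sec_ext hVW fun z hz => by
    rw [map_zero]; exact eq_zero_of_mem_degFiltration (key _ z hz)

/-- A morphism with invertible leading matrices and with a holomorphic inverse on the underlying
space is surjective on sections: a preimage is found successively in every degree. -/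
theorem exists_pullback_eq {V : Opens M} (hVW : V ≤ W) (hVψ : V.comap (SuperSpace.base ψ) ≤ W)
    {h : M → M} (hh : ContMDiff 𝓘(ℂ, EuclideanSpace ℂ (Fin m)) 𝓘(ℂ, EuclideanSpace ℂ (Fin m)) ω h)
    (hψh : ∀ x, SuperSpace.base ψ (h x) = x) (hhψ : ∀ x, h (SuperSpace.base ψ x) = x)
    (hdet : ∀ x (hx : x ∈ V.comap (SuperSpace.base ψ)),
      (((PointHom.ofCoord θ (hVψ hx)).comp ψ).leadMatrix θ (hVW hx)).det ≠ 0)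
    (f : M.Sec (V.comap (SuperSpace.base ψ))) :
    ∃ s : M.Sec V, SuperSpace.pullback ψ V s = f := by
  classical
  -- the leading matrices, as a matrix of holomorphic functions
  let T : Matrix (Finset (Fin n)) (Finset (Fin n)) (Hol m (V.comap (SuperSpace.base ψ))) :=
    Matrix.of fun ν μ => if ν.card = μ.card then θ.coeff hVψ
      (SuperSpace.pullback ψ V (M.res hVW (θ.equiv W le_rfl (1 ⊗ₜ grassmannBasis n ν)))) μ else 0
  have hT : ∀ ν μ, T ν μ = if ν.card = μ.card then θ.coeff hVψ
      (SuperSpace.pullback ψ V (M.res hVW (θ.equiv W le_rfl (1 ⊗ₜ grassmannBasis n ν)))) μ else 0 :=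
    fun ν μ => rfl
  have hTev : ∀ x (hx : x ∈ V.comap (SuperSpace.base ψ)), T.map (Hol.eval ⟨x, hx⟩) =
      ((PointHom.ofCoord θ (hVψ hx)).comp ψ).leadMatrix θ (hVW hx) := by
    intro x hx
    ext ν μ
    rw [Matrix.map_apply, hT, PointHom.leadMatrix, Matrix.of_apply]
    split_ifs with hc
    · rw [Hol.eval_apply, ← θ.gcoeff_ev hVψ (hVψ hx), pullback_res, θ.ev_res]; rfl
    · rw [map_zero]
  have hTdet : IsUnit T.det := by
    refine Hol.isUnit_of_ne_zero _ fun ⟨x, hx⟩ => ?_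
    rw [← Hol.eval_apply, AlgHom.map_det, AlgHom.mapMatrix_apply, hTev x hx]
    exact hdet x hx
  have key : ∀ l : ℕ, ∃ s : M.Sec V, ∀ x (hx : x ∈ V.comap (SuperSpace.base ψ)),
      θ.ev (hVψ hx) hx (f - SuperSpace.pullback ψ V s) ∈ degFiltration n l := by
    intro l
    induction l with
    | zero => exact ⟨0, fun x hx => mem_degFiltration_zero _⟩
    | succ l ih =>
      obtain ⟨s, hs⟩ := ih
      set f' := f - SuperSpace.pullback ψ V s with hf'
      let a : Finset (Fin n) → Hol m (V.comap (SuperSpace.base ψ)) :=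
        Matrix.vecMul (fun μ => θ.coeff hVψ f' μ) T⁻¹
      have ha : Matrix.vecMul a T = fun μ => θ.coeff hVψ f' μ := by
        rw [Matrix.vecMul_vecMul, Matrix.nonsing_inv_mul _ hTdet, Matrix.vecMul_one]
      let A : Finset (Fin n) → M → ℂ := fun ν x =>
        if hx : x ∈ V.comap (SuperSpace.base ψ) then a ν ⟨x, hx⟩ else 0
      have hA : ∀ ν x (hx : x ∈ V.comap (SuperSpace.base ψ)), A ν x = a ν ⟨x, hx⟩ :=
        fun ν x hx => dif_pos hx
      have hAc : ∀ ν, ContMDiffOn 𝓘(ℂ, EuclideanSpace ℂ (Fin m)) 𝓘(ℂ, ℂ) ω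
          (fun z => A ν (h z)) V := fun ν =>
        (Hol.contMDiffOn_of_eq (a ν) fun x => hA ν x x.2).comp hh.contMDiffOn fun z hz => by
          change SuperSpace.base ψ (h z) ∈ V
          rw [hψh]; exact hz
      let c : Finset (Fin n) → Hol m V := fun ν =>
        if ν.card = l then Hol.ofContMDiffOn _ (hAc ν) else 0
      have hc : ∀ ν z (hz : z ∈ V), c ν ⟨z, hz⟩ = if ν.card = l then A ν (h z) else 0 := by
        intro ν z hz
        by_cases hν : ν.card = l
        · simp only [c, if_pos hν]; rfl
        · simp only [c, if_neg hν]; rfl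
      set s' := θ.ofCoeff hVW c with hs'
      have hs'l : ∀ z (hz : z ∈ V), θ.ev (hVW hz) hz s' ∈ degFiltration n l := fun z hz =>
        mem_degFiltration.2 fun ν hν => by
          rw [hs', θ.gcoeff_ev_ofCoeff, hc, if_neg hν.ne]
      refine ⟨s + s', fun x hx => ?_⟩
      have hxV : SuperSpace.base ψ x ∈ V := hx
      have hev : θ.ev (hVψ hx) hx (f - SuperSpace.pullback ψ V (s + s')) =
          θ.ev (hVψ hx) hx f' - ((PointHom.ofCoord θ (hVψ hx)).comp ψ).hom V hxV s' := by
        rw [map_add, ← sub_sub, ← hf', map_sub]; rfl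
      rw [hev]
      refine mem_degFiltration.2 fun μ hμ => ?_
      rw [map_sub]
      rcases Nat.lt_succ_iff_lt_or_eq.1 hμ with hlt | heq
      · rw [mem_degFiltration.1 (hs x hx) μ hlt, mem_degFiltration.1
          (PointHom.hom_mem_degFiltration _ θ hVW hxV s' hs'l) μ hlt, sub_zero]
      · rw [PointHom.gcoeff_hom_eq _ θ hVW hxV s' hs'l μ heq, θ.gcoeff_ev hVψ, sub_eq_zero,
          ← hTev x hx, ← congrFun ha μ]
        rw [← Hol.eval_apply, Matrix.vecMul, Matrix.vecMul, dotProduct, dotProduct, map_sum]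
        refine Finset.sum_congr rfl fun ν _ => ?_
        rw [map_mul, Matrix.map_apply, hs', θ.gcoeff_ev_ofCoeff, hc, hhψ, hA ν x hx,
          Hol.eval_apply]
        by_cases hν : ν.card = l
        · rw [if_pos hν, if_pos hν]
        · rw [if_neg hν, zero_mul]
          rw [hT, if_neg (by omega), map_zero, mul_zero]
  obtain ⟨s, hs⟩ := key (n + 1)
  refine ⟨s, (sub_eq_zero.1 (θ.sec_ext hVψ fun x hx => ?_)).symm⟩
  rw [map_zero]
  exact eq_zero_of_mem_degFiltration (hs x hx)

end ComplexSupermanifold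

namespace ComplexSupermanifold

variable {m n : ℕ} {M : ComplexSupermanifold.{u} m n}

theorem isIso_of_bijective {ψ : M.space ⟶ M.space} (e : M ≃ₜ M) (he : ⇑e = SuperSpace.base ψ)
    (h : ∀ U : Opens M, Function.Bijective (SuperSpace.pullback ψ U)) : IsIso ψ := by
  have h1 : IsIso ψ.hom.base := by
    have : ψ.hom.base = (TopCat.isoOfHomeo e).hom := by
      ext x
      exact (congrFun he x).symm
    rw [this]; infer_instance
  have h2 : ∀ U, IsIso (ψ.hom.c.app U) := fun U =>
    (ConcreteCategory.isIso_iff_bijective _).2 (h U.unop)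
  have h3 : IsIso ψ.hom.c := NatIso.isIso_of_isIso_app _
  have h4 : IsIso ψ.hom := PresheafedSpace.isIso_of_components ψ.hom
  have h5 : IsIso (SheafedSpace.forgetToPresheafedSpace.map ψ) := h4
  exact isIso_of_reflects_iso ψ SheafedSpace.forgetToPresheafedSpace

theorem preservesParity_id : SuperSpace.PreservesParity (𝟙 M.space) := fun _ _ _ hf => hf

theorem preservesParity_comp {φ ψ : M.space ⟶ M.space} (hφ : SuperSpace.PreservesParity φ)
    (hψ : SuperSpace.PreservesParity ψ) : SuperSpace.PreservesParity (φ ≫ ψ) :=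
  fun U k f hf => hφ (U.comap (SuperSpace.base ψ)) k _ (hψ U k f hf)

theorem preservesParity_inv {ψ : M.space ⟶ M.space} [IsIso ψ] (hψ : SuperSpace.PreservesParity ψ) :
    SuperSpace.PreservesParity (inv ψ) := by
  intro U k f hf
  set V := U.comap (SuperSpace.base (inv ψ)) with hV
  set t := SuperSpace.pullback (inv ψ) U f with ht
  have hid : SuperSpace.PreservesParity (ψ ≫ inv ψ) := by
    rw [IsIso.hom_inv_id]; exact preservesParity_id
  have h1 : SuperSpace.pullback ψ V t ∈ M.parity (V.comap (SuperSpace.base ψ)) k := hid U k f hf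
  obtain ⟨q, hq, hr⟩ := exists_parity_decomposition t k
  have h0 : SuperSpace.pullback ψ V (t - q) = 0 := by
    refine eq_zero_of_mem_parity (zmod_two_ne_add_one k) ?_ (hψ V _ _ hr)
    rw [map_sub]
    exact sub_mem h1 (hψ V k q hq)
  have hinj : Function.Injective (SuperSpace.pullback ψ V) := by
    have : IsIso (ψ.hom.c.app (op V)) := by
      have : IsIso ψ.hom :=
        inferInstanceAs (IsIso (SheafedSpace.forgetToPresheafedSpace.map ψ))
      have := PresheafedSpace.c_isIso_of_iso ψ.hom
      exact NatIso.isIso_app_of_isIso ψ.hom.c (op V)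
    exact ((ConcreteCategory.isIso_iff_bijective _).1 this).1
  have h2 : t - q = 0 := hinj (by rw [h0, map_zero])
  rw [sub_eq_zero.1 h2]
  exact hq

/-- A morphism whose underlying map is biholomorphic and whose leading matrices are invertible in
suitable odd coordinates near every point is an isomorphism. -/
theorem isIso_of_leadMatrix {ψ : M.space ⟶ M.space} {h : M → M}
    (hh : ContMDiff 𝓘(ℂ, EuclideanSpace ℂ (Fin m)) 𝓘(ℂ, EuclideanSpace ℂ (Fin m)) ω h)
    (hψh : ∀ x, SuperSpace.base ψ (h x) = x) (hhψ : ∀ x, h (SuperSpace.base ψ x) = x)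
    (hdet : ∀ x : M, ∃ (W : Opens M) (θ : M.OddCoordinates m n W) (O : Opens M), x ∈ O ∧
      SuperSpace.base ψ x ∈ W ∧ O ≤ W ∧
      ∀ x' ∈ O, ∀ (hW : x' ∈ W) (hy : SuperSpace.base ψ x' ∈ W),
        (((PointHom.ofCoord θ hW).comp ψ).leadMatrix θ hy).det ≠ 0) : IsIso ψ := by
  have hsurj : Function.Surjective (SuperSpace.base ψ) := fun x => ⟨h x, hψh x⟩
  let e : M ≃ₜ M :=
    { toFun := SuperSpace.base ψ
      invFun := h
      left_inv := hhψ
      right_inv := hψh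
      continuous_toFun := (SuperSpace.base ψ).continuous
      continuous_invFun := hh.continuous }
  -- `ψ` is bijective on sections over the small open sets near any point
  have hloc : ∀ y : M, ∃ V : Opens M, y ∈ V ∧ ∀ V' ≤ V,
      (∀ s : M.Sec V', SuperSpace.pullback ψ V' s = 0 → s = 0) ∧
      ∀ f, ∃ s : M.Sec V', SuperSpace.pullback ψ V' s = f := by
    intro y
    obtain ⟨W, θ, O, hxO, hyW, hOW, hO⟩ := hdet (h y)
    rw [hψh] at hyW
    let h' : C(M, M) := ⟨h, hh.continuous⟩
    refine ⟨W ⊓ O.comap h', ⟨hyW, hxO⟩, fun V' hV' => ?_⟩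
    have hV'W : V' ≤ W := hV'.trans inf_le_left
    have hV'O : V'.comap (SuperSpace.base ψ) ≤ O := fun x hx => by
      have : h (SuperSpace.base ψ x) ∈ O := (hV' hx).2
      rwa [hhψ] at this
    have hd := fun x (hx : x ∈ V'.comap (SuperSpace.base ψ)) =>
      hO x (hV'O hx) (hOW (hV'O hx)) (hV'W hx)
    exact ⟨fun s hs => pullback_eq_zero θ hV'W (hV'O.trans hOW) hsurj hd hs,
      fun f => exists_pullback_eq θ hV'W (hV'O.trans hOW) hh hψh hhψ hd f⟩
  choose V hyV hV using hloc
  refine isIso_of_bijective e rfl fun U => ⟨?_, ?_⟩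
  · refine (injective_iff_map_eq_zero _).2 fun s hs => sec_eq_of_locally_eq fun y hy =>
      ⟨U ⊓ V y, inf_le_left, ⟨hy, hyV y⟩, ?_⟩
    rw [map_zero]
    refine (hV y (U ⊓ V y) inf_le_right).1 _ ?_
    rw [pullback_res, hs, map_zero]
  · intro f
    choose s hs using fun y : M => (hV y (U ⊓ V y) inf_le_right).2
      (M.res (comap_le_comap (SuperSpace.base ψ) inf_le_left) f)
    obtain ⟨t, ht⟩ := exists_glue (V := U) (fun y : M => U ⊓ V y) (fun y => inf_le_left)
      (fun y hy => ⟨y, hy, hyV y⟩) s fun i j => by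
        refine sub_eq_zero.1 ((hV i (U ⊓ V i ⊓ (U ⊓ V j)) (inf_le_left.trans inf_le_right)).1 _ ?_)
        rw [map_sub, pullback_res, pullback_res, hs, hs, res_res, res_res, sub_self]
    refine ⟨t, sec_eq_of_locally_eq fun x hx =>
      ⟨(U ⊓ V (SuperSpace.base ψ x)).comap (SuperSpace.base ψ), fun z hz => hz.1,
        ⟨hx, hyV _⟩, ?_⟩⟩
    rw [← hs, ← ht, pullback_res]

/-! ### Limits of holomorphic maps -/

/-- The underlying map of a morphism is holomorphic. -/
theorem contMDiff_base (φ : M.space ⟶ M.space) :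
    ContMDiff 𝓘(ℂ, EuclideanSpace ℂ (Fin m)) 𝓘(ℂ, EuclideanSpace ℂ (Fin m)) ω
      (SuperSpace.base φ) := by
  intro x
  set y := SuperSpace.base φ x with hy
  set e := chartAt (EuclideanSpace ℂ (Fin m)) y with he
  obtain ⟨W₀, hyW₀, ⟨θ₀⟩⟩ := M.exists_oddCoordinates y
  obtain ⟨W', hxW', ⟨θ'⟩⟩ := M.exists_oddCoordinates x
  let W : Opens M := W₀ ⊓ ⟨e.source, e.open_source⟩
  have hW : (W : Set M) ⊆ e.source := fun z hz => hz.2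
  let θ := θ₀.restrict (inf_le_left : W ≤ W₀)
  have hyW : y ∈ W := ⟨hyW₀, mem_chart_source _ y⟩
  let Y : Opens M := W' ⊓ W.comap (SuperSpace.base φ)
  have hxY : x ∈ Y := ⟨hxW', hyW⟩
  have h1 : ∀ k, ContMDiffAt 𝓘(ℂ, EuclideanSpace ℂ (Fin m)) 𝓘(ℂ, ℂ) ω
      (fun x' => (e (SuperSpace.base φ x')) k) x := by
    intro k
    refine ((contMDiffOn_gcoeff_pullbackVal φ θ' (θ.equiv W le_rfl (chartCoordHol hW k ⊗ₜ 1)) ∅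
      ).contMDiffAt (Y.2.mem_nhds hxY)).congr_of_eventuallyEq ?_
    filter_upwards [Y.2.mem_nhds hxY] with z hz
    have hzW : SuperSpace.base φ z ∈ W := hz.2
    rw [pullbackVal_eq φ θ' _ hz.1 hz.2]
    exact (((PointHom.ofCoord θ' hz.1).comp φ).gcoeff_empty_hol θ le_rfl hzW
      (chartCoordHol hW k)).symm
  have h2 : ContMDiffAt 𝓘(ℂ, EuclideanSpace ℂ (Fin m)) 𝓘(ℂ, EuclideanSpace ℂ (Fin m)) ω
      (fun x' => e (SuperSpace.base φ x')) x := by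
    have h3 := contMDiffAt_pi_space.2 h1
    have h4 := (EuclideanSpace.equiv (Fin m) ℂ).symm.toContinuousLinearMap.contMDiff (n := ω)
      |>.contMDiffAt.comp x h3
    exact h4
  have h5 : ContMDiffAt 𝓘(ℂ, EuclideanSpace ℂ (Fin m)) 𝓘(ℂ, EuclideanSpace ℂ (Fin m)) ω e.symm
      (e (SuperSpace.base φ x)) := contMDiffOn_chart_symm.contMDiffAt
    (e.open_target.mem_nhds (e.map_source (mem_chart_source _ y)))
  refine (h5.comp x h2).congr_of_eventuallyEq ?_
  filter_upwards [(SuperSpace.base φ).continuous.continuousAt.preimage_mem_nhds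
    (e.open_source.mem_nhds (mem_chart_source _ y))] with z hz
  exact (e.left_inv hz).symm

end ComplexSupermanifold

section Maps

variable {m : ℕ} {M : Type u} [TopologicalSpace M] [ChartedSpace (EuclideanSpace ℂ (Fin m)) M]

/-- The closed ball of centre `p` and radius `r` in the chart at `p`. It is compact if the target of
the chart contains the corresponding ball of `ℂᵐ`. -/
def chartClosedBall (p : M) (r : ℝ) : Set M :=
  (chartAt (EuclideanSpace ℂ (Fin m)) p).symm ''
    closedBall (chartAt (EuclideanSpace ℂ (Fin m)) p p) r

theorem isCompact_chartClosedBall {p : M} {r : ℝ}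
    (h : closedBall (chartAt (EuclideanSpace ℂ (Fin m)) p p) r ⊆
      (chartAt (EuclideanSpace ℂ (Fin m)) p).target) :
    IsCompact (chartClosedBall (m := m) p r) :=
  (isCompact_closedBall _ _).image_of_continuousOn
    ((chartAt (EuclideanSpace ℂ (Fin m)) p).continuousOn_symm.mono h)

theorem mem_chartClosedBall_iff {p : M} {r : ℝ}
    (h : closedBall (chartAt (EuclideanSpace ℂ (Fin m)) p p) r ⊆
      (chartAt (EuclideanSpace ℂ (Fin m)) p).target) {x : M} :
    x ∈ chartClosedBall (m := m) p r ↔ x ∈ (chartAt (EuclideanSpace ℂ (Fin m)) p).source ∧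
      chartAt (EuclideanSpace ℂ (Fin m)) p x ∈
        closedBall (chartAt (EuclideanSpace ℂ (Fin m)) p p) r := by
  constructor
  · rintro ⟨z, hz, rfl⟩
    refine ⟨(chartAt (EuclideanSpace ℂ (Fin m)) p).map_target (h hz), ?_⟩
    rwa [(chartAt (EuclideanSpace ℂ (Fin m)) p).right_inv (h hz)]
  · rintro ⟨h1, h2⟩
    exact ⟨_, h2, (chartAt (EuclideanSpace ℂ (Fin m)) p).left_inv h1⟩

/-- A pointwise limit of holomorphic maps which map a ball in a chart into a compact ball of the
same chart is holomorphic on the ball, and the convergence is locally uniform. -/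
theorem contMDiffOn_of_tendsto [T2Space M] [IsManifold 𝓘(ℂ, EuclideanSpace ℂ (Fin m)) ω M]
    {ι : Type*} {l : Filter ι} [l.NeBot] {b : ι → M → M} {g : M → M} {p : M} {r R : ℝ}
    (hb : ∀ i, ContMDiff 𝓘(ℂ, EuclideanSpace ℂ (Fin m)) 𝓘(ℂ, EuclideanSpace ℂ (Fin m)) ω (b i))
    (hg : ∀ x, Tendsto (b · x) l (𝓝 (g x)))
    (ht : closedBall (chartAt (EuclideanSpace ℂ (Fin m)) p p) R ⊆
      (chartAt (EuclideanSpace ℂ (Fin m)) p).target) (hrR : r ≤ R)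
    (hmaps : ∀ᶠ i in l, ∀ x ∈ chartBall p (chartAt (EuclideanSpace ℂ (Fin m)) p p) r,
      b i x ∈ chartClosedBall (m := m) p R) :
    ContMDiffOn 𝓘(ℂ, EuclideanSpace ℂ (Fin m)) 𝓘(ℂ, EuclideanSpace ℂ (Fin m)) ω g
      (chartBall p (chartAt (EuclideanSpace ℂ (Fin m)) p p) r) ∧
    ∀ x ∈ chartBall p (chartAt (EuclideanSpace ℂ (Fin m)) p p) r, ∀ U : Opens M, g x ∈ U →
      ∃ V : Opens M, x ∈ V ∧ ∀ᶠ i in l, ∀ x' ∈ V, b i x' ∈ U := by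
  set e := chartAt (EuclideanSpace ℂ (Fin m)) p with he
  set B := chartBall p (e p) r with hB
  have htr : ball (e p) r ⊆ e.target := ball_subset_closedBall.trans
    ((closedBall_subset_closedBall hrR).trans ht)
  have hsymm : ∀ z ∈ ball (e p) r, e.symm z ∈ B := fun z hz => chart_symm_mem_chartBall htr hz
  have hgL : ∀ x ∈ B, g x ∈ chartClosedBall (m := m) p R := fun x hx =>
    (isCompact_chartClosedBall ht).isClosed.mem_of_tendsto (hg x)
      (hmaps.mono fun i hi => hi x hx)
  have hgs : ∀ x ∈ B, g x ∈ e.source := fun x hx =>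
    ((mem_chartClosedBall_iff ht).1 (hgL x hx)).1
  have hf : ∀ᶠ i in l, AnalyticOnNhd ℂ (fun z => e (b i (e.symm z))) (ball (e p) r) := by
    filter_upwards [hmaps] with i hi
    have h1 : ContMDiffOn 𝓘(ℂ, EuclideanSpace ℂ (Fin m)) 𝓘(ℂ, EuclideanSpace ℂ (Fin m)) ω
        (fun x => e (b i x)) B :=
      contMDiffOn_chart.comp (hb i).contMDiffOn fun x hx =>
        ((mem_chartClosedBall_iff ht).1 (hi x hx)).1
    exact analyticOnNhd_comp_chart_symm h1 isOpen_ball htr hsymm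
  have hS : ∀ᶠ i in l, ∀ z ∈ ball (e p) r, ‖e (b i (e.symm z))‖ ≤ ‖e p‖ + R := by
    filter_upwards [hmaps] with i hi z hz
    have h1 := ((mem_chartClosedBall_iff ht).1 (hi _ (hsymm z hz))).2
    rw [mem_closedBall, dist_eq_norm] at h1
    calc ‖e (b i (e.symm z))‖ = ‖e p + (e (b i (e.symm z)) - e p)‖ := by rw [add_sub_cancel]
      _ ≤ _ := (norm_add_le _ _).trans (add_le_add le_rfl h1)
  have hlim : ∀ z ∈ ball (e p) r, Tendsto (fun i => e (b i (e.symm z))) l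
      (𝓝 (e (g (e.symm z)))) := fun z hz =>
    (e.continuousAt (hgs _ (hsymm z hz))).tendsto.comp (hg _)
  have hball : ∀ z ∈ ball (e p) r, ∃ r' > 0, ball z r' ⊆ ball (e p) r := fun z hz =>
    Metric.isOpen_iff.1 isOpen_ball z hz
  constructor
  · have hana : AnalyticOnNhd ℂ (fun z => e (g (e.symm z))) (ball (e p) r) := by
      intro z hz
      obtain ⟨r', hr', hsub⟩ := hball z hz
      exact analyticAt_of_tendsto hr' (hf.mono fun i hi => hi.mono hsub)
        (hS.mono fun i hi w hw => hi w (hsub hw)) fun w hw => hlim w (hsub hw)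
    have h1 := contMDiffOn_comp_chart hana p
    have h2 : ContMDiffOn 𝓘(ℂ, EuclideanSpace ℂ (Fin m)) 𝓘(ℂ, EuclideanSpace ℂ (Fin m)) ω
        (fun x => e.symm (e (g (e.symm (e x))))) B :=
      contMDiffOn_chart_symm.comp h1 fun x hx => e.map_source (by
        rw [e.left_inv hx.1]; exact hgs x hx)
    refine h2.congr fun x hx => ?_
    rw [e.left_inv hx.1, e.left_inv (hgs x hx)]
  · intro x hx U hU
    obtain ⟨r', hr', hsub⟩ := hball (e x) hx.2
    have hopen : IsOpen (e.target ∩ e.symm ⁻¹' U) := e.symm.isOpen_inter_preimage U.2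
    obtain ⟨ε, hε, hεsub⟩ := Metric.isOpen_iff.1 hopen (e (g x))
      ⟨e.map_source (hgs x hx), by rw [mem_preimage, e.left_inv (hgs x hx)]; exact hU⟩
    obtain ⟨δ, hδ, hδr, hδe⟩ := eventually_norm_sub_lt_of_tendsto hr'
      (hf.mono fun i hi => hi.mono hsub) (hS.mono fun i hi w hw => hi w (hsub hw))
      (fun w hw => hlim w (hsub hw)) hε
    have hVB : chartBall p (e x) δ ≤ B := chartBall_mono ((ball_subset_ball hδr.le).trans hsub)
    refine ⟨chartBall p (e x) δ, ⟨hx.1, mem_ball_self hδ⟩, ?_⟩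
    filter_upwards [hδe, hmaps] with i h1 h2 x' hx'
    have h3 := h1 (e x') hx'.2
    rw [e.left_inv hx'.1, e.left_inv hx.1] at h3
    have h4 := (hεsub (show e (b i x') ∈ ball (e (g x)) ε by rwa [mem_ball, dist_eq_norm])).2
    rwa [mem_preimage, e.left_inv ((mem_chartClosedBall_iff ht).1 (h2 x' (hVB hx'))).1] at h4

end Maps

namespace ComplexSupermanifold

variable {m n : ℕ} {M : ComplexSupermanifold.{u} m n}

/-! ### The topology of the automorphism group -/

theorem mem_basicSet_iff {K : Set M} {W : Opens M} {hKW : K ⊆ W} {U : Opens M} {f : M.Sec U}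
    {θ : M.OddCoordinates m n W} {O : Finset (Fin n) → Set ℂ} {φ : M.Aut₀} :
    φ ∈ M.basicSet K hKW U f θ O ↔ ∀ x ∈ K, φ.base x ∈ U ∧
      ∀ ν, gcoeff ν (pullbackVal φ.1.hom θ f x) ∈ O ν := by
  have key : ∀ x (hxW : x ∈ W) (hx : x ∈ U.comap φ.base) (hx' : x ∈ W ⊓ U.comap φ.base) ν,
      φ.coeff θ f ν ⟨x, hx'⟩ = gcoeff ν (pullbackVal φ.1.hom θ f x) := by
    intro x hxW hx hx' ν
    rw [pullbackVal_eq φ.1.hom θ f hxW hx, Aut₀.coeff, ← θ.gcoeff_ev inf_le_left hxW, θ.ev_res]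
    rfl
  constructor
  · rintro ⟨hU, h⟩ x hx
    refine ⟨hU hx, fun ν => ?_⟩
    rw [← key x (hKW hx) (hU hx) (mem_inf_of_mem (hKW hx) (hU hx)) ν]
    exact h ν x hx
  · intro h
    have hU : MapsTo φ.base K U := fun x hx => (h x hx).1
    refine ⟨hU, fun ν x hx => ?_⟩
    have := (h x hx).2 ν
    rwa [← key x (hKW hx) (hU hx) (mem_inf_of_mem (hKW hx) (hU hx)) ν] at this

theorem isOpen_basicSet {K : Set M} (hK : IsCompact K) {W : Opens M} (hKW : K ⊆ W) (U : Opens M)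
    (f : M.Sec U) (θ : M.OddCoordinates m n W) {O : Finset (Fin n) → Set ℂ}
    (hO : ∀ ν, IsOpen (O ν)) : IsOpen (M.basicSet K hKW U f θ O) :=
  isOpen_generateFrom_of_mem ⟨K, hK, W, hKW, U, f, θ, O, hO, rfl⟩

/-- The topology of `Aut₀` is finer than the compact-open topology on the underlying maps. -/
theorem isOpen_setOf_mapsTo {K : Set M} (hK : IsCompact K) (U : Opens M) :
    IsOpen {φ : M.Aut₀ | MapsTo φ.base K U} := by
  have : LocallyCompactSpace M := ChartedSpace.locallyCompactSpace (EuclideanSpace ℂ (Fin m)) M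
  -- prove openness at a given automorphism by covering `K` with small compact sets
  rw [isOpen_iff_mem_nhds]
  intro φ hφ
  suffices h : ∀ᶠ ψ : M.Aut₀ in 𝓝 φ, ∀ x ∈ K, ψ.base x ∈ U from h
  have hφ' : K ⊆ U.comap φ.base := hφ
  refine hK.induction_on (p := fun K => ∀ᶠ ψ : M.Aut₀ in 𝓝 φ, ∀ x ∈ K, ψ.base x ∈ U) ?_ ?_ ?_ ?_
  · exact Eventually.of_forall fun _ _ h => h.elim
  · exact fun S T hST hT => hT.mono fun ψ hψ x hx => hψ x (hST hx)
  · intro S T hS hT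
    filter_upwards [hS, hT] with ψ h1 h2 x hx
    exact hx.elim (h1 x) (h2 x)
  · intro x hx
    obtain ⟨W, hxW, ⟨θ⟩⟩ := M.exists_oddCoordinates x
    obtain ⟨L, hL, hxL, hLW⟩ := exists_compact_subset (W ⊓ U.comap φ.base).2
      (mem_inf_of_mem hxW (hφ' hx))
    refine ⟨L, mem_nhdsWithin_of_mem_nhds (mem_interior_iff_mem_nhds.1 hxL), ?_⟩
    have hopen := isOpen_basicSet hL (hLW.trans fun y hy => hy.1) U 0 θ (O := fun _ => univ)
      fun _ => isOpen_univ
    have hmem : φ ∈ M.basicSet L (hLW.trans fun y hy => hy.1) U 0 θ fun _ => univ :=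
      mem_basicSet_iff.2 fun y hy => ⟨(hLW hy).2, fun _ => mem_univ _⟩
    filter_upwards [hopen.mem_nhds hmem] with ψ hψ y hy
    exact (mem_basicSet_iff.1 hψ y hy).1

/-- A morphism is determined by its underlying map and by the values of the pullbacks of all
sections in odd coordinates. -/
theorem hom_ext {φ ψ : M.space ⟶ M.space} (hb : SuperSpace.base φ = SuperSpace.base ψ)
    (h : ∀ (W : Opens M) (θ : M.OddCoordinates m n W) (U : Opens M) (f : M.Sec U), ∀ x ∈ W,
      SuperSpace.base φ x ∈ U → pullbackVal φ θ f x = pullbackVal ψ θ f x) : φ = ψ := by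
  obtain ⟨⟨b, c⟩⟩ := φ
  obtain ⟨⟨b', c'⟩⟩ := ψ
  have hbb : b = b' := by
    ext x
    exact congrArg (fun g : C(M, M) => g x) hb
  subst hbb
  have hc : c = c' := by
    apply NatTrans.ext
    funext U
    ext f
    refine sec_ext fun W θ x hW hx => ?_
    have := h W θ U.unop f x hW hx
    have hx' : x ∈ U.unop.comap (SuperSpace.base (⟨⟨b, c⟩⟩ : M.space ⟶ M.space)) := hx
    have hx'' : x ∈ U.unop.comap (SuperSpace.base (⟨⟨b, c'⟩⟩ : M.space ⟶ M.space)) := hx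
    rw [pullbackVal_eq ⟨⟨b, c⟩⟩ θ f hW hx', pullbackVal_eq ⟨⟨b, c'⟩⟩ θ f hW hx''] at this
    exact this
  rw [hc]

instance : T2Space M.Aut₀ := by
  refine ⟨fun φ ψ hne => ?_⟩
  by_cases hb : SuperSpace.base φ.1.hom = SuperSpace.base ψ.1.hom
  · have : ∃ (W : Opens M) (θ : M.OddCoordinates m n W) (U : Opens M) (f : M.Sec U) (x : M),
        x ∈ W ∧ φ.base x ∈ U ∧ ∃ ν, gcoeff ν (pullbackVal φ.1.hom θ f x) ≠
          gcoeff ν (pullbackVal ψ.1.hom θ f x) := by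
      by_contra hcon
      push Not at hcon
      refine hne (Subtype.ext (Iso.ext (hom_ext hb fun W θ U f x hW hx => ?_)))
      exact gcoeff_ext fun ν => hcon W θ U f x hW hx ν
    obtain ⟨W, θ, U, f, x, hW, hx, ν, hν⟩ := this
    have hx' : ψ.base x ∈ U := by
      have : ψ.base x = φ.base x := congrArg (fun g : C(M, M) => g x) hb.symm
      rwa [this]
    obtain ⟨A, B, hA, hB, hφA, hψB, hAB⟩ := t2_separation hν
    have hKW : ({x} : Set M) ⊆ W := singleton_subset_iff.2 hW
    refine ⟨M.basicSet {x} hKW U f θ (fun μ => if μ = ν then A else univ),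
      M.basicSet {x} hKW U f θ (fun μ => if μ = ν then B else univ),
      isOpen_basicSet isCompact_singleton _ _ _ _ fun μ => ?_,
      isOpen_basicSet isCompact_singleton _ _ _ _ fun μ => ?_,
      mem_basicSet_iff.2 ?_, mem_basicSet_iff.2 ?_, ?_⟩
    · split_ifs; exacts [hA, isOpen_univ]
    · split_ifs; exacts [hB, isOpen_univ]
    · rintro _ rfl
      refine ⟨hx, fun μ => ?_⟩
      split_ifs with h
      · rw [h]; exact hφA
      · exact mem_univ _
    · rintro _ rfl
      refine ⟨hx', fun μ => ?_⟩
      split_ifs with h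
      · rw [h]; exact hψB
      · exact mem_univ _
    · refine disjoint_left.2 fun χ h1 h2 => ?_
      have h1' := (mem_basicSet_iff.1 h1 x rfl).2 ν
      have h2' := (mem_basicSet_iff.1 h2 x rfl).2 ν
      rw [if_pos rfl] at h1' h2'
      exact disjoint_left.1 hAB h1' h2'
  · obtain ⟨x, hx⟩ : ∃ x, φ.base x ≠ ψ.base x := by
      by_contra hcon
      push Not at hcon
      exact hb (ContinuousMap.ext hcon)
    obtain ⟨A, B, hA, hB, hφA, hψB, hAB⟩ := t2_separation hx
    refine ⟨_, _, isOpen_setOf_mapsTo (isCompact_singleton (x := x)) ⟨A, hA⟩,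
      isOpen_setOf_mapsTo (isCompact_singleton (x := x)) ⟨B, hB⟩, ?_, ?_, ?_⟩
    · rintro _ rfl; exact hφA
    · rintro _ rfl; exact hψB
    · exact disjoint_left.2 fun χ h1 h2 => disjoint_left.1 hAB (h1 rfl) (h2 rfl)

namespace Aut₀

/-- The composition of automorphisms: the first argument is applied last. -/
def comp (φ₀ φ : M.Aut₀) : M.Aut₀ :=
  ⟨φ.1 ≪≫ φ₀.1, preservesParity_comp φ.2.1 φ₀.2.1, preservesParity_comp φ₀.2.2 φ.2.2⟩

/-- The inverse automorphism. -/
def symm (φ : M.Aut₀) : M.Aut₀ := ⟨φ.1.symm, φ.2.2, φ.2.1⟩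

variable (M) in
/-- The identity automorphism. -/
def refl : M.Aut₀ := ⟨Iso.refl _, preservesParity_id, preservesParity_id⟩

theorem continuous_comp (φ₀ : M.Aut₀) : Continuous (comp φ₀) := by
  refine continuous_generateFrom_iff.2 ?_
  rintro _ ⟨K, hK, W, hKW, U, f, θ, O, hO, rfl⟩
  exact isOpen_basicSet hK hKW (U.comap φ₀.base) (φ₀.pullback U f) θ hO

theorem trans_trans_symm {C : Type*} [Category C] {X : C} (a b : X ≅ X) :
    (a ≪≫ b) ≪≫ b.symm = a := by
  ext; simp

/-- Left translations are homeomorphisms. -/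
def leftTranslation (φ₀ : M.Aut₀) : M.Aut₀ ≃ₜ M.Aut₀ where
  toFun := comp φ₀
  invFun := comp φ₀.symm
  left_inv φ := Subtype.ext (
    trans_trans_symm (X := M.space) φ.1 φ₀.1)
  right_inv φ := Subtype.ext (
    trans_trans_symm (X := M.space) φ.1 φ₀.1.symm)
  continuous_toFun := continuous_comp φ₀
  continuous_invFun := continuous_comp φ₀.symm

theorem leftTranslation_refl (φ₀ : M.Aut₀) : leftTranslation φ₀ (refl M) = φ₀ :=
  Subtype.ext (Iso.refl_trans (X := M.space) φ₀.1)

theorem base_symm_base (φ : M.Aut₀) (x : M) : φ.symm.base (φ.base x) = x := by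
  have := congrArg (fun f => SuperSpace.base f x) φ.1.hom_inv_id
  exact this

theorem base_base_symm (φ : M.Aut₀) (x : M) : φ.base (φ.symm.base x) = x :=
  φ.symm.base_symm_base x

theorem pullbackVal_refl {W : Opens M} (θ : M.OddCoordinates m n W) {U : Opens M} (f : M.Sec U)
    {x : M} (hW : x ∈ W) (hx : x ∈ U) : pullbackVal (refl M).1.hom θ f x = θ.ev hW hx f :=
  pullbackVal_eq (refl M).1.hom θ f hW hx

end Aut₀

/-! ### A compact neighbourhood of the identity -/

/-- The automorphisms converge in the topology of `Aut₀` if the data of a limit morphism are given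
and the limit morphism is an automorphism. -/
theorem LimitData.le_nhds {F : Ultrafilter M.Aut₀} {g : C(M, M)}
    (hL : LimitData F (fun φ => φ.1.hom) g) {ψ : M.Aut₀} (hψ : ψ.1.hom = hL.limit) :
    (F : Filter M.Aut₀) ≤ 𝓝 ψ := by
  refine tendsto_nhds_generateFrom_iff.2 ?_
  rintro _ ⟨K, hK, W, hKW, U, f, θ, O, hO, rfl⟩ hmem
  rw [mem_basicSet_iff] at hmem
  rw [hψ] at hmem
  have hgU : ∀ x ∈ K, x ∈ U.comap g := fun x hx => by
    have : SuperSpace.base ψ.1.hom x ∈ U := (hmem x hx).1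
    rw [hψ] at this
    exact this
  suffices h : ∀ᶠ φ : M.Aut₀ in F, ∀ x ∈ K, φ.base x ∈ U ∧
      ∀ ν, gcoeff ν (pullbackVal φ.1.hom θ f x) ∈ O ν from
    h.mono fun φ hφ => mem_basicSet_iff.2 hφ
  have hloc : ∀ x ∈ K, ∃ V ∈ 𝓝[K] x, ∀ᶠ φ : M.Aut₀ in F, ∀ x ∈ V, φ.base x ∈ U ∧
      ∀ ν, gcoeff ν (pullbackVal φ.1.hom θ f x) ∈ O ν := by
    intro x hx
    have hxU := hgU x hx
    have hxO : ∀ ν, gcoeff ν (θ.ev (hKW hx) hxU (hL.limitSec f)) ∈ O ν := fun ν => by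
      have := (hmem x hx).2 ν
      rwa [pullbackVal_eq hL.limit θ f (hKW hx) hxU] at this
    choose ε hε hεO using fun ν => Metric.isOpen_iff.1 (hO ν) _ (hxO ν)
    obtain ⟨δ, hδ, hδε⟩ : ∃ δ > 0, ∀ ν, δ ≤ ε ν :=
      ⟨Finset.univ.inf' Finset.univ_nonempty ε, by simpa [Finset.lt_inf'_iff] using hε,
        fun ν => Finset.inf'_le _ (Finset.mem_univ ν)⟩
    obtain ⟨V, hxV, -, hev⟩ :=
      hL.locallyUniform (hL.isSectionLimit_limitSec f) θ (hKW hx) hxU hδ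
    refine ⟨V, mem_nhdsWithin_of_mem_nhds (V.2.mem_nhds hxV), hev.mono fun φ hφ z hz =>
      ⟨hφ.1 hz, fun ν => hεO ν ?_⟩⟩
    rw [mem_ball, dist_eq_norm]
    exact (hφ.2 z hz ν).trans_le (hδε ν)
  refine hK.induction_on (p := fun K => ∀ᶠ φ : M.Aut₀ in F, ∀ x ∈ K, φ.base x ∈ U ∧
      ∀ ν, gcoeff ν (pullbackVal φ.1.hom θ f x) ∈ O ν) ?_ ?_ ?_ hloc
  · exact Eventually.of_forall fun φ x hx => hx.elim
  · exact fun S T hST hT => hT.mono fun φ hφ x hx => hφ x (hST hx)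
  · intro S T hS hT
    filter_upwards [hS, hT] with φ h1 h2 x hx using hx.elim (h1 x) (h2 x)

variable (M) in
/-- A ball in the chart at `p`, together with odd coordinates on a neighbourhood of the closed ball
of twice the radius. -/
structure CoordBall (p : M) where
  /-- The radius. -/
  r : ℝ
  r_pos : 0 < r
  /-- The domain of the odd coordinates. -/
  W : Opens M
  /-- The odd coordinates. -/
  θ : M.OddCoordinates m n W
  subset_source : (W : Set M) ⊆ (chartAt (EuclideanSpace ℂ (Fin m)) p).source
  closedBall_subset : closedBall (chartAt (EuclideanSpace ℂ (Fin m)) p p) (2 * r) ⊆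
    (chartAt (EuclideanSpace ℂ (Fin m)) p).target
  chartClosedBall_subset : chartClosedBall (m := m) p (2 * r) ⊆ W

theorem nonempty_coordBall (p : M) : Nonempty (M.CoordBall p) := by
  set e := chartAt (EuclideanSpace ℂ (Fin m)) p with he
  obtain ⟨W, hpW, ⟨θ⟩⟩ := M.exists_oddCoordinates p
  let W' : Opens M := W ⊓ ⟨e.source, e.open_source⟩
  have hopen : IsOpen (e.target ∩ e.symm ⁻¹' W') := e.symm.isOpen_inter_preimage W'.2
  obtain ⟨R, hR, hRsub⟩ := Metric.isOpen_iff.1 hopen (e p) ⟨mem_chart_target _ p, by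
    rw [mem_preimage, e.left_inv (mem_chart_source _ p)]; exact ⟨hpW, mem_chart_source _ p⟩⟩
  have hsub : closedBall (e p) (2 * (R / 4)) ⊆ ball (e p) R :=
    closedBall_subset_ball (by linarith)
  exact ⟨⟨R / 4, by positivity, W', θ.restrict inf_le_left, fun x hx => hx.2,
    fun z hz => (hRsub (hsub hz)).1, by
      rintro _ ⟨z, hz, rfl⟩
      exact (hRsub (hsub hz)).2⟩⟩

namespace CoordBall

variable {p : M} (D : M.CoordBall p)

/-- The open ball. -/
def ball : Opens M := chartBall p (chartAt (EuclideanSpace ℂ (Fin m)) p p) D.r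

/-- The closed ball of twice the radius. -/
def big : Set M := chartClosedBall (m := m) p (2 * D.r)

theorem self_mem_ball : p ∈ D.ball := ⟨mem_chart_source _ p, mem_ball_self D.r_pos⟩

theorem isCompact_big : IsCompact D.big := isCompact_chartClosedBall D.closedBall_subset

theorem big_subset : D.big ⊆ D.W := D.chartClosedBall_subset

theorem ball_subset_big : (D.ball : Set M) ⊆ D.big := fun _ hx =>
  (mem_chartClosedBall_iff D.closedBall_subset).2
    ⟨hx.1, ball_subset_closedBall.trans
      (closedBall_subset_closedBall (by linarith [D.r_pos])) hx.2⟩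

/-- The `k`-th even coordinate as a section. -/
def even (k : Fin m) : M.Sec D.W := D.θ.equiv D.W le_rfl (chartCoordHol D.subset_source k ⊗ₜ 1)

/-- The monomials in the odd coordinates as sections. -/
def odd (μ : Finset (Fin n)) : M.Sec D.W := D.θ.equiv D.W le_rfl (1 ⊗ₜ grassmannBasis n μ)

/-- A strict bound for the coordinates on the closed ball of radius `r`. -/
def bound : ℝ := ‖chartAt (EuclideanSpace ℂ (Fin m)) p p‖ + D.r + 1

theorem bound_nonneg : 0 ≤ D.bound := by
  have := D.r_pos
  unfold bound
  positivity

/-- The pullbacks of the coordinates satisfy the bounds which define the neighbourhood of the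
identity. The leading matrices have `2 ^ n` columns, so that the bound `1 / 2 ^ (n + 1)` makes them
strictly diagonally dominant. -/
structure IsSmall (φ : M.space ⟶ M.space) : Prop where
  mem_big : ∀ x ∈ D.ball, SuperSpace.base φ x ∈ D.big
  even_le : ∀ x ∈ D.ball, ∀ k ν, ‖gcoeff ν (pullbackVal φ D.θ (D.even k) x)‖ ≤ D.bound
  odd_le : ∀ x ∈ D.ball, ∀ μ ν,
    ‖gcoeff ν (pullbackVal φ D.θ (D.odd μ) x) - if μ = ν then 1 else 0‖ ≤ 1 / 2 ^ (n + 1)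

/-- The automorphisms which are close to the identity on the ball. -/
def nearOne : Set M.Aut₀ := {φ | D.IsSmall φ.1.hom ∧ ∀ x ∈ D.ball, φ.symm.base x ∈ D.big}

theorem nearOne_mem_nhds [CompactSpace M] : D.nearOne ∈ 𝓝 (Aut₀.refl M) := by
  set e := chartAt (EuclideanSpace ℂ (Fin m)) p with he
  have hr := D.r_pos
  have hcl : closedBall (e p) D.r ⊆ closedBall (e p) (2 * D.r) :=
    closedBall_subset_closedBall (by linarith)
  set K : Set M := chartClosedBall (m := m) p D.r with hKdef
  have hKt : closedBall (e p) D.r ⊆ e.target := hcl.trans D.closedBall_subset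
  have hK : IsCompact K := isCompact_chartClosedBall hKt
  have hKbig : K ⊆ D.big := image_mono hcl
  have hKW : K ⊆ D.W := hKbig.trans D.big_subset
  have hBK : (D.ball : Set M) ⊆ K := fun x hx =>
    (mem_chartClosedBall_iff hKt).2 ⟨hx.1, ball_subset_closedBall hx.2⟩
  set B₂ : Opens M := chartBall p (e p) (2 * D.r) with hB₂
  have hB₂big : (B₂ : Set M) ⊆ D.big := fun x hx =>
    (mem_chartClosedBall_iff D.closedBall_subset).2 ⟨hx.1, ball_subset_closedBall hx.2⟩
  have hKB₂ : K ⊆ B₂ := fun x hx => by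
    obtain ⟨h1, h2⟩ := (mem_chartClosedBall_iff hKt).1 hx
    exact ⟨h1, closedBall_subset_ball (by linarith) h2⟩
  have h1 : ∀ᶠ φ : M.Aut₀ in 𝓝 (Aut₀.refl M), MapsTo φ.base K B₂ :=
    (isOpen_setOf_mapsTo hK B₂).mem_nhds hKB₂
  -- a condition on `φ` itself which implies that the inverse maps the ball into `B₂`
  have h2 : ∀ᶠ φ : M.Aut₀ in 𝓝 (Aut₀.refl M), MapsTo φ.base (B₂ : Set M)ᶜ Kᶜ :=
    (isOpen_setOf_mapsTo B₂.2.isClosed_compl.isCompact ⟨Kᶜ, hK.isClosed.isOpen_compl⟩).mem_nhds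
      (compl_subset_compl.2 hKB₂)
  have h3 : ∀ k, ∀ᶠ φ : M.Aut₀ in 𝓝 (Aut₀.refl M), ∀ x ∈ K, ∀ ν,
      ‖gcoeff ν (pullbackVal φ.1.hom D.θ (D.even k) x)‖ ≤ D.bound := by
    intro k
    have hmem : Aut₀.refl M ∈ M.basicSet K hKW D.W (D.even k) D.θ
        fun _ => Metric.ball 0 D.bound := by
      refine mem_basicSet_iff.2 fun x hx => ⟨hKW hx, fun ν => ?_⟩
      rw [Aut₀.pullbackVal_refl D.θ _ (hKW hx) (hKW hx), even, D.θ.ev_equiv_tmul, map_smul,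
        mem_ball_zero_iff, norm_smul]
      have hx2 := ((mem_chartClosedBall_iff hKt).1 hx).2
      rw [mem_closedBall, dist_eq_norm] at hx2
      have hc : ‖(e x) k‖ ≤ ‖e p‖ + D.r := by
        refine (PiLp.norm_apply_le (e x) k).trans ?_
        calc ‖e x‖ = ‖e p + (e x - e p)‖ := by rw [add_sub_cancel]
          _ ≤ _ := (norm_add_le _ _).trans (by gcongr)
      have h1 : ‖gcoeff ν (1 : Grassmann n)‖ ≤ 1 := by
        rw [← map_one (algebraMap ℂ (Grassmann n)), gcoeff_algebraMap]
        split_ifs <;> simp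
      calc _ ≤ (‖e p‖ + D.r) * 1 := mul_le_mul hc h1 (norm_nonneg _) (by positivity)
        _ < D.bound := by unfold bound; linarith
    filter_upwards [(isOpen_basicSet hK hKW D.W (D.even k) D.θ fun _ => isOpen_ball).mem_nhds
      hmem] with φ hφ x hx ν
    exact (mem_ball_zero_iff.1 ((mem_basicSet_iff.1 hφ x hx).2 ν)).le
  have h4 : ∀ μ, ∀ᶠ φ : M.Aut₀ in 𝓝 (Aut₀.refl M), ∀ x ∈ K, ∀ ν,
      ‖gcoeff ν (pullbackVal φ.1.hom D.θ (D.odd μ) x) - if μ = ν then 1 else 0‖ ≤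
        1 / 2 ^ (n + 1) := by
    intro μ
    have hmem : Aut₀.refl M ∈ M.basicSet K hKW D.W (D.odd μ) D.θ
        fun ν => Metric.ball (if μ = ν then 1 else 0) (1 / 2 ^ (n + 1)) := by
      refine mem_basicSet_iff.2 fun x hx => ⟨hKW hx, fun ν => ?_⟩
      rw [Aut₀.pullbackVal_refl D.θ _ (hKW hx) (hKW hx), odd, D.θ.ev_equiv_tmul]
      have : (1 : Hol m D.W) ⟨x, hKW hx⟩ = 1 := rfl
      rw [this, one_smul, gcoeff_basis]
      exact mem_ball_self (by positivity)
    filter_upwards [(isOpen_basicSet hK hKW D.W (D.odd μ) D.θ fun _ => isOpen_ball).mem_nhds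
      hmem] with φ hφ x hx ν
    exact (mem_ball_iff_norm.1 ((mem_basicSet_iff.1 hφ x hx).2 ν)).le
  filter_upwards [h1, h2, eventually_all.2 h3, eventually_all.2 h4] with φ hφ1 hφ2 hφ3 hφ4
  refine ⟨⟨fun x hx => hB₂big (hφ1 (hBK hx)), fun x hx k => hφ3 k x (hBK hx),
    fun x hx μ => hφ4 μ x (hBK hx)⟩, fun x hx => ?_⟩
  by_contra hcon
  refine hφ2 (x := φ.symm.base x) (fun h => hcon (hB₂big h)) ?_
  rw [φ.base_base_symm]
  exact hBK hx

/-- The leading matrices are strictly diagonally dominant. -/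
theorem IsSmall.det_leadMatrix_ne_zero {D : M.CoordBall p} {φ : M.space ⟶ M.space}
    (h : D.IsSmall φ) {x : M} (hx : x ∈ D.ball) (hW : x ∈ D.W) (hy : SuperSpace.base φ x ∈ D.W) :
    (((PointHom.ofCoord D.θ hW).comp φ).leadMatrix D.θ hy).det ≠ 0 := by
  set ε : ℝ := 1 / 2 ^ (n + 1) with hε
  set A := ((PointHom.ofCoord D.θ hW).comp φ).leadMatrix D.θ hy with hA
  have hy' : x ∈ D.W.comap (SuperSpace.base φ) := hy
  have hentry : ∀ μ ν, ‖A μ ν - if μ = ν then 1 else 0‖ ≤ ε := by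
    intro μ ν
    by_cases hc : μ.card = ν.card
    · have : A μ ν = gcoeff ν (pullbackVal φ D.θ (D.odd μ) x) := by
        rw [pullbackVal_eq φ D.θ _ hW hy', hA, PointHom.leadMatrix, Matrix.of_apply, if_pos hc]
        rfl
      rw [this]
      exact h.odd_le x hx μ ν
    · have hne : μ ≠ ν := fun h => hc (h ▸ rfl)
      rw [hA, PointHom.leadMatrix, Matrix.of_apply, if_neg hc, if_neg hne, sub_zero, norm_zero]
      positivity
  refine det_ne_zero_of_sum_row_lt_diag fun μ => ?_
  have hdiag : 1 - ε ≤ ‖A μ μ‖ := by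
    have h1 := hentry μ μ
    rw [if_pos rfl] at h1
    have h2 : ‖(1 : ℂ)‖ ≤ ‖A μ μ‖ + ‖A μ μ - 1‖ := by
      calc ‖(1 : ℂ)‖ = ‖A μ μ - (A μ μ - 1)‖ := by rw [sub_sub_cancel]
        _ ≤ _ := norm_sub_le _ _
    rw [norm_one] at h2
    linarith
  have hsum : ∑ ν ∈ Finset.univ.erase μ, ‖A μ ν‖ ≤ ∑ _ν ∈ Finset.univ.erase μ, ε :=
    Finset.sum_le_sum fun ν hν => by
      have h1 := hentry μ ν
      rwa [if_neg (Finset.ne_of_mem_erase hν).symm, sub_zero] at h1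
  rw [Finset.sum_const, Finset.card_erase_of_mem (Finset.mem_univ _), Finset.card_univ,
    Fintype.card_finset, Fintype.card_fin, nsmul_eq_mul, Nat.cast_sub Nat.one_le_two_pow] at hsum
  refine hsum.trans_lt (lt_of_lt_of_le ?_ hdiag)
  have h2 : (2 : ℝ) ^ n * ε = 1 / 2 := by
    rw [hε, pow_succ]; field_simp
  push_cast
  linarith

end CoordBall

/-- A family of holomorphic maps, all of which map the balls of a finite cover into fixed compact
coordinate balls, converges to a holomorphic map locally uniformly along any ultrafilter. -/
theorem exists_limit_base [CompactSpace M] {ι : Type*} {F : Ultrafilter ι} {b : ι → M → M}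
    (hb : ∀ i, ContMDiff 𝓘(ℂ, EuclideanSpace ℂ (Fin m)) 𝓘(ℂ, EuclideanSpace ℂ (Fin m)) ω (b i))
    (D : ∀ p : M, M.CoordBall p) {t : Finset M} (ht : ∀ x, ∃ p ∈ t, x ∈ (D p).ball)
    (hmaps : ∀ᶠ i in (F : Filter ι), ∀ p ∈ t, ∀ x ∈ (D p).ball, b i x ∈ (D p).big) :
    ∃ g : M → M, ContMDiff 𝓘(ℂ, EuclideanSpace ℂ (Fin m)) 𝓘(ℂ, EuclideanSpace ℂ (Fin m)) ω g ∧
      (∀ x, Tendsto (fun i => b i x) F (𝓝 (g x))) ∧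
      ∀ (x : M) (U : Opens M), g x ∈ U →
        ∃ V : Opens M, x ∈ V ∧ ∀ᶠ i in (F : Filter ι), ∀ x' ∈ V, b i x' ∈ U := by
  have hlim : ∀ x : M, ∃ y, Tendsto (fun i => b i x) F (𝓝 y) := fun x => by
    obtain ⟨y, -, hy⟩ := isCompact_univ.ultrafilter_le_nhds (F.map fun i => b i x) (by simp)
    exact ⟨y, hy⟩
  choose g hg using hlim
  have key := fun p (hp : p ∈ t) => contMDiffOn_of_tendsto (r := (D p).r) hb hg
    (D p).closedBall_subset (by linarith [(D p).r_pos]) (hmaps.mono fun i hi => hi p hp)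
  refine ⟨g, fun x => ?_, hg, fun x U hU => ?_⟩
  · obtain ⟨p, hp, hx⟩ := ht x
    exact (key p hp).1.contMDiffAt ((D p).ball.2.mem_nhds hx)
  · obtain ⟨p, hp, hx⟩ := ht x
    exact (key p hp).2 x hx U hU

theorem comp_limit_eq {ι : Type*} {F : Ultrafilter ι} {b c : ι → M → M} {g h : M → M}
    (hbc : ∀ i x, b i (c i x) = x) (hh : ∀ x, Tendsto (fun i => c i x) F (𝓝 (h x)))
    (hg : ∀ (x : M) (U : Opens M), g x ∈ U →
      ∃ V : Opens M, x ∈ V ∧ ∀ᶠ i in (F : Filter ι), ∀ x' ∈ V, b i x' ∈ U) (x : M) :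
    g (h x) = x := by
  by_contra hne
  obtain ⟨V, hxV, hV⟩ := hg (h x) ⟨{x}ᶜ, isOpen_compl_singleton⟩ hne
  obtain ⟨i, hi, hi'⟩ := (hV.and ((hh x).eventually (V.2.mem_nhds hxV))).exists
  exact hi _ hi' (hbc i x)

/-- The compactness theorem: the automorphisms which are close to the identity on the balls of a
finite cover form a compact set. -/
theorem isCompact_iInter_nearOne [CompactSpace M] (D : ∀ p : M, M.CoordBall p) {t : Finset M}
    (ht : ∀ x, ∃ p ∈ t, x ∈ (D p).ball) : IsCompact (⋂ p ∈ t, (D p).nearOne) := by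
  refine isCompact_iff_ultrafilter_le_nhds.2 fun F hF => ?_
  have hN : ∀ᶠ φ : M.Aut₀ in F, ∀ p ∈ t, φ ∈ (D p).nearOne := by
    filter_upwards [le_principal_iff.1 hF] with φ hφ using mem_iInter₂.1 hφ
  obtain ⟨g, hgh, hg, hge⟩ := exists_limit_base (F := F) (b := fun φ : M.Aut₀ => φ.base)
    (fun φ => contMDiff_base φ.1.hom) D ht
    (hN.mono fun φ hφ p hp => (hφ p hp).1.mem_big)
  obtain ⟨h, hhh, hh, hhe⟩ := exists_limit_base (F := F) (b := fun φ : M.Aut₀ => φ.symm.base)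
    (fun φ => contMDiff_base φ.symm.1.hom) D ht
    (hN.mono fun φ hφ p hp => (hφ p hp).2)
  have hgh' : ∀ x, g (h x) = x := comp_limit_eq (fun φ : M.Aut₀ => φ.base_base_symm) hh hge
  have hhg' : ∀ x, h (g x) = x := comp_limit_eq (fun φ : M.Aut₀ => φ.base_symm_base) hg hhe
  let g' : C(M, M) := ⟨g, hgh.continuous⟩
  have hgbig : ∀ p ∈ t, ∀ x ∈ (D p).ball, g x ∈ (D p).big := fun p hp x hx =>
    (D p).isCompact_big.isClosed.mem_of_tendsto (hg x)
      (hN.mono fun φ hφ => (hφ p hp).1.mem_big x hx)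
  have hL : LimitData F (fun φ : M.Aut₀ => φ.1.hom) g' := by
    refine ⟨hge, fun x => ?_⟩
    obtain ⟨p, hp, hx⟩ := ht x
    have hb := (D p).bound_nonneg
    refine ⟨p, (D p).W, (D p).θ, (D p).subset_source, (D p).W, (D p).θ,
      2 ^ n * ((D p).bound + 2), (D p).ball, (D p).big_subset (hgbig p hp x hx),
      (D p).big_subset ((D p).ball_subset_big hx), hx, by positivity, ?_⟩
    filter_upwards [hN] with φ hφ x' hx' hW hy
    have hS := (hφ p hp).1
    have hy' : x' ∈ (D p).W.comap (SuperSpace.base φ.1.hom) := hy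
    refine ⟨fun k => gnorm_le_of_norm_gcoeff_le fun ν => ?_,
      fun μ => gnorm_le_of_norm_gcoeff_le fun ν => ?_⟩
    · have h1 := hS.even_le x' hx' k ν
      rw [pullbackVal_eq φ.1.hom (D p).θ _ hW hy'] at h1
      have h2 : _ ≤ (D p).bound := h1
      exact h2.trans (by linarith)
    · have h1 := hS.odd_le x' hx' μ ν
      rw [pullbackVal_eq φ.1.hom (D p).θ _ hW hy'] at h1
      have h2 : ‖(if μ = ν then 1 else 0 : ℂ)‖ ≤ 1 := by split_ifs <;> simp
      have h3 : (1 : ℝ) / 2 ^ (n + 1) ≤ 1 :=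
        (div_le_one (by positivity)).2 (one_le_pow₀ one_le_two)
      have h4 := (norm_le_norm_sub_add _ (if μ = ν then 1 else 0 : ℂ)).trans
        (add_le_add (h1.trans h3) h2)
      exact h4.trans (by linarith)
  have hsmall : ∀ p ∈ t, (D p).IsSmall hL.limit := by
    intro p hp
    have hxU : ∀ x ∈ (D p).ball, x ∈ (D p).W.comap g' := fun x hx =>
      (D p).big_subset (hgbig p hp x hx)
    have hxW : ∀ x ∈ (D p).ball, x ∈ (D p).W := fun x hx =>
      (D p).big_subset ((D p).ball_subset_big hx)
    refine ⟨hgbig p hp, fun x hx k ν => ?_, fun x hx μ ν => ?_⟩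
    · rw [pullbackVal_eq hL.limit (D p).θ _ (hxW x hx) (hxU x hx)]
      exact le_of_tendsto (hL.tendsto_gcoeff _ (D p).θ (hxW x hx) (hxU x hx) ν).norm
        (hN.mono fun φ hφ => (hφ p hp).1.even_le x hx k ν)
    · rw [pullbackVal_eq hL.limit (D p).θ _ (hxW x hx) (hxU x hx)]
      exact le_of_tendsto
        ((hL.tendsto_gcoeff _ (D p).θ (hxW x hx) (hxU x hx) ν).sub_const _).norm
        (hN.mono fun φ hφ => (hφ p hp).1.odd_le x hx μ ν)
  have hiso : IsIso hL.limit := isIso_of_leadMatrix hhh hgh' hhg' fun x => by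
    obtain ⟨p, hp, hx⟩ := ht x
    exact ⟨(D p).W, (D p).θ, (D p).ball, hx, (D p).big_subset (hgbig p hp x hx),
      (D p).ball_subset_big.trans (D p).big_subset, fun x' hx' hW hy =>
        (hsmall p hp).det_leadMatrix_ne_zero hx' hW hy⟩
  have hpar : SuperSpace.PreservesParity hL.limit :=
    hL.preservesParity_limit fun φ => φ.2.1
  let ψ : M.Aut₀ := ⟨asIso hL.limit, hpar, preservesParity_inv hpar⟩
  have hψh : ∀ x, ψ.symm.base x = h x := fun x => by
    have h1 : g (ψ.symm.base x) = x := ψ.base_base_symm x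
    rw [← hhg' (ψ.symm.base x), h1]
  refine ⟨ψ, mem_iInter₂.2 fun p hp => ⟨hsmall p hp, fun x hx => ?_⟩, hL.le_nhds rfl⟩
  rw [hψh]
  exact (D p).isCompact_big.isClosed.mem_of_tendsto (hh x)
    (hN.mono fun φ hφ => (hφ p hp).2 x hx)

theorem exists_isCompact_mem_nhds_refl [CompactSpace M] :
    ∃ N : Set M.Aut₀, IsCompact N ∧ N ∈ 𝓝 (Aut₀.refl M) := by
  have D : ∀ p : M, M.CoordBall p := fun p => (nonempty_coordBall p).some
  obtain ⟨t, ht⟩ := isCompact_univ.elim_finite_subcover (fun p : M => ((D p).ball : Set M))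
    (fun p => (D p).ball.2) fun x _ => mem_iUnion.2 ⟨x, (D x).self_mem_ball⟩
  have ht' : ∀ x, ∃ p ∈ t, x ∈ (D p).ball := fun x => by
    simpa using ht (mem_univ x)
  exact ⟨_, isCompact_iInter_nearOne D ht',
    (biInter_finset_mem t).2 fun p _ => (D p).nearOne_mem_nhds⟩

/-- The translates of a compact neighbourhood of the identity are compact neighbourhoods. -/
instance [CompactSpace M] : WeaklyLocallyCompactSpace M.Aut₀ where
  exists_compact_mem_nhds φ := by
    obtain ⟨N, hN, hmem⟩ := exists_isCompact_mem_nhds_refl (M := M)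
    refine ⟨Aut₀.leftTranslation φ '' N, hN.image (Aut₀.leftTranslation φ).continuous, ?_⟩
    have h := (Aut₀.leftTranslation φ).isOpenMap.image_mem_nhds hmem
    rwa [Aut₀.leftTranslation_refl] at h

end ComplexSupermanifold

end Supergeometry

end

theorem mainTheorem7 (m n : ℕ) (M : Supergeometry.ComplexSupermanifold.{u} m n) [CompactSpace M] :
    LocallyCompactSpace M.Aut₀ :=
  inferInstance
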